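/- **Conventions.** Let $d\ge 1$. For a tempered distribution $u$ on $\mathbb R^d$ write $\widehat u$ for its Fourier transform, normalized by $\widehat u(\xi)=\int u(x)e^{-i x\cdot\xi}\,dx$. For $\sigma\in\mathbb R$, $H^\sigma=H^\sigma(\mathbb R^d)$ is the Sobolev space of those $u$ for which $\widehat u$ is a function and $\|u\|_{H^\sigma}^2:=(2\pi)^{-d}\int|\widehat u(\xi)|^2(1+\|\xi\|_2^2)^\sigma d\xi<\infty$; let $\langle\cdot,\cdot\rangle_{H^\sigma}$ be the corresponding inner product, and let $\langle f,g\rangle:=(2\pi)^{-d}\int\widehat f(\xi)\overline{\widehat g(\xi)}\,d\xi$ for $f\in H^{\sigma}$, $g\in H^{-\sigma}$. Let $M$ be an isotropic dilation matrix: a $d\times d$ integer matrix, all of whose eigenvalues have modulus $>1$, that is similar over $\mathbb C$ to a diagonal matrix whose diagonal entries all have modulus $m:=|\det M|^{1/d}$. For $s\in\mathbb R$, $j\in\mathbb N_0$, $k\in\mathbb Z^d$ put $u_{0,k}:=u(\cdot-k)$ and $u^{s}_{j,k}:=m^{j(d/2-s)}u(M^j\cdot-k)$. A *wavelet system* $X^s(\phi;\psi^1,\dots,\psi^L)$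 in $H^s$ is the family $\{\phi_{0,k}\}_{k}\cup\{\psi^{\ell,s}_{j,k}\}_{\ell,j,k}$ $(1\le\ell\le L,\ j\in\mathbb N_0,\ k\in\mathbb Z^d)$, where $\phi\in H^s$ is $M$-refinable, i.e. $\widehat\phi(M^T\xi)=\widehat a(\xi)\widehat\phi(\xi)$ a.e. for some $2\pi\mathbb Z^d$-periodic $\widehat a(\xi)=\sum_{k\in\mathbb Z^d}a[k]e^{ik\cdot\xi}$ (convergent in $L^2((-\pi,\pi]^d)$), and $\widehat{\psi^\ell}(M^T\xi)=\widehat{b^\ell}(\xi)\widehat\phi(\xi)$ a.e. with trigonometric polynomials $\widehat{b^\ell}(\xi)=\sum_k b^\ell[k]e^{ik\cdot\xi}$. It is an *$M$-framelet system* in $H^s$ if there are $C_1,C_2>0$ with $$C_1\|f\|_{H^s}^2\le\sum_{k}|\langle f,\phi_{0,k}\rangle_{H^s}|^2+\sum_{\ell=1}^L\sum_{j\ge0}\sum_{k}|\langle f,\psi^{\ell,s}_{j,k}\rangle_{H^s}|^2\le C_2\|f\|_{H^s}^2\qquad\text{for all }f\in H^s .$$ An $M$-framelet system $X^s(\phi;\psi^1,\dots,\psi^L)$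 in $H^s$ and an $M$-framelet system $X^{-s}(\widetilde\phi;\widetilde\psi^1,\dots,\widetilde\psi^L)$ in $H^{-s}$ form a *pair of dual $M$-framelet systems* in $(H^s,H^{-s})$ if for all $f\in H^s$, $g\in H^{-s}$ $$\langle f,g\rangle=\sum_{k}\langle\phi_{0,k},g\rangle\langle f,\widetilde\phi_{0,k}\rangle+\sum_{\ell=1}^L\sum_{j\ge0}\sum_{k}\langle\psi^{\ell,s}_{j,k},g\rangle\langle f,\widetilde\psi^{\ell,-s}_{j,k}\rangle .$$ A distribution $u$ has *$\kappa+1$ vanishing moments* $(\kappa\in\mathbb N_0)$ if $\widehat u$ is a function that is $C^\kappa$ near the origin (after a change on a null set) and $\partial^\alpha\widehat u(0)=0$ for every multi-index $\alpha$ with $|\alpha|\le\kappa$. **Theorem.** Let $\kappa\in\mathbb N_0$ and $0<s<\varsigma<\kappa+1$. Suppose that $X^{s}(\phi;\psi^1,\dots,\psi^L)$ and $X^{-s}(\widetilde\phi;\widetilde\psi^1,\dots,\widetilde\psi^L)$ form a pair of dual $M$-framelet systems in $(H^s,H^{-s})$, that $\phi\in H^\varsigma$, and that every $\widetilde\psi^\ell$,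 $1\le\ell\le L$, has $\kappa+1$ vanishing moments. For $N\in\mathbb N_0$ let $$\mathcal S^N_\phi f:=\sum_{k\in\mathbb Z^d}\langle f,\widetilde\phi_{0,k}\rangle\phi_{0,k}+\sum_{\ell=1}^L\sum_{j=0}^{N-1}\sum_{k\in\mathbb Z^d}\langle f,\widetilde\psi^{\ell,-s}_{j,k}\rangle\psi^{\ell,s}_{j,k}.$$ Then there is a constant $C(s,\varsigma)>0$, independent of $f$ and $N$, such that for every $f\in H^\varsigma$ and every $N\in\mathbb N_0$ the series over $k$ defining $\mathcal S^N_\phi f$ converge unconditionally in $H^s$ and $$\|(I-\mathcal S^N_\phi)f\|_{H^s}\le C(s,\varsigma)\,\|f\|_{H^\varsigma}\,m^{-N(\varsigma-s)/2}.$$ -/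

import Mathlib

open MeasureTheory Filter Topology
open scoped SchwartzMap FourierTransform ENNReal

noncomputable section

namespace Framelet

/-- Euclidean space `ℝ^d`. -/
abbrev Rd (d : ℕ) : Type := EuclideanSpace ℝ (Fin d)

/-- Complex-valued tempered distributions on `ℝ^d`. -/
abbrev Dist (d : ℕ) : Type := 𝓢'(Rd d, ℂ)

variable {d : ℕ}

/-! ## Fourier transforms and Sobolev spaces -/

/-- The (locally integrable) function `g` is the Fourier transform of the tempered distribution `u`
in the normalization `û(ξ) = ∫ u(x) e^{-i x·ξ} dx`. Mathlib's `𝓕` uses the kernel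
`e^{-2πi x·η}`, so that `(𝓕 u)(η) = û(2πη)`. -/
def IsFourierOf (u : Dist d) (g : Rd d → ℂ) : Prop :=
  AEStronglyMeasurable g volume ∧
    ∀ θ : 𝓢(Rd d, ℂ),
      Integrable (fun η : Rd d => θ η * g ((2 * Real.pi) • η)) volume ∧
        (𝓕 u) θ = ∫ η : Rd d, θ η * g ((2 * Real.pi) • η)

open Classical in
/-- The function `û` (well defined almost everywhere), for distributions `u` whose Fourier transform
is a function; every element of a Sobolev space `H^σ`, `σ ∈ ℝ`, is such. -/
def hat (u : Dist d) : Rd d → ℂ :=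
  if h : ∃ g, IsFourierOf u g then h.choose else 0

/-- `u ∈ H^σ(ℝ^d)`, for any real `σ`. -/
abbrev InH (σ : ℝ) (u : Dist d) : Prop := TemperedDistribution.MemSobolev σ 2 u

/-- The inner product of `H^σ(ℝ^d)`:
`(2π)^{-d} ∫ û(ξ) conj(v̂(ξ)) (1 + ‖ξ‖²)^σ dξ`. -/
def innerH (σ : ℝ) (u v : Dist d) : ℂ :=
  ((2 * Real.pi : ℂ) ^ d)⁻¹ *
    ∫ ξ : Rd d, hat u ξ * starRingEnd ℂ (hat v ξ) * (((1 + ‖ξ‖ ^ 2) ^ σ : ℝ) : ℂ)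

/-- The norm of `H^σ(ℝ^d)`: `(2π)^{-d/2} (∫ |û(ξ)|² (1 + ‖ξ‖²)^σ dξ)^{1/2}`. -/
def normH (σ : ℝ) (u : Dist d) : ℝ :=
  ((2 * Real.pi) ^ ((d : ℝ) / 2))⁻¹ *
    Real.sqrt (∫ ξ : Rd d, ‖hat u ξ‖ ^ 2 * (1 + ‖ξ‖ ^ 2) ^ σ)

/-- The pairing of `H^σ(ℝ^d)` with `H^{-σ}(ℝ^d)`: `(2π)^{-d} ∫ û(ξ) conj(v̂(ξ)) dξ`. -/
def pairing (u v : Dist d) : ℂ :=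
  ((2 * Real.pi : ℂ) ^ d)⁻¹ * ∫ ξ : Rd d, hat u ξ * starRingEnd ℂ (hat v ξ)

/-- The series `∑ i, F i` converges (unconditionally) to `u` in the norm of `H^σ(ℝ^d)`. -/
def HasSumH {ι : Type*} (σ : ℝ) (F : ι → Dist d) (u : Dist d) : Prop :=
  (∀ i, InH σ (F i)) ∧ InH σ u ∧
    Tendsto (fun T : Finset ι => normH σ (u - ∑ i ∈ T, F i)) atTop (𝓝 0)

/-- `u` has `κ + 1` vanishing moments: all partial derivatives of `û` of order at most `κ` exist in
a neighbourhood of the origin (as continuous functions) and vanish at the origin. -/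
def HasVanishingMoments (κ : ℕ) (u : Dist d) : Prop :=
  ∃ g : Rd d → ℂ, IsFourierOf u g ∧ ContDiffAt ℝ (κ : ℕ∞) g 0 ∧
    ∀ n : ℕ, n ≤ κ → ∀ α : Fin n → Fin d,
      iteratedFDeriv ℝ n g 0 (fun i => EuclideanSpace.single (α i) (1 : ℝ)) = 0

/-! ## Isotropic dilation matrices -/

/-- An isotropic dilation matrix: a `d × d` integer matrix, all of whose complex eigenvalues are
strictly larger than `1` in modulus, and which is similar over `ℂ` to a diagonal matrix whose
diagonal entries all have the modulus `|det M|^{1/d}`. -/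
structure Dilation (d : ℕ) where
  /-- the integer matrix `M` -/
  mat : Matrix (Fin d) (Fin d) ℤ
  eigenvalue_gt : ∀ μ ∈ spectrum ℂ (mat.map (Int.cast : ℤ → ℂ)), 1 < ‖μ‖
  isotropic : ∃ (P : Matrix (Fin d) (Fin d) ℂ) (lam : Fin d → ℂ), IsUnit P.det ∧
    mat.map (Int.cast : ℤ → ℂ) = P * Matrix.diagonal lam * P⁻¹ ∧
      ∀ i, ‖lam i‖ = |(mat.det : ℝ)| ^ (1 / (d : ℝ))

namespace Dilation

variable (M : Dilation d)

/-- `M` as a real matrix. -/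
def real : Matrix (Fin d) (Fin d) ℝ := M.mat.map (Int.cast : ℤ → ℝ)

/-- `m = |det M|^{1/d}`. -/
def m : ℝ := |(M.mat.det : ℝ)| ^ (1 / (d : ℝ))

theorem det_ne_zero : M.mat.det ≠ 0 := by
  intro h
  have h0 : (0 : ℂ) ∈ spectrum ℂ (M.mat.map (Int.cast : ℤ → ℂ)) := by
    rw [spectrum.zero_mem_iff, Matrix.isUnit_iff_isUnit_det]
    have h1 : (M.mat.map (Int.cast : ℤ → ℂ)).det = 0 := by
      have h2 := (Int.castRingHom ℂ).map_det M.mat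
      rw [h] at h2
      simpa [RingHom.mapMatrix_apply] using h2.symm
    simp [h1]
  have := M.eigenvalue_gt 0 h0
  simp at this
  linarith

theorem isUnit_det_real : IsUnit M.real.det := by
  have h2 := (Int.castRingHom ℝ).map_det M.mat
  have h3 : M.real.det = (M.mat.det : ℝ) := by
    simpa [RingHom.mapMatrix_apply, real] using h2.symm
  rw [h3, isUnit_iff_ne_zero]
  exact_mod_cast M.det_ne_zero

/-- The linear automorphism `x ↦ M x` of `ℝ^d`. -/
def equiv : Rd d ≃L[ℝ] Rd d :=
  ContinuousLinearEquiv.equivOfInverse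
    (Matrix.toEuclideanCLM (𝕜 := ℝ) M.real) (Matrix.toEuclideanCLM (𝕜 := ℝ) M.real⁻¹)
    (fun x => by
      rw [← mul_apply_eq_comp, ← map_mul, Matrix.nonsing_inv_mul _ M.isUnit_det_real]
      simp)
    (fun x => by
      rw [← mul_apply_eq_comp, ← map_mul, Matrix.mul_nonsing_inv _ M.isUnit_det_real]
      simp)

/-- `Mᵀ ξ`. -/
def transposeMul (ξ : Rd d) : Rd d := Matrix.toEuclideanCLM (𝕜 := ℝ) M.real.transpose ξ

end Dilation

/-- The integer vector `k` as a point of `ℝ^d`. -/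
def ofInt (k : Fin d → ℤ) : Rd d := WithLp.toLp 2 (fun i => (k i : ℝ))

/-- The distribution `u(A · - k)`: formally, by the substitution `y = A x - k`,
`∫ u(A x - k) θ(x) dx = |det A|⁻¹ ∫ u(y) θ(A⁻¹ (y + k)) dy`. -/
def dilateShift (A : Rd d ≃L[ℝ] Rd d) (k : Rd d) (u : Dist d) : Dist d :=
  ((|LinearMap.det (A : Rd d →ₗ[ℝ] Rd d)|⁻¹ : ℝ) : ℂ) •
    PointwiseConvergenceCLM.precomp ℂ
      ((SchwartzMap.compSubConstCLM ℂ (-k)).comp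
        (SchwartzMap.compCLMOfContinuousLinearEquiv ℂ A.symm)) u

/-- `u^s_{j,k} = m^{j(d/2-s)} u(M^j · - k)`. -/
def atom (M : Dilation d) (s : ℝ) (u : Dist d) (j : ℕ) (k : Fin d → ℤ) : Dist d :=
  ((M.m ^ ((j : ℝ) * ((d : ℝ) / 2 - s)) : ℝ) : ℂ) • dilateShift (M.equiv ^ j) (ofInt k) u

/-- `u_{0,k} = u(· - k)`. -/
def shift (u : Dist d) (k : Fin d → ℤ) : Dist d :=
  dilateShift (ContinuousLinearEquiv.refl ℝ (Rd d)) (ofInt k) u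

/-! ## Refinable functions, wavelets and framelet systems -/

/-- The exponential `ξ ↦ e^{i k·ξ}`. -/
def expo (k : Fin d → ℤ) (ξ : Rd d) : ℂ :=
  Complex.exp (Complex.I * ((∑ i, (k i : ℝ) * ξ i : ℝ) : ℂ))

/-- The trigonometric polynomial `∑_k c[k] e^{i k·ξ}` with finitely many nonzero coefficients. -/
def trigPoly (c : (Fin d → ℤ) →₀ ℂ) (ξ : Rd d) : ℂ := c.sum fun k z => z * expo k ξ

/-- The `2πℤ^d`-periodic function `A` is the sum of the Fourier series `∑_k a[k] e^{i k·ξ}`,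
with convergence in the mean square over `(-π, π]^d`. -/
def IsFourierSeries (a : (Fin d → ℤ) → ℂ) (A : Rd d → ℂ) : Prop :=
  AEStronglyMeasurable A volume ∧
    (∀ (ξ : Rd d) (k : Fin d → ℤ), A (ξ + (2 * Real.pi) • ofInt k) = A ξ) ∧
    Tendsto
      (fun T : Finset (Fin d → ℤ) =>
        ∫⁻ ξ in {ξ : Rd d | ∀ i, ξ i ∈ Set.Ioc (-Real.pi) Real.pi},
          ‖A ξ - ∑ k ∈ T, a k * expo k ξ‖ₑ ^ 2)
      atTop (𝓝 0)

/-- `φ` is `M`-refinable: `φ̂(Mᵀ ξ) = â(ξ) φ̂(ξ)` for some mask `a`. -/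
def IsRefinable (M : Dilation d) (φ : Dist d) : Prop :=
  ∃ (a : (Fin d → ℤ) → ℂ) (A : Rd d → ℂ), IsFourierSeries a A ∧
    ∀ᵐ ξ : Rd d, hat φ (M.transposeMul ξ) = A ξ * hat φ ξ

/-- The data generating a wavelet system `X^s(φ; ψ¹, …, ψ^L)` in `H^s(ℝ^d)`: an `M`-refinable
`φ ∈ H^s`, and wavelet functions `ψ^ℓ` with `ψ̂^ℓ(Mᵀ ξ) = b̂^ℓ(ξ) φ̂(ξ)` for
trigonometric polynomials `b̂^ℓ` (these are then in `H^s` as well). -/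
structure IsWaveletSystem {L : ℕ} (M : Dilation d) (s : ℝ) (φ : Dist d) (ψ : Fin L → Dist d) :
    Prop where
  mem_phi : InH s φ
  mem_psi : ∀ l, InH s (ψ l)
  refinable : IsRefinable M φ
  wavelet : ∀ l, ∃ b : (Fin d → ℤ) →₀ ℂ,
    ∀ᵐ ξ : Rd d, hat (ψ l) (M.transposeMul ξ) = trigPoly b ξ * hat φ ξ

/-- `X^s(φ; ψ¹, …, ψ^L)` is an `M`-framelet system in `H^s(ℝ^d)`. -/
def IsFrameletSystem {L : ℕ} (M : Dilation d) (s : ℝ) (φ : Dist d) (ψ : Fin L → Dist d) :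
    Prop :=
  IsWaveletSystem M s φ ψ ∧
    ∃ C₁ C₂ : ℝ, 0 < C₁ ∧ 0 < C₂ ∧ ∀ f : Dist d, InH s f →
      ENNReal.ofReal (C₁ * normH s f ^ 2) ≤
          ∑' k, ‖innerH s f (shift φ k)‖ₑ ^ 2
            + ∑ l, ∑' j, ∑' k, ‖innerH s f (atom M s (ψ l) j k)‖ₑ ^ 2 ∧
        ∑' k, ‖innerH s f (shift φ k)‖ₑ ^ 2
            + ∑ l, ∑' j, ∑' k, ‖innerH s f (atom M s (ψ l) j k)‖ₑ ^ 2 ≤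
          ENNReal.ofReal (C₂ * normH s f ^ 2)

/-- `X^s(φ; ψ¹, …, ψ^L)` and `X^{-s}(φ'; ψ'¹, …, ψ'^L)` form a pair of dual `M`-framelet
systems in `(H^s(ℝ^d), H^{-s}(ℝ^d))`. (The frame inequalities make all the series below absolutely
convergent.) -/
def IsDualPair {L : ℕ} (M : Dilation d) (s : ℝ) (φ : Dist d) (ψ : Fin L → Dist d)
    (φ' : Dist d) (ψ' : Fin L → Dist d) : Prop :=
  IsFrameletSystem M s φ ψ ∧ IsFrameletSystem M (-s) φ' ψ' ∧
    ∀ f g : Dist d, InH s f → InH (-s) g →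
      pairing f g =
        ∑' k, pairing (shift φ k) g * pairing f (shift φ' k)
          + ∑ l, ∑' j, ∑' k,
              pairing (atom M s (ψ l) j k) g * pairing f (atom M (-s) (ψ' l) j k)

/-- `S` is the truncated framelet series
`∑_k ⟨f, φ'_{0,k}⟩ φ_{0,k} + ∑_l ∑_{j<N} ∑_k ⟨f, ψ'^{l,-s}_{j,k}⟩ ψ^{l,s}_{j,k}`,
all the series over `k ∈ ℤ^d` being convergent in `H^s(ℝ^d)`. -/
def IsTruncatedSeries {L : ℕ} (M : Dilation d) (s : ℝ) (φ : Dist d) (ψ : Fin L → Dist d)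
    (φ' : Dist d) (ψ' : Fin L → Dist d) (N : ℕ) (f S : Dist d) : Prop :=
  ∃ (u : Dist d) (v : Fin L → ℕ → Dist d),
    HasSumH s (fun k : Fin d → ℤ => pairing f (shift φ' k) • shift φ k) u ∧
    (∀ l, ∀ j < N,
      HasSumH s (fun k : Fin d → ℤ =>
        pairing f (atom M (-s) (ψ' l) j k) • atom M s (ψ l) j k) (v l j)) ∧
    S = u + ∑ l, ∑ j ∈ Finset.range N, v l j

end Framelet

end

open Framelet

noncomputable section

namespace Framelet

variable {d : ℕ}

/-! ## Linear changes of variables -/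

/-! The weighted Fourier transform `toL2` identifies both `H^s` and `H^{-s}` with `L²(ℝ^d)`, and the
pairing with the `L²` inner product. Let `w = f - S` be the truncation error. Testing the dual
expansion of `f` against `w` itself cancels everything that `S` contains, so `‖w‖²` equals the sum
over the levels `j ≥ N`. Cauchy–Schwarz and the Bessel bound of the `ψ`-system then bound `‖w‖²` by
a constant times the sum of the squared coefficients `⟨f, ψ'_{j,k}⟩` over `j ≥ N`
(`norm_sub_truncated_sq_le`). It remains to show that these coefficients decay geometrically in `j`.

Substituting `ξ = (Mᵀ)^{j+1} η` and using the relation between `ψ'` and `φ'`, the level-`j`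
coefficients become, up to a factor, coefficients with respect to integer shifts of `φ'` of a
function whose transform is `f̂((Mᵀ)^{j+1} η)` times the conjugate mask and a weight. The Bessel
bound for the shifts of `φ'`, the isotropic expansion of `Mᵀ` and the estimate `|b̂(η)|² (1 +
‖η‖²)^s ≤ B ‖η‖^{2ς}` give the decay `m^{-2(ς-s)j}` (`exists_coefficient_decay`). The estimate holds
once `b̂` vanishes to order `κ + 1 > ς` at the origin (`exists_trigPoly_weight_le`).

The delicate point is to pass the vanishing moments from `ψ'` to its mask, because `φ̂'` need not be
continuous or bounded away from zero near the origin (`taylorPart_eq_zero`). Duality shows that the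
dilates of `φ̂ · conj φ̂'` tend weakly to `1` on a ball (`tendsto_integral_hat_mul_conj_hat`), while
the Bessel bounds keep the local `L²` norms of the dilates of `φ̂` and `φ̂'` bounded
(`setIntegral_hat_comp_sq_le`). If `P` is the first homogeneous Taylor part of the mask not yet
known to vanish, the rescaled masks converge along a subsequence to `P ∘ V` with `V` invertible.
Their products with the dilates of `φ̂'` are rescaled dilates of `ψ̂'`, which tend to `0`. Hence the
integral of `|P ∘ V|²` over the ball is `0`, and `P = 0`. -/

theorem map_equiv_volume (B : Rd d ≃L[ℝ] Rd d) :
    Measure.map B volume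
      = ENNReal.ofReal |LinearMap.det (B : Rd d →ₗ[ℝ] Rd d)|⁻¹ • (volume : Measure (Rd d)) := by
  have h : LinearMap.det (B : Rd d →ₗ[ℝ] Rd d) ≠ 0 := (LinearEquiv.isUnit_det' B.toLinearEquiv).ne_zero
  have := Measure.map_linearMap_addHaar_eq_smul_addHaar (volume : Measure (Rd d)) h
  rw [abs_inv] at this
  exact this

theorem quasiMeasurePreserving_equiv (B : Rd d ≃L[ℝ] Rd d) :
    Measure.QuasiMeasurePreserving B (volume : Measure (Rd d)) volume := by
  refine ⟨B.continuous.measurable, ?_⟩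
  rw [map_equiv_volume]
  exact Measure.smul_absolutelyContinuous

theorem absdet_pos (B : Rd d ≃L[ℝ] Rd d) : 0 < |LinearMap.det (B : Rd d →ₗ[ℝ] Rd d)| :=
  abs_pos.mpr (LinearEquiv.isUnit_det' B.toLinearEquiv).ne_zero

theorem integral_comp_equiv {E : Type*} [NormedAddCommGroup E] [NormedSpace ℝ E]
    (B : Rd d ≃L[ℝ] Rd d) (f : Rd d → E) :
    ∫ x, f (B x) = |LinearMap.det (B : Rd d →ₗ[ℝ] Rd d)|⁻¹ • ∫ x, f x := by
  have h := B.toHomeomorph.measurableEmbedding.integral_map (μ := volume) f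
  have h2 : Measure.map (B.toHomeomorph) volume
      = ENNReal.ofReal |LinearMap.det (B : Rd d →ₗ[ℝ] Rd d)|⁻¹ • (volume : Measure (Rd d)) :=
    map_equiv_volume B
  rw [h2, integral_smul_measure, ENNReal.toReal_ofReal (inv_nonneg.mpr (abs_nonneg _))] at h
  exact h.symm

theorem memLp_comp_equiv {E : Type*} [NormedAddCommGroup E] {p : ℝ≥0∞}
    (B : Rd d ≃L[ℝ] Rd d) {f : Rd d → E} (hf : MemLp f p volume) :
    MemLp (fun x => f (B x)) p volume := by
  refine (memLp_map_measure_iff (g := f) ?_ B.continuous.aemeasurable).mp ?_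
  · rw [map_equiv_volume]
    exact hf.1.smul_measure _
  · rw [map_equiv_volume]
    exact hf.smul_measure ENNReal.ofReal_ne_top

theorem integrable_comp_equiv {E : Type*} [NormedAddCommGroup E]
    (B : Rd d ≃L[ℝ] Rd d) {f : Rd d → E} (hf : Integrable f volume) :
    Integrable (fun x => f (B x)) volume :=
  memLp_one_iff_integrable.mp (memLp_comp_equiv B (memLp_one_iff_integrable.mpr hf))

theorem aestronglyMeasurable_comp_equiv {E : Type*} [TopologicalSpace E]
    (B : Rd d ≃L[ℝ] Rd d) {f : Rd d → E} (hf : AEStronglyMeasurable f volume) :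
    AEStronglyMeasurable (fun x => f (B x)) volume :=
  hf.comp_quasiMeasurePreserving (quasiMeasurePreserving_equiv B)

theorem ae_comp_equiv (B : Rd d ≃L[ℝ] Rd d) {p : Rd d → Prop} (h : ∀ᵐ x, p x) :
    ∀ᵐ x, p (B x) := (quasiMeasurePreserving_equiv B).ae h

/-- The homothety `ξ ↦ 2π ξ`. -/
def twoPi (d : ℕ) : Rd d ≃L[ℝ] Rd d :=
  ContinuousLinearEquiv.smulLeft (Units.mk0 (2 * Real.pi) (by positivity))

theorem twoPi_apply (x : Rd d) : twoPi d x = (2 * Real.pi) • x := rfl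

/-! ## Uniqueness and linearity of the Fourier transform -/

/-- Testing against a smooth bump equal to `1` near a point turns integrability against Schwartz
functions into the local integrability that the fundamental lemma of the calculus of variations
requires in `IsFourierOf.ae_eq`. -/
theorem IsFourierOf.locallyIntegrable {u : Dist d} {g : Rd d → ℂ} (h : IsFourierOf u g) :
    LocallyIntegrable (fun η : Rd d => g ((2 * Real.pi) • η)) volume := by
  intro x
  let χ : ContDiffBump x := ⟨1, 2, one_pos, one_lt_two⟩
  have hc : HasCompactSupport (Complex.ofRealCLM ∘ χ) := χ.hasCompactSupport.comp_left rfl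
  have hs : ContDiff ℝ (⊤ : ℕ∞) (Complex.ofRealCLM ∘ χ) :=
    Complex.ofRealCLM.contDiff.comp χ.contDiff
  have h1 := (h.2 (hc.toSchwartzMap hs)).1
  refine ⟨Metric.closedBall x 1, Metric.closedBall_mem_nhds x one_pos, ?_⟩
  refine h1.integrableOn.congr_fun (fun y hy => ?_) Metric.isClosed_closedBall.measurableSet
  have : χ y = 1 := χ.one_of_mem_closedBall hy
  simp [this]

theorem IsFourierOf.ae_eq {u : Dist d} {g g' : Rd d → ℂ} (h : IsFourierOf u g)
    (h' : IsFourierOf u g') : g =ᵐ[volume] g' := by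
  have h0 : ∀ᵐ η : Rd d, g ((2 * Real.pi) • η) - g' ((2 * Real.pi) • η) = 0 := by
    refine ae_eq_zero_of_integral_contDiff_smul_eq_zero
      (h.locallyIntegrable.sub h'.locallyIntegrable) fun χ hχ hχc => ?_
    have hc : HasCompactSupport (Complex.ofRealCLM ∘ χ) := hχc.comp_left rfl
    have hs : ContDiff ℝ (⊤ : ℕ∞) (Complex.ofRealCLM ∘ χ) := by fun_prop
    obtain ⟨i1, e1⟩ := h.2 (hc.toSchwartzMap hs)
    obtain ⟨i2, e2⟩ := h'.2 (hc.toSchwartzMap hs)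
    have := integral_sub i1 i2
    rw [← e1, ← e2, sub_self] at this
    rw [← this]
    refine integral_congr_ae (Eventually.of_forall fun x => ?_)
    simp [mul_sub]
  have := ae_comp_equiv (twoPi d).symm h0
  filter_upwards [this] with ξ hξ
  rw [← twoPi_apply, ContinuousLinearEquiv.apply_symm_apply] at hξ
  exact sub_eq_zero.mp hξ

theorem IsFourierOf.congr {u : Dist d} {g g' : Rd d → ℂ} (h : IsFourierOf u g)
    (hg : g =ᵐ[volume] g') : IsFourierOf u g' := by
  have h2 : ∀ᵐ η : Rd d, g ((2 * Real.pi) • η) = g' ((2 * Real.pi) • η) :=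
    ae_comp_equiv (twoPi d) hg
  refine ⟨h.1.congr hg, fun θ => ?_⟩
  have h3 : (fun η : Rd d => θ η * g ((2 * Real.pi) • η)) =ᵐ[volume]
      fun η => θ η * g' ((2 * Real.pi) • η) := by
    filter_upwards [h2] with η hη
    rw [hη]
  exact ⟨(h.2 θ).1.congr h3, (h.2 θ).2.trans (integral_congr_ae h3)⟩

theorem isFourierOf_hat {u : Dist d} {g : Rd d → ℂ} (h : IsFourierOf u g) :
    IsFourierOf u (hat u) := by
  have h1 : ∃ g, IsFourierOf u g := ⟨g, h⟩
  rw [hat, dif_pos h1]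
  exact h1.choose_spec

theorem IsFourierOf.hat_ae_eq {u : Dist d} {g : Rd d → ℂ} (h : IsFourierOf u g) :
    hat u =ᵐ[volume] g := (isFourierOf_hat h).ae_eq h

theorem IsFourierOf.add {u v : Dist d} {g g' : Rd d → ℂ} (h : IsFourierOf u g)
    (h' : IsFourierOf v g') : IsFourierOf (u + v) (fun ξ => g ξ + g' ξ) := by
  refine ⟨h.1.add h'.1, fun θ => ?_⟩
  obtain ⟨i1, e1⟩ := h.2 θ
  obtain ⟨i2, e2⟩ := h'.2 θ
  simp only [mul_add]
  refine ⟨i1.add i2, ?_⟩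
  rw [integral_add i1 i2, ← e1, ← e2]
  rfl

theorem IsFourierOf.smul {u : Dist d} {g : Rd d → ℂ} (c : ℂ) (h : IsFourierOf u g) :
    IsFourierOf (c • u) (fun ξ => c * g ξ) := by
  refine ⟨h.1.const_mul c, fun θ => ?_⟩
  obtain ⟨i1, e1⟩ := h.2 θ
  have e : (fun η : Rd d => θ η * (c * g ((2 * Real.pi) • η)))
      = fun η => c * (θ η * g ((2 * Real.pi) • η)) := by
    ext η; ring
  rw [e]
  refine ⟨i1.const_mul c, ?_⟩
  rw [integral_const_mul, ← e1]
  rfl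

/-! ## The Fourier transform of `u(A · - k)` -/

/-- The translation and the substitution `x ↦ A x` move the affine map onto the exponential, where
`A` becomes its adjoint `B`. This is the action of `dilateShift` on test functions, seen from the
Fourier side. -/
theorem fourierInv_comp_affine (A B : Rd d ≃L[ℝ] Rd d)
    (hAB : ∀ x y : Rd d, inner ℝ (A x) y = inner ℝ x (B y)) (k : Rd d) (θ : 𝓢(Rd d, ℂ))
    (η : Rd d) :
    (𝓕⁻ ((SchwartzMap.compSubConstCLM ℂ (-k)).comp
        (SchwartzMap.compCLMOfContinuousLinearEquiv ℂ A.symm) (𝓕 θ)) : 𝓢(Rd d, ℂ)) η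
      = ((|LinearMap.det (A : Rd d →ₗ[ℝ] Rd d)| : ℝ) : ℂ) *
        (Complex.exp (((-(2 * Real.pi * inner ℝ k η) : ℝ) : ℂ) * Complex.I) * θ (B η)) := by
  have h1 : θ (B η) = (𝓕⁻ (𝓕 θ) : 𝓢(Rd d, ℂ)) (B η) := by simp
  rw [h1, SchwartzMap.fourierInv_coe, SchwartzMap.fourierInv_coe, Real.fourierInv_eq',
    Real.fourierInv_eq']
  set ψ : 𝓢(Rd d, ℂ) := 𝓕 θ
  have h2 := integral_sub_right_eq_self (μ := (volume : Measure (Rd d)))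
    (fun v => Complex.exp (((2 * Real.pi * inner ℝ v η : ℝ) : ℂ) * Complex.I) •
      ((SchwartzMap.compSubConstCLM ℂ (-k)).comp
        (SchwartzMap.compCLMOfContinuousLinearEquiv ℂ A.symm) ψ) v) k
  have h3 := integral_comp_equiv A (fun v => Complex.exp (((2 * Real.pi * inner ℝ (v - k) η : ℝ) : ℂ) * Complex.I) •
      ((SchwartzMap.compSubConstCLM ℂ (-k)).comp
        (SchwartzMap.compCLMOfContinuousLinearEquiv ℂ A.symm) ψ) (v - k))
  rw [h2, eq_inv_smul_iff₀ (absdet_pos A).ne'] at h3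
  rw [← h3, ← integral_const_mul, Complex.real_smul]
  congr 2
  ext v
  simp only [ContinuousLinearMap.comp_apply, SchwartzMap.compSubConstCLM_apply,
    SchwartzMap.compCLMOfContinuousLinearEquiv_apply, Function.comp, sub_neg_eq_add, sub_add_cancel,
    ContinuousLinearEquiv.symm_apply_apply, inner_sub_left, hAB, smul_eq_mul]
  rw [← mul_assoc, ← Complex.exp_add]
  congr 2
  push_cast
  ring

theorem IsFourierOf.dilateShift {u : Dist d} {g : Rd d → ℂ} (h : IsFourierOf u g)
    (A B : Rd d ≃L[ℝ] Rd d) (hAB : ∀ x y : Rd d, inner ℝ (A x) y = inner ℝ x (B y))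
    (hdet : |LinearMap.det (A : Rd d →ₗ[ℝ] Rd d)| = |LinearMap.det (B : Rd d →ₗ[ℝ] Rd d)|)
    (k : Rd d) :
    IsFourierOf (dilateShift A k u) (fun ξ => ((|LinearMap.det (A : Rd d →ₗ[ℝ] Rd d)|⁻¹ : ℝ) : ℂ) *
      (Complex.exp (((-inner ℝ k (B.symm ξ) : ℝ) : ℂ) * Complex.I) * g (B.symm ξ))) := by
  refine ⟨?_, fun θ => ?_⟩
  · refine AEStronglyMeasurable.const_mul (AEStronglyMeasurable.mul ?_
      (aestronglyMeasurable_comp_equiv B.symm h.1)) _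
    refine Continuous.aestronglyMeasurable ?_
    fun_prop
  -- `θ'` is chosen so that its Fourier transform is the affine pullback of `𝓕 θ`; the
  -- representation of `𝓕 u` can then be applied to it.
  · set θ' : 𝓢(Rd d, ℂ) := 𝓕⁻ ((SchwartzMap.compSubConstCLM ℂ (-k)).comp
        (SchwartzMap.compCLMOfContinuousLinearEquiv ℂ A.symm) (𝓕 θ)) with hθ'
    have e1 : 𝓕 (Framelet.dilateShift A k u) θ
        = ((|LinearMap.det (A : Rd d →ₗ[ℝ] Rd d)|⁻¹ : ℝ) : ℂ) * (𝓕 u) θ' := by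
      rw [TemperedDistribution.fourier_apply, TemperedDistribution.fourier_apply, hθ',
        FourierTransform.fourier_fourierInv_eq]
      rfl
    obtain ⟨i1, e2⟩ := h.2 θ'
    have hpt : ∀ η : Rd d, θ' η = ((|LinearMap.det (A : Rd d →ₗ[ℝ] Rd d)| : ℝ) : ℂ) *
        (Complex.exp (((-(2 * Real.pi * inner ℝ k η) : ℝ) : ℂ) * Complex.I) * θ (B η)) :=
      fourierInv_comp_affine A B hAB k θ
    have hfun : (fun η : Rd d => θ η * (((|LinearMap.det (A : Rd d →ₗ[ℝ] Rd d)|⁻¹ : ℝ) : ℂ) *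
        (Complex.exp (((-inner ℝ k (B.symm ((2 * Real.pi) • η)) : ℝ) : ℂ) * Complex.I) *
          g (B.symm ((2 * Real.pi) • η)))))
        = fun η => ((|LinearMap.det (A : Rd d →ₗ[ℝ] Rd d)|⁻¹ ^ 2 : ℝ) : ℂ) *
          (θ' (B.symm η) * g ((2 * Real.pi) • (B.symm η))) := by
      ext η
      rw [hpt, ContinuousLinearEquiv.apply_symm_apply, map_smul, inner_smul_right]
      have := (absdet_pos A).ne'
      have h' : ((|LinearMap.det (A : Rd d →ₗ[ℝ] Rd d)| : ℝ) : ℂ) ≠ 0 := by exact_mod_cast this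
      push_cast
      field_simp
    rw [hfun]
    have i2 := integrable_comp_equiv B.symm i1
    refine ⟨i2.const_mul _, ?_⟩
    rw [integral_const_mul, e1, e2,
      integral_comp_equiv B.symm (fun η => θ' η * g ((2 * Real.pi) • η))]
    have hd : |LinearMap.det (B.symm : Rd d →ₗ[ℝ] Rd d)|⁻¹
        = |LinearMap.det (A : Rd d →ₗ[ℝ] Rd d)| := by
      rw [hdet]
      have := LinearEquiv.det_symm_mul_det B.toLinearEquiv
      have h5 : LinearMap.det (B.symm : Rd d →ₗ[ℝ] Rd d) * LinearMap.det (B : Rd d →ₗ[ℝ] Rd d) = 1 :=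
        this
      exact inv_eq_of_mul_eq_one_right (by rw [← abs_mul, h5, abs_one])
    rw [hd, Complex.real_smul]
    have := (absdet_pos A).ne'
    have h' : ((|LinearMap.det (A : Rd d →ₗ[ℝ] Rd d)| : ℝ) : ℂ) ≠ 0 := by exact_mod_cast this
    push_cast
    field_simp

/-! ## Sobolev spaces on the Fourier side -/

/-- The Sobolev weight `(1 + ‖ξ‖²)^{σ/2}`. -/
def wt (σ : ℝ) (ξ : Rd d) : ℝ := (1 + ‖ξ‖ ^ 2) ^ (σ / 2)

theorem wt_pos (σ : ℝ) (ξ : Rd d) : 0 < wt σ ξ := by unfold wt; positivity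

theorem wt_mul_neg (σ : ℝ) (ξ : Rd d) : wt σ ξ * wt (-σ) ξ = 1 := by
  unfold wt
  rw [← Real.rpow_add (by positivity)]
  ring_nf
  simp

theorem wt_sq (σ : ℝ) (ξ : Rd d) : wt σ ξ ^ 2 = (1 + ‖ξ‖ ^ 2) ^ σ := by
  unfold wt
  rw [← Real.rpow_natCast, ← Real.rpow_mul (by positivity)]
  norm_num

theorem continuous_wt (σ : ℝ) : Continuous (wt σ : Rd d → ℝ) := by
  unfold wt
  exact (by fun_prop : Continuous fun ξ : Rd d => 1 + ‖ξ‖ ^ 2).rpow_const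
    fun ξ => Or.inl (by positivity)

theorem continuous_wt_ofReal (σ : ℝ) : Continuous fun ξ : Rd d => ((wt σ ξ : ℝ) : ℂ) :=
  Complex.continuous_ofReal.comp (continuous_wt σ)

theorem hasTemperateGrowth_wt (σ : ℝ) :
    (fun ξ : Rd d => ((wt σ ξ : ℝ) : ℂ)).HasTemperateGrowth := by
  unfold wt
  fun_prop

theorem wt_mono {σ τ : ℝ} (h : σ ≤ τ) (ξ : Rd d) : wt σ ξ ≤ wt τ ξ := by
  unfold wt
  exact Real.rpow_le_rpow_of_exponent_le (by simp) (by linarith)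

theorem one_add_sq_comp_le (B : Rd d ≃L[ℝ] Rd d) :
    ∃ C : ℝ, 0 < C ∧ ∀ ξ : Rd d, 1 + ‖B ξ‖ ^ 2 ≤ C * (1 + ‖ξ‖ ^ 2) := by
  refine ⟨1 + ‖(B : Rd d →L[ℝ] Rd d)‖ ^ 2, by positivity, fun ξ => ?_⟩
  have h : ‖B ξ‖ ≤ ‖(B : Rd d →L[ℝ] Rd d)‖ * ‖ξ‖ := (B : Rd d →L[ℝ] Rd d).le_opNorm ξ
  have h2 := pow_le_pow_left₀ (norm_nonneg _) h 2
  nlinarith [sq_nonneg ‖ξ‖, sq_nonneg ‖(B : Rd d →L[ℝ] Rd d)‖]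

theorem wt_comp_le (σ : ℝ) (B : Rd d ≃L[ℝ] Rd d) :
    ∃ C : ℝ, 0 < C ∧ ∀ ξ : Rd d, wt σ (B ξ) ≤ C * wt σ ξ := by
  rcases le_total 0 σ with h | h
  · obtain ⟨C, hC, hB⟩ := one_add_sq_comp_le B
    refine ⟨C ^ (σ / 2), by positivity, fun ξ => ?_⟩
    unfold wt
    rw [← Real.mul_rpow hC.le (by positivity)]
    exact Real.rpow_le_rpow (by positivity) (hB ξ) (by linarith)
  -- For a negative exponent a lower bound for `1 + ‖B ξ‖²` is needed; it is the upper bound for the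
  -- inverse map taken at `B ξ`.
  · obtain ⟨C, hC, hB⟩ := one_add_sq_comp_le B.symm
    refine ⟨C ^ (-(σ / 2)), by positivity, fun ξ => ?_⟩
    have h1 := hB (B ξ)
    rw [ContinuousLinearEquiv.symm_apply_apply] at h1
    have h2 := Real.rpow_le_rpow (by positivity) h1 (z := -(σ / 2)) (by linarith)
    rw [Real.mul_rpow hC.le (by positivity), Real.rpow_neg (by positivity),
      Real.rpow_neg (x := 1 + ‖B ξ‖ ^ 2) (by positivity)] at h2
    unfold wt
    have p1 : 0 < (1 + ‖ξ‖ ^ 2) ^ (σ / 2) := by positivity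
    have p2 : 0 < (1 + ‖B ξ‖ ^ 2) ^ (σ / 2) := by positivity
    rwa [← div_eq_mul_inv, inv_le_comm₀ p1 (by positivity), inv_div, div_le_iff₀ (by positivity),
      mul_comm] at h2

/-- `wt σ · g` is square integrable; i.e. `g` is the Fourier transform of an element of `H^σ`. -/
def WtL2 (σ : ℝ) (g : Rd d → ℂ) : Prop :=
  MemLp (fun ξ => ((wt σ ξ : ℝ) : ℂ) * g ξ) 2 volume

theorem WtL2.aestronglyMeasurable {σ : ℝ} {g : Rd d → ℂ} (h : WtL2 σ g) :
    AEStronglyMeasurable g volume := by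
  have h1 := (continuous_wt_ofReal (d := d) (-σ)).aestronglyMeasurable (μ := volume) |>.mul h.1
  refine h1.congr (Eventually.of_forall fun ξ => ?_)
  have := wt_mul_neg σ ξ
  simp only [Pi.mul_apply]
  rw [← mul_assoc, ← Complex.ofReal_mul, mul_comm (wt (-σ) ξ), this]
  simp

theorem WtL2.of_bound {σ : ℝ} {g G : Rd d → ℂ} (hG : MemLp G 2 volume)
    (hg : AEStronglyMeasurable g volume) (C : ℝ) (h : ∀ᵐ ξ, wt σ ξ * ‖g ξ‖ ≤ C * ‖G ξ‖) :
    WtL2 σ g := by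
  refine MemLp.of_le_mul (c := C) hG ((continuous_wt_ofReal σ).aestronglyMeasurable.mul hg) ?_
  filter_upwards [h] with ξ hξ
  rwa [norm_mul, Complex.norm_real, Real.norm_of_nonneg (wt_pos σ ξ).le]

theorem WtL2.congr {σ : ℝ} {g g' : Rd d → ℂ} (h : WtL2 σ g) (e : g =ᵐ[volume] g') :
    WtL2 σ g' := by
  refine (memLp_congr_ae ?_).mp h
  filter_upwards [e] with ξ hξ
  rw [hξ]

theorem WtL2.comp {σ : ℝ} {g : Rd d → ℂ} (h : WtL2 σ g) (B : Rd d ≃L[ℝ] Rd d) :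
    WtL2 σ (fun ξ => g (B ξ)) := by
  obtain ⟨C, hC, hB⟩ := wt_comp_le σ B.symm
  refine WtL2.of_bound (memLp_comp_equiv B h)
    (aestronglyMeasurable_comp_equiv B h.aestronglyMeasurable) C (Eventually.of_forall fun ξ => ?_)
  have := hB (B ξ)
  rw [ContinuousLinearEquiv.symm_apply_apply] at this
  rw [norm_mul, Complex.norm_real, Real.norm_of_nonneg (wt_pos σ _).le, ← mul_assoc]
  gcongr

theorem WtL2.mono {σ τ : ℝ} (h : σ ≤ τ) {g : Rd d → ℂ} (hg : WtL2 τ g) : WtL2 σ g := by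
  refine WtL2.of_bound hg hg.aestronglyMeasurable 1 (Eventually.of_forall fun ξ => ?_)
  rw [norm_mul, Complex.norm_real, Real.norm_of_nonneg (wt_pos τ _).le, one_mul]
  gcongr
  exact wt_mono h ξ

/-- Shifting the weight `wt (-σ)` onto the Schwartz function leaves it Schwartz, hence in `L²`, so
the product is one of two `L²` functions. -/
theorem integrable_schwartz_mul_of_wtL2 {σ : ℝ} {G : Rd d → ℂ} (h : WtL2 σ G)
    (θ : 𝓢(Rd d, ℂ)) : Integrable (fun η => θ η * G η) volume := by
  have h1 : MemLp (SchwartzMap.smulLeftCLM ℂ (fun ξ : Rd d => ((wt (-σ) ξ : ℝ) : ℂ)) θ) 2 volume :=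
    SchwartzMap.memLp _ 2 volume
  refine (h1.integrable_mul h).congr (Eventually.of_forall fun η => ?_)
  simp only [Pi.mul_apply]
  rw [SchwartzMap.smulLeftCLM_apply_apply (hasTemperateGrowth_wt _)]
  have : ((wt σ η : ℝ) : ℂ) * ((wt (-σ) η : ℝ) : ℂ) = 1 := by
    rw [← Complex.ofReal_mul, wt_mul_neg, Complex.ofReal_one]
  rw [smul_eq_mul]
  linear_combination (θ η * G η) * this

theorem smulLeft_wt_toLp_apply {σ : ℝ} {G : Rd d → ℂ} (h : WtL2 σ G) (θ : 𝓢(Rd d, ℂ)) :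
    TemperedDistribution.smulLeftCLM ℂ (fun ξ : Rd d => ((wt (-σ) ξ : ℝ) : ℂ))
      ((MemLp.toLp _ h : Lp ℂ 2 (volume : Measure (Rd d))) : Dist d) θ = ∫ η, θ η * G η := by
  rw [TemperedDistribution.smulLeftCLM_apply_apply, Lp.toTemperedDistribution_apply]
  refine integral_congr_ae ?_
  filter_upwards [MemLp.coeFn_toLp h] with η hη
  rw [SchwartzMap.smulLeftCLM_apply_apply (hasTemperateGrowth_wt _), hη]
  have : ((wt σ η : ℝ) : ℂ) * ((wt (-σ) η : ℝ) : ℂ) = 1 := by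
    rw [← Complex.ofReal_mul, wt_mul_neg, Complex.ofReal_one]
  simp only [smul_eq_mul]
  linear_combination (θ η * G η) * this

theorem smulLeft_wt_smulLeft_wt (σ : ℝ) (u : Dist d) :
    TemperedDistribution.smulLeftCLM ℂ (fun ξ : Rd d => ((wt (-σ) ξ : ℝ) : ℂ))
      (TemperedDistribution.smulLeftCLM ℂ (fun ξ : Rd d => ((wt σ ξ : ℝ) : ℂ)) u) = u := by
  rw [TemperedDistribution.smulLeftCLM_smulLeftCLM_apply (hasTemperateGrowth_wt _)
    (hasTemperateGrowth_wt _)]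
  have : (fun ξ : Rd d => ((wt σ ξ : ℝ) : ℂ)) * (fun ξ : Rd d => ((wt (-σ) ξ : ℝ) : ℂ))
      = fun _ => 1 := by
    ext ξ
    rw [Pi.mul_apply, ← Complex.ofReal_mul, wt_mul_neg, Complex.ofReal_one]
  rw [this, TemperedDistribution.smulLeftCLM_const, one_smul]

/-- Dividing the `L²` function `wt σ · 𝓕 u` by its weight gives the transform in the normalization
`e^{-2πi x·η}`. The homothety by `2π` passes to the present normalization and preserves weighted
square integrability, since it changes the weight only by bounded factors. -/
theorem InH.exists_isFourierOf {σ : ℝ} {u : Dist d} (h : InH σ u) :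
    ∃ g, IsFourierOf u g ∧ WtL2 σ g := by
  obtain ⟨f, hf⟩ := TemperedDistribution.memSobolev_iff_exists_smulLeftCLM_fourier.mp h
  set G : Rd d → ℂ := fun η => ((wt (-σ) η : ℝ) : ℂ) * f η
  have hwG : (fun η => ((wt σ η : ℝ) : ℂ) * G η) = f := by
    ext η
    have : ((wt σ η : ℝ) : ℂ) * ((wt (-σ) η : ℝ) : ℂ) = 1 := by
      rw [← Complex.ofReal_mul, wt_mul_neg, Complex.ofReal_one]
    simp only [G]
    linear_combination (f η) * this
  have hG : WtL2 σ G := by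
    unfold WtL2
    rw [hwG]
    exact Lp.memLp f
  have hfG : f = MemLp.toLp _ hG := by
    refine Lp.ext ?_
    filter_upwards [MemLp.coeFn_toLp hG] with η hη
    rw [hη, ← hwG]
  refine ⟨fun ξ => G ((twoPi d).symm ξ), ⟨(hG.comp _).aestronglyMeasurable, fun θ => ?_⟩,
    hG.comp _⟩
  have e : (fun η => θ η * G ((twoPi d).symm ((2 * Real.pi) • η))) = fun η => θ η * G η := by
    ext η
    rw [← twoPi_apply, ContinuousLinearEquiv.symm_apply_apply]
  rw [e]
  refine ⟨integrable_schwartz_mul_of_wtL2 hG θ, ?_⟩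
  rw [← smulLeft_wt_toLp_apply hG, ← hfG, ← hf]
  exact congrArg (fun v : Dist d => v θ) (smulLeft_wt_smulLeft_wt σ (𝓕 u)).symm

theorem inH_of_wtL2 {σ : ℝ} {u : Dist d} {g : Rd d → ℂ} (hu : IsFourierOf u g)
    (hg : WtL2 σ g) : InH σ u := by
  have hG : WtL2 σ (fun η => g (twoPi d η)) := hg.comp _
  rw [InH, TemperedDistribution.memSobolev_iff_exists_smulLeftCLM_fourier]
  refine ⟨MemLp.toLp _ hG, ?_⟩
  have h1 : 𝓕 u = TemperedDistribution.smulLeftCLM ℂ (fun ξ : Rd d => ((wt (-σ) ξ : ℝ) : ℂ))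
      ((MemLp.toLp _ hG : Lp ℂ 2 (volume : Measure (Rd d))) : Dist d) := by
    ext θ
    rw [smulLeft_wt_toLp_apply hG, (hu.2 θ).2]
    rfl
  rw [h1]
  have := smulLeft_wt_smulLeft_wt (-σ)
    ((MemLp.toLp _ hG : Lp ℂ 2 (volume : Measure (Rd d))) : Dist d)
  rw [neg_neg] at this
  exact this

theorem exists_isFourierOf_of_wtL2 {σ : ℝ} {g : Rd d → ℂ} (hg : WtL2 σ g) :
    ∃ u : Dist d, IsFourierOf u g := by
  have hG : WtL2 σ (fun η => g (twoPi d η)) := hg.comp _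
  refine ⟨𝓕⁻ (TemperedDistribution.smulLeftCLM ℂ (fun ξ : Rd d => ((wt (-σ) ξ : ℝ) : ℂ))
      ((MemLp.toLp _ hG : Lp ℂ 2 (volume : Measure (Rd d))) : Dist d)),
      hg.aestronglyMeasurable, fun θ => ⟨integrable_schwartz_mul_of_wtL2 hG θ, ?_⟩⟩
  rw [FourierTransform.fourier_fourierInv_eq, smulLeft_wt_toLp_apply hG]
  rfl

theorem InH.isFourierOf {σ : ℝ} {u : Dist d} (h : InH σ u) : IsFourierOf u (hat u) := by
  obtain ⟨g, hg, -⟩ := h.exists_isFourierOf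
  exact isFourierOf_hat hg

theorem InH.wtL2 {σ : ℝ} {u : Dist d} (h : InH σ u) : WtL2 σ (hat u) := by
  obtain ⟨g, hg, hg2⟩ := h.exists_isFourierOf
  exact hg2.congr hg.hat_ae_eq.symm

theorem InH.of_hat {σ τ : ℝ} {u : Dist d} (h : InH σ u) (h2 : WtL2 τ (hat u)) : InH τ u :=
  inH_of_wtL2 h.isFourierOf h2

theorem exists_inH_of_wtL2 {σ : ℝ} {g : Rd d → ℂ} (hg : WtL2 σ g) :
    ∃ u : Dist d, InH σ u ∧ hat u =ᵐ[volume] g := by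
  obtain ⟨u, hu⟩ := exists_isFourierOf_of_wtL2 hg
  exact ⟨u, inH_of_wtL2 hu hg, hu.hat_ae_eq⟩

theorem InH.mono {σ τ : ℝ} (h : σ ≤ τ) {u : Dist d} (hu : InH τ u) : InH σ u :=
  hu.of_hat (hu.wtL2.mono h)

/-! ## The isometry of `H^σ` with `L²` -/

/-- The constant `(2π)^{-d/2}`. -/
def cst (d : ℕ) : ℝ := ((2 * Real.pi) ^ ((d : ℝ) / 2))⁻¹

theorem cst_pos (d : ℕ) : 0 < cst d := by unfold cst; positivity

theorem cst_sq (d : ℕ) : cst d ^ 2 = ((2 * Real.pi) ^ d)⁻¹ := by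
  unfold cst
  rw [inv_pow, ← Real.rpow_natCast, ← Real.rpow_mul (by positivity)]
  norm_num

theorem cst_sq_complex (d : ℕ) : ((cst d : ℝ) : ℂ) * (cst d : ℝ) = ((2 * Real.pi : ℂ) ^ d)⁻¹ := by
  have := cst_sq d
  rw [← Complex.ofReal_mul, ← sq, this]
  push_cast
  rfl

open Classical in
/-- The isometry `u ↦ (2π)^{-d/2} (1 + ‖ξ‖²)^{σ/2} û` of `H^σ(ℝ^d)` onto `L²(ℝ^d)`. -/
def toL2 (σ : ℝ) (u : Dist d) : Lp ℂ 2 (volume : Measure (Rd d)) :=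
  if h : WtL2 σ (hat u) then ((cst d : ℝ) : ℂ) • MemLp.toLp _ h else 0

theorem InH.coeFn_toL2 {σ : ℝ} {u : Dist d} (h : InH σ u) :
    toL2 σ u =ᵐ[volume] fun ξ => ((cst d : ℝ) : ℂ) * (((wt σ ξ : ℝ) : ℂ) * hat u ξ) := by
  rw [toL2, dif_pos h.wtL2]
  filter_upwards [Lp.coeFn_smul ((cst d : ℝ) : ℂ) (MemLp.toLp _ h.wtL2),
    MemLp.coeFn_toLp h.wtL2] with ξ h1 h2
  rw [h1, Pi.smul_apply, h2, smul_eq_mul]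

theorem hat_add {σ : ℝ} {u v : Dist d} (hu : InH σ u) (hv : InH σ v) :
    hat (u + v) =ᵐ[volume] fun ξ => hat u ξ + hat v ξ :=
  (hu.isFourierOf.add hv.isFourierOf).hat_ae_eq

theorem hat_smul {σ : ℝ} {u : Dist d} (c : ℂ) (hu : InH σ u) :
    hat (c • u) =ᵐ[volume] fun ξ => c * hat u ξ :=
  (hu.isFourierOf.smul c).hat_ae_eq

theorem InH.add {σ : ℝ} {u v : Dist d} (hu : InH σ u) (hv : InH σ v) : InH σ (u + v) :=
  TemperedDistribution.MemSobolev.add hu hv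

theorem InH.smul {σ : ℝ} {u : Dist d} (c : ℂ) (hu : InH σ u) : InH σ (c • u) :=
  TemperedDistribution.MemSobolev.smul c hu

theorem InH.sub {σ : ℝ} {u v : Dist d} (hu : InH σ u) (hv : InH σ v) : InH σ (u - v) :=
  TemperedDistribution.MemSobolev.sub hu hv

theorem InH.sum {σ : ℝ} {ι : Type*} {u : ι → Dist d} (T : Finset ι) (hu : ∀ i ∈ T, InH σ (u i)) :
    InH σ (∑ i ∈ T, u i) := by
  classical
  induction T using Finset.induction_on with
  | empty => simp
  | insert a T ha ih =>
    rw [Finset.sum_insert ha]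
    exact (hu a (Finset.mem_insert_self a T)).add
      (ih fun i hi => hu i (Finset.mem_insert_of_mem hi))

theorem toL2_add {σ : ℝ} {u v : Dist d} (hu : InH σ u) (hv : InH σ v) :
    toL2 σ (u + v) = toL2 σ u + toL2 σ v := by
  refine Lp.ext ?_
  filter_upwards [Lp.coeFn_add (toL2 σ u) (toL2 σ v), (hu.add hv).coeFn_toL2, hu.coeFn_toL2,
    hv.coeFn_toL2, hat_add hu hv] with ξ h1 h2 h3 h4 h5
  rw [h1, Pi.add_apply, h2, h3, h4, h5]
  ring

theorem toL2_smul {σ : ℝ} {u : Dist d} (c : ℂ) (hu : InH σ u) :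
    toL2 σ (c • u) = c • toL2 σ u := by
  refine Lp.ext ?_
  filter_upwards [Lp.coeFn_smul c (toL2 σ u), (hu.smul c).coeFn_toL2, hu.coeFn_toL2,
    hat_smul c hu] with ξ h1 h2 h3 h5
  rw [h1, Pi.smul_apply, h2, h3, h5, smul_eq_mul]
  ring

theorem toL2_sub {σ : ℝ} {u v : Dist d} (hu : InH σ u) (hv : InH σ v) :
    toL2 σ (u - v) = toL2 σ u - toL2 σ v := by
  have h1 : u - v = u + (-1 : ℂ) • v := by
    ext θ
    change u θ - v θ = u θ + (-1) * v θ
    ring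
  rw [h1, toL2_add hu (hv.smul _), toL2_smul _ hv]
  simp [sub_eq_add_neg]

theorem toL2_sum {σ : ℝ} {ι : Type*} {u : ι → Dist d} (T : Finset ι)
    (hu : ∀ i ∈ T, InH σ (u i)) :
    toL2 σ (∑ i ∈ T, u i) = ∑ i ∈ T, toL2 σ (u i) := by
  classical
  induction T using Finset.induction_on with
  | empty =>
    have := toL2_smul (σ := σ) (u := (0 : Dist d)) 0
      (TemperedDistribution.memSobolev_fun_zero _ _ _ _)
    have h0 : (0 : ℂ) • (0 : Dist d) = 0 := by
      ext θ
      exact zero_mul _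
    rw [h0, zero_smul] at this
    simpa using this
  | insert a T ha ih =>
    have h1 : ∀ i ∈ T, InH σ (u i) := fun i hi => hu i (Finset.mem_insert_of_mem hi)
    rw [Finset.sum_insert ha, Finset.sum_insert ha,
      toL2_add (hu a (Finset.mem_insert_self a T)) (InH.sum T h1), ih h1]

theorem innerH_eq_inner {σ : ℝ} {u v : Dist d} (hu : InH σ u) (hv : InH σ v) :
    innerH σ u v = inner ℂ (toL2 σ v) (toL2 σ u) := by
  rw [innerH, L2.inner_def, ← integral_const_mul]
  refine integral_congr_ae ?_
  filter_upwards [hu.coeFn_toL2, hv.coeFn_toL2] with ξ h1 h2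
  rw [h1, h2, RCLike.inner_apply, ← cst_sq_complex, ← wt_sq]
  simp only [map_mul, Complex.conj_ofReal]
  push_cast
  ring

/-- The weights of exponents `σ` and `-σ` cancel. This places both framelet systems in one Hilbert
space, with duality expressed by its inner product. -/
theorem pairing_eq_inner {σ : ℝ} {u v : Dist d} (hu : InH σ u) (hv : InH (-σ) v) :
    pairing u v = inner ℂ (toL2 (-σ) v) (toL2 σ u) := by
  rw [pairing, L2.inner_def, ← integral_const_mul]
  refine integral_congr_ae ?_
  filter_upwards [hu.coeFn_toL2, hv.coeFn_toL2] with ξ h1 h2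
  rw [h1, h2, RCLike.inner_apply, ← cst_sq_complex]
  have : ((wt σ ξ : ℝ) : ℂ) * ((wt (-σ) ξ : ℝ) : ℂ) = 1 := by
    rw [← Complex.ofReal_mul, wt_mul_neg, Complex.ofReal_one]
  simp only [map_mul, Complex.conj_ofReal]
  linear_combination (-(cst d : ℂ) * cst d * hat u ξ * starRingEnd ℂ (hat v ξ)) * this

theorem normH_sq (σ : ℝ) (u : Dist d) :
    normH σ u ^ 2 = cst d ^ 2 * ∫ ξ : Rd d, ‖hat u ξ‖ ^ 2 * (1 + ‖ξ‖ ^ 2) ^ σ := by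
  rw [normH, mul_pow, Real.sq_sqrt (integral_nonneg fun ξ => by positivity)]
  rfl

theorem normH_nonneg (σ : ℝ) (u : Dist d) : 0 ≤ normH σ u := by
  unfold normH; positivity

theorem normH_eq_norm {σ : ℝ} {u : Dist d} (hu : InH σ u) : normH σ u = ‖toL2 σ u‖ := by
  rw [← sq_eq_sq₀ (normH_nonneg _ _) (norm_nonneg _), normH_sq]
  have h := innerH_eq_inner hu hu
  rw [inner_self_eq_norm_sq_to_K, innerH] at h
  have h3 : (fun ξ : Rd d => hat u ξ * starRingEnd ℂ (hat u ξ) * (((1 + ‖ξ‖ ^ 2) ^ σ : ℝ) : ℂ))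
      = fun ξ => ((‖hat u ξ‖ ^ 2 * (1 + ‖ξ‖ ^ 2) ^ σ : ℝ) : ℂ) := by
    ext ξ
    rw [Complex.mul_conj, Complex.normSq_eq_norm_sq]
    push_cast
    rfl
  rw [h3, integral_complex_ofReal, ← cst_sq_complex] at h
  rw [sq]
  exact Complex.ofReal_injective (by push_cast; exact h)

/-- Needed to turn frame inequalities and dual expansions quantified over Sobolev distributions into
statements about all vectors of `L²`. -/
theorem toL2_surjective (σ : ℝ) (x : Lp ℂ 2 (volume : Measure (Rd d))) :
    ∃ u : Dist d, InH σ u ∧ toL2 σ u = x := by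
  set g : Rd d → ℂ := fun ξ => ((cst d : ℝ) : ℂ)⁻¹ * (((wt (-σ) ξ : ℝ) : ℂ) * x ξ)
  have e : ∀ ξ, ((cst d : ℝ) : ℂ) * (((wt σ ξ : ℝ) : ℂ) * g ξ) = x ξ := by
    intro ξ
    have h1 : ((wt σ ξ : ℝ) : ℂ) * ((wt (-σ) ξ : ℝ) : ℂ) = 1 := by
      rw [← Complex.ofReal_mul, wt_mul_neg, Complex.ofReal_one]
    have h2 : ((cst d : ℝ) : ℂ) * ((cst d : ℝ) : ℂ)⁻¹ = 1 :=
      mul_inv_cancel₀ (by exact_mod_cast (cst_pos d).ne')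
    simp only [g]
    linear_combination (((cst d : ℝ) : ℂ) * ((cst d : ℝ) : ℂ)⁻¹ * x ξ) * h1 + x ξ * h2
  have hg : WtL2 σ g := by
    have := (Lp.memLp x).const_mul ((cst d : ℝ) : ℂ)⁻¹
    refine (memLp_congr_ae (Eventually.of_forall fun ξ => ?_)).mp this
    rw [← e ξ, ← mul_assoc, inv_mul_cancel₀ (by exact_mod_cast (cst_pos d).ne'), one_mul]
  obtain ⟨u, hu, hu2⟩ := exists_inH_of_wtL2 hg
  refine ⟨u, hu, Lp.ext ?_⟩
  filter_upwards [hu.coeFn_toL2, hu2] with ξ h1 h2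
  rw [h1, h2, e]

/-! ## Bessel sequences and dual systems in a Hilbert space -/

section Hilbert

variable {H : Type*} [NormedAddCommGroup H] [InnerProductSpace ℂ H] {ι : Type*}

theorem enorm_sq_eq_ofReal (z : ℂ) : ‖z‖ₑ ^ 2 = ENNReal.ofReal (‖z‖ ^ 2) := by
  rw [← ofReal_norm, ENNReal.ofReal_pow (norm_nonneg _)]

theorem sum_norm_sq_le_of_tsum_enorm_sq_le {c : ι → ℂ} {R : ℝ} (hR : 0 ≤ R)
    (h : ∑' k, ‖c k‖ₑ ^ 2 ≤ ENNReal.ofReal R) (T : Finset ι) : ∑ k ∈ T, ‖c k‖ ^ 2 ≤ R := by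
  have h1 := (ENNReal.sum_le_tsum (f := fun k => ‖c k‖ₑ ^ 2) T).trans h
  simp only [enorm_sq_eq_ofReal] at h1
  rw [← ENNReal.ofReal_sum_of_nonneg (fun i _ => by positivity)] at h1
  exact (ENNReal.ofReal_le_ofReal_iff hR).mp h1

/-- The synthesis operator is the adjoint of the analysis operator: expand `⟨y, y⟩` for the finite
sum `y`, apply Cauchy–Schwarz and the Bessel bound at `y`, and divide by `‖y‖²`. -/
theorem norm_sum_smul_sq_le {a : ι → H} {C : ℝ} (hC : 0 ≤ C)
    (hB : ∀ x : H, ∑' k, ‖inner ℂ (a k) x‖ₑ ^ 2 ≤ ENNReal.ofReal (C * ‖x‖ ^ 2))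
    (c : ι → ℂ) (T : Finset ι) :
    ‖∑ k ∈ T, c k • a k‖ ^ 2 ≤ C * ∑ k ∈ T, ‖c k‖ ^ 2 := by
  set y := ∑ k ∈ T, c k • a k with hy
  have h1 : ‖y‖ ^ 2 ≤ ∑ k ∈ T, ‖c k‖ * ‖inner ℂ (a k) y‖ := by
    have e : ((‖y‖ ^ 2 : ℝ) : ℂ) = ∑ k ∈ T, c k * inner ℂ y (a k) := by
      have e1 : inner ℂ y y = ∑ k ∈ T, c k * inner ℂ y (a k) := by
        conv_lhs => rw [hy]
        rw [← hy, inner_sum]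
        simp [inner_smul_right]
      rw [← e1, inner_self_eq_norm_sq_to_K]
      push_cast
      rfl
    have e2 : ‖y‖ ^ 2 = ‖((‖y‖ ^ 2 : ℝ) : ℂ)‖ := by
      rw [Complex.norm_real, Real.norm_of_nonneg (by positivity)]
    rw [e2, e]
    refine (norm_sum_le _ _).trans (Finset.sum_le_sum fun k _ => ?_)
    rw [norm_mul, norm_inner_symm]
  have h2 := Finset.sum_mul_sq_le_sq_mul_sq T (fun k => ‖c k‖) (fun k => ‖inner ℂ (a k) y‖)
  have h3 := sum_norm_sq_le_of_tsum_enorm_sq_le (by positivity) (hB y) T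
  have h4 : 0 ≤ ∑ k ∈ T, ‖c k‖ ^ 2 := Finset.sum_nonneg fun _ _ => by positivity
  have h5 : (‖y‖ ^ 2) ^ 2 ≤ (∑ k ∈ T, ‖c k‖ ^ 2) * (C * ‖y‖ ^ 2) :=
    (pow_le_pow_left₀ (by positivity) h1 2).trans (h2.trans (by gcongr))
  rcases eq_or_lt_of_le (sq_nonneg ‖y‖) with h0 | h0
  · rw [← h0]; positivity
  · nlinarith

theorem summable_smul_of_bessel [CompleteSpace H] {a : ι → H} {C : ℝ} (hC : 0 ≤ C)
    (hB : ∀ x : H, ∑' k, ‖inner ℂ (a k) x‖ₑ ^ 2 ≤ ENNReal.ofReal (C * ‖x‖ ^ 2))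
    {c : ι → ℂ} (hc : ∑' k, ‖c k‖ₑ ^ 2 ≠ ⊤) : Summable fun k => c k • a k := by
  have hs : Summable fun k => ‖c k‖ ^ 2 := by
    have := ENNReal.summable_toReal hc
    simpa using this
  rw [summable_iff_vanishing_norm] at hs ⊢
  intro ε hε
  obtain ⟨s, hs⟩ := hs (ε ^ 2 / (C + 1)) (by positivity)
  refine ⟨s, fun t ht => ?_⟩
  have h1 := norm_sum_smul_sq_le hC hB c t
  have h2 := hs t ht
  rw [Real.norm_of_nonneg (Finset.sum_nonneg fun _ _ => by positivity),
    lt_div_iff₀ (by positivity)] at h2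
  have h4 : 0 ≤ ∑ k ∈ t, ‖c k‖ ^ 2 := Finset.sum_nonneg fun _ _ => by positivity
  refine lt_of_pow_lt_pow_left₀ 2 hε.le ?_
  nlinarith

/-- The weighted arithmetic–geometric mean inequality replaces Cauchy–Schwarz for the iterated sums
in `ℝ≥0∞`; the parameter `t` is tuned where it is used. -/
theorem two_mul_enorm_mul_le {t : ℝ} (ht : 0 < t) (a b : ℂ) :
    2 * ‖a * b‖ₑ ≤ ENNReal.ofReal t * ‖a‖ₑ ^ 2 + ENNReal.ofReal t⁻¹ * ‖b‖ₑ ^ 2 := by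
  rw [enorm_sq_eq_ofReal, enorm_sq_eq_ofReal, ← ENNReal.ofReal_mul ht.le,
    ← ENNReal.ofReal_mul (by positivity), ← ENNReal.ofReal_add (by positivity) (by positivity),
    ← ofReal_norm, ← ENNReal.ofReal_ofNat 2, ← ENNReal.ofReal_mul (by norm_num), norm_mul]
  apply ENNReal.ofReal_le_ofReal
  have h1 : t * ‖a‖ ^ 2 + t⁻¹ * ‖b‖ ^ 2 - 2 * (‖a‖ * ‖b‖) = t⁻¹ * (t * ‖a‖ - ‖b‖) ^ 2 := by
    field_simp
    ring
  have h2 : 0 ≤ t⁻¹ * (t * ‖a‖ - ‖b‖) ^ 2 := by positivity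
  linarith

theorem two_mul_sum_enorm_le {L : ℕ} {t : ℝ} (ht : 0 < t) (a b : Fin L → ℕ → ι → ℂ) :
    2 * ∑ l, ∑' j, ∑' k, ‖a l j k * b l j k‖ₑ ≤
      ENNReal.ofReal t * ∑ l, ∑' j, ∑' k, ‖a l j k‖ₑ ^ 2 +
        ENNReal.ofReal t⁻¹ * ∑ l, ∑' j, ∑' k, ‖b l j k‖ₑ ^ 2 := by
  simp only [Finset.mul_sum, ← ENNReal.tsum_mul_left, ← Finset.sum_add_distrib, ← ENNReal.tsum_add]
  gcongr with l _ j k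
  exact two_mul_enorm_mul_le ht _ _

theorem summable_of_tsum_enorm_ne_top {c : ι → ℂ} (h : ∑' k, ‖c k‖ₑ ≠ ⊤) : Summable c := by
  have := ENNReal.summable_toReal h
  exact Summable.of_norm (by simpa using this)

theorem norm_sub_truncated_sq_le {L : ℕ} {e0 e0' : ι → H} {e e' : Fin L → ℕ → ι → H}
    {C R : ℝ} (hC : 0 < C) (hR : 0 ≤ R)
    (hB : ∀ x : H, ∑ l, ∑' j, ∑' k, ‖inner ℂ (e l j k) x‖ₑ ^ 2 ≤ ENNReal.ofReal (C * ‖x‖ ^ 2))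
    {x : H}
    (hdual : ∀ y : H, inner ℂ y x = ∑' k, inner ℂ y (e0 k) * inner ℂ (e0' k) x
      + ∑ l, ∑' j, ∑' k, inner ℂ y (e l j k) * inner ℂ (e' l j k) x)
    (hfin : ∑ l, ∑' j, ∑' k, ‖inner ℂ (e' l j k) x‖ₑ ^ 2 ≠ ⊤) {N : ℕ}
    (htail : ∑ l, ∑' j, ∑' k, ‖inner ℂ (e' l (j + N) k) x‖ₑ ^ 2 ≤ ENNReal.ofReal R)
    {u : H} {v : Fin L → ℕ → H} (hu : HasSum (fun k => inner ℂ (e0' k) x • e0 k) u)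
    (hv : ∀ l, ∀ j < N, HasSum (fun k => inner ℂ (e' l j k) x • e l j k) (v l j)) :
    ‖x - (u + ∑ l, ∑ j ∈ Finset.range N, v l j)‖ ^ 2 ≤ C * R := by
  set w := x - (u + ∑ l, ∑ j ∈ Finset.range N, v l j) with hw
  have key : ∀ (c : ι → ℂ) (a : ι → H) (z : H), HasSum (fun k => c k • a k) z →
      inner ℂ w z = ∑' k, inner ℂ w (a k) * c k := by
    intro c a z h
    have := ((innerSL ℂ w).hasSum h).tsum_eq
    rw [innerSL_apply_apply] at this
    rw [← this]
    refine tsum_congr fun k => ?_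
    rw [innerSL_apply_apply, inner_smul_right, mul_comm]
  set A : Fin L → ℕ → ℂ := fun l j => ∑' k, inner ℂ w (e l j k) * inner ℂ (e' l j k) x with hA
  have hBw : ∑ l, ∑' j, ∑' k, ‖inner ℂ w (e l j k)‖ₑ ^ 2 ≤ ENNReal.ofReal (C * ‖w‖ ^ 2) := by
    refine le_trans (le_of_eq ?_) (hB w)
    simp only [← ofReal_norm, norm_inner_symm w]
  have hAsum : ∀ l, Summable (A l) := by
    intro l
    refine summable_of_tsum_enorm_ne_top ?_
    have h1 := two_mul_sum_enorm_le one_pos (fun l j k => inner ℂ w (e l j k))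
      (fun l j k => inner ℂ (e' l j k) x)
    have h2 : 2 * ∑ l, ∑' j, ∑' k, ‖inner ℂ w (e l j k) * inner ℂ (e' l j k) x‖ₑ ≠ ⊤ := by
      refine ne_top_of_le_ne_top ?_ h1
      refine ENNReal.add_ne_top.mpr ⟨ENNReal.mul_ne_top ENNReal.ofReal_ne_top
        (ne_top_of_le_ne_top ENNReal.ofReal_ne_top hBw),
        ENNReal.mul_ne_top ENNReal.ofReal_ne_top hfin⟩
    have h3 : ∑ l, ∑' j, ∑' k, ‖inner ℂ w (e l j k) * inner ℂ (e' l j k) x‖ₑ ≠ ⊤ := by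
      intro h
      rw [h] at h2
      exact h2 (by simp)
    have h4 := ENNReal.sum_ne_top.mp h3 l (Finset.mem_univ l)
    refine ne_top_of_le_ne_top h4 (ENNReal.tsum_le_tsum fun j => ?_)
    exact enorm_tsum_le_tsum_enorm
  -- The dual expansion is tested at `y = w`. The `e0` series and the levels below `N` occur both in
  -- `x` and in its truncation, so only the tail survives.
  have h1 : inner ℂ w w = ∑ l, ∑' j, A l (j + N) := by
    conv_lhs => rw [hw]
    rw [← hw, inner_sub_right, hdual w, inner_add_right, key _ _ _ hu, inner_sum]
    have h2 : ∀ l, inner ℂ w (∑ j ∈ Finset.range N, v l j) = ∑ j ∈ Finset.range N, A l j := by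
      intro l
      rw [inner_sum]
      exact Finset.sum_congr rfl fun j hj => key _ _ _ (hv l j (Finset.mem_range.mp hj))
    simp only [h2]
    rw [add_sub_add_left_eq_sub, ← Finset.sum_sub_distrib]
    refine Finset.sum_congr rfl fun l _ => ?_
    rw [← (hAsum l).sum_add_tsum_nat_add N]
    ring
  have h2 : ENNReal.ofReal (‖w‖ ^ 2) ≤
      ∑ l, ∑' j, ∑' k, ‖inner ℂ w (e l (j + N) k) * inner ℂ (e' l (j + N) k) x‖ₑ := by
    have e1 : ENNReal.ofReal (‖w‖ ^ 2) = ‖inner ℂ w w‖ₑ := by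
      rw [← ofReal_norm, inner_self_eq_norm_sq_to_K, norm_pow]
      simp
    rw [e1, h1]
    refine (enorm_sum_le _ _).trans (Finset.sum_le_sum fun l _ => ?_)
    refine enorm_tsum_le_tsum_enorm.trans (ENNReal.tsum_le_tsum fun j => ?_)
    exact enorm_tsum_le_tsum_enorm
  have h3 : ∑ l, ∑' j, ∑' k, ‖inner ℂ w (e l (j + N) k)‖ₑ ^ 2 ≤ ENNReal.ofReal (C * ‖w‖ ^ 2) := by
    refine (Finset.sum_le_sum fun l _ => ?_).trans hBw
    exact ENNReal.tsum_comp_le_tsum_of_injective (add_left_injective N)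
      (fun j => ∑' k, ‖inner ℂ w (e l j k)‖ₑ ^ 2)
  -- With `t = C⁻¹` the Bessel term is at most `‖w‖²` and is absorbed on the left: `2‖w‖² ≤ ‖w‖² + C
  -- R`.
  have h4 := two_mul_sum_enorm_le (inv_pos.mpr hC) (fun l j k => inner ℂ w (e l (j + N) k))
      (fun l j k => inner ℂ (e' l (j + N) k) x)
  have h5 : 2 * ENNReal.ofReal (‖w‖ ^ 2) ≤ ENNReal.ofReal C⁻¹ * ENNReal.ofReal (C * ‖w‖ ^ 2)
      + ENNReal.ofReal C⁻¹⁻¹ * ENNReal.ofReal R :=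
    (mul_le_mul_right h2 2).trans (h4.trans (by gcongr))
  rw [← ENNReal.ofReal_mul (by positivity), ← ENNReal.ofReal_mul (by positivity),
    ← ENNReal.ofReal_add (by positivity) (by positivity), ← ENNReal.ofReal_ofNat 2,
    ← ENNReal.ofReal_mul (by norm_num), ENNReal.ofReal_le_ofReal_iff (by positivity), inv_inv,
    inv_mul_cancel_left₀ hC.ne'] at h5
  linarith

end Hilbert

/-! ## Isotropic dilations -/

theorem det_toEuclideanCLM (A : Matrix (Fin d) (Fin d) ℝ) :
    LinearMap.det ((Matrix.toEuclideanCLM (𝕜 := ℝ) A : Rd d →L[ℝ] Rd d) : Rd d →ₗ[ℝ] Rd d)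
      = A.det := by
  rw [Matrix.coe_toEuclideanCLM_eq_toEuclideanLin, Matrix.toEuclideanLin_eq_toLin_orthonormal,
    LinearMap.det_toLin]

theorem inner_toEuclideanCLM_left (A : Matrix (Fin d) (Fin d) ℝ) (x y : Rd d) :
    inner ℝ (Matrix.toEuclideanCLM (𝕜 := ℝ) A x) y
      = inner ℝ x (Matrix.toEuclideanCLM (𝕜 := ℝ) A.transpose y) := by
  rw [← Matrix.conjTranspose_eq_transpose_of_trivial, ← Matrix.star_eq_conjTranspose, map_star,
    ContinuousLinearMap.star_eq_adjoint, ContinuousLinearMap.adjoint_inner_right]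

theorem coe_pow_equiv (B : Rd d ≃L[ℝ] Rd d) (j : ℕ) :
    ((B ^ j : Rd d ≃L[ℝ] Rd d) : Rd d →ₗ[ℝ] Rd d) = (B : Rd d →ₗ[ℝ] Rd d) ^ j := by
  induction j with
  | zero => rfl
  | succ j ih =>
    rw [pow_succ, pow_succ, ← ih]
    rfl

theorem absdet_pow (B : Rd d ≃L[ℝ] Rd d) (j : ℕ) :
    |LinearMap.det ((B ^ j : Rd d ≃L[ℝ] Rd d) : Rd d →ₗ[ℝ] Rd d)|
      = |LinearMap.det (B : Rd d →ₗ[ℝ] Rd d)| ^ j := by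
  rw [coe_pow_equiv, map_pow, abs_pow]

theorem absdet_symm (B : Rd d ≃L[ℝ] Rd d) :
    |LinearMap.det (B.symm : Rd d →ₗ[ℝ] Rd d)| = |LinearMap.det (B : Rd d →ₗ[ℝ] Rd d)|⁻¹ := by
  have h : LinearMap.det (B.symm : Rd d →ₗ[ℝ] Rd d) * LinearMap.det (B : Rd d →ₗ[ℝ] Rd d) = 1 :=
    LinearEquiv.det_symm_mul_det B.toLinearEquiv
  exact eq_inv_of_mul_eq_one_left (by rw [← abs_mul, h, abs_one])

namespace Dilation

variable (M : Dilation d)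

/-- The linear automorphism `ξ ↦ Mᵀ ξ` of `ℝ^d`. -/
def tr : Rd d ≃L[ℝ] Rd d :=
  ContinuousLinearEquiv.equivOfInverse
    (Matrix.toEuclideanCLM (𝕜 := ℝ) M.real.transpose)
    (Matrix.toEuclideanCLM (𝕜 := ℝ) M.real.transpose⁻¹)
    (fun x => by
      rw [← mul_apply_eq_comp, ← map_mul, Matrix.nonsing_inv_mul _
        (by rw [Matrix.det_transpose]; exact M.isUnit_det_real)]
      simp)
    (fun x => by
      rw [← mul_apply_eq_comp, ← map_mul, Matrix.mul_nonsing_inv _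
        (by rw [Matrix.det_transpose]; exact M.isUnit_det_real)]
      simp)

theorem inner_equiv (x y : Rd d) : inner ℝ (M.equiv x) y = inner ℝ x (M.tr y) :=
  inner_toEuclideanCLM_left M.real x y

theorem inner_equiv_pow (j : ℕ) (x y : Rd d) :
    inner ℝ ((M.equiv ^ j) x) y = inner ℝ x ((M.tr ^ j) y) := by
  induction j generalizing x y with
  | zero => rfl
  | succ j ih =>
    rw [pow_succ, pow_succ']
    change inner ℝ ((M.equiv ^ j) (M.equiv x)) y = inner ℝ x (M.tr ((M.tr ^ j) y))
    rw [ih, inner_equiv]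

theorem real_det : M.real.det = (M.mat.det : ℝ) := by
  have h2 := (Int.castRingHom ℝ).map_det M.mat
  simpa [RingHom.mapMatrix_apply, real] using h2.symm

theorem m_pow (hd : 0 < d) : M.m ^ d = |(M.mat.det : ℝ)| := by
  unfold m
  rw [← Real.rpow_natCast, ← Real.rpow_mul (abs_nonneg _), one_div_mul_cancel (by positivity),
    Real.rpow_one]

theorem absdet_tr (hd : 0 < d) : |LinearMap.det (M.tr : Rd d →ₗ[ℝ] Rd d)| = M.m ^ d := by
  have h : LinearMap.det (M.tr : Rd d →ₗ[ℝ] Rd d) = M.real.transpose.det :=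
    det_toEuclideanCLM M.real.transpose
  rw [h, Matrix.det_transpose, real_det, m_pow M hd]

theorem absdet_equiv (hd : 0 < d) : |LinearMap.det (M.equiv : Rd d →ₗ[ℝ] Rd d)| = M.m ^ d := by
  have h : LinearMap.det (M.equiv : Rd d →ₗ[ℝ] Rd d) = M.real.det := det_toEuclideanCLM M.real
  rw [h, real_det, m_pow M hd]

theorem one_lt_m (hd : 0 < d) : 1 < M.m := by
  obtain ⟨P, lam, hP, hM, hlam⟩ := M.isotropic
  unfold m
  rw [← hlam ⟨0, hd⟩]
  refine M.eigenvalue_gt _ ?_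
  let U : (Matrix (Fin d) (Fin d) ℂ)ˣ := Matrix.nonsingInvUnit P hP
  have h1 : M.mat.map (Int.cast : ℤ → ℂ) = (U : Matrix (Fin d) (Fin d) ℂ) *
      Matrix.diagonal lam * ((U⁻¹ : (Matrix (Fin d) (Fin d) ℂ)ˣ) : Matrix (Fin d) (Fin d) ℂ) := hM
  rw [h1, spectrum.units_conjugate, spectrum_diagonal]
  exact ⟨_, rfl⟩

/-- Transposing the diagonalization gives `Pᵀ Mᵀ = diag(λ) Pᵀ`. In the coordinates `Pᵀ ξ` each
component is multiplied by a number of modulus `m`, so the sup norm is scaled exactly. -/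
theorem exists_adapted_map :
    ∃ Λ : Rd d →ₗ[ℝ] (Fin d → ℂ), Λ.ker = ⊥ ∧ ∀ ξ, ‖Λ (M.tr ξ)‖ = M.m * ‖Λ ξ‖ := by
  obtain ⟨P, lam, hP, hM, hlam⟩ := M.isotropic
  have hQ : P.transpose * (M.mat.map (Int.cast : ℤ → ℂ)).transpose
      = Matrix.diagonal lam * P.transpose := by
    rw [hM, Matrix.transpose_mul, Matrix.transpose_mul, Matrix.diagonal_transpose, ← mul_assoc,
      ← Matrix.transpose_mul, Matrix.nonsing_inv_mul _ hP, Matrix.transpose_one, one_mul]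
  let Λ : Rd d →ₗ[ℝ] (Fin d → ℂ) :=
    { toFun := fun ξ => P.transpose.mulVec (fun i => (ξ i : ℂ))
      map_add' := fun x y => by
        rw [← Matrix.mulVec_add]
        congr 1
        ext i
        simp
      map_smul' := fun c x => by
        ext i
        simp only [Matrix.mulVec, dotProduct, PiLp.smul_apply, smul_eq_mul, Complex.ofReal_mul,
          RingHom.id_apply, Pi.smul_apply, Complex.real_smul, Finset.mul_sum]
        exact Finset.sum_congr rfl fun j _ => by ring }
  have hΛ : ∀ ξ, Λ ξ = P.transpose.mulVec (fun i => (ξ i : ℂ)) := fun _ => rfl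
  refine ⟨Λ, ?_, fun ξ => ?_⟩
  · rw [LinearMap.ker_eq_bot']
    intro ξ h
    have h1 : P.transpose⁻¹.mulVec (Λ ξ) = fun i => (ξ i : ℂ) := by
      rw [hΛ, Matrix.mulVec_mulVec, Matrix.nonsing_inv_mul _ (by rwa [Matrix.det_transpose]),
        Matrix.one_mulVec]
    rw [h, Matrix.mulVec_zero] at h1
    ext i
    have := congrFun h1 i
    simpa using this.symm
  · have h1 : Λ (M.tr ξ) = fun i => lam i * Λ ξ i := by
      have h2 : (fun i => ((M.tr ξ) i : ℂ))
          = (M.mat.map (Int.cast : ℤ → ℂ)).transpose.mulVec (fun i => (ξ i : ℂ)) := by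
        ext i
        change ((M.real.transpose.mulVec ξ.ofLp i : ℝ) : ℂ) = _
        simp [Matrix.mulVec, dotProduct, real]
      rw [hΛ, h2, Matrix.mulVec_mulVec, hQ, ← Matrix.mulVec_mulVec, ← hΛ]
      ext i
      rw [Matrix.mulVec_diagonal]
    have hm : ∀ i, ‖lam i‖ = M.m := hlam
    have hm0 : 0 ≤ M.m := by unfold m; positivity
    rw [h1]
    refine le_antisymm ?_ ?_
    · refine (pi_norm_le_iff_of_nonneg (by positivity)).mpr fun i => ?_
      rw [norm_mul, hm]
      gcongr
      exact norm_le_pi_norm _ i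
    · have h3 : ‖Λ ξ‖ * M.m = ‖fun i => M.m • Λ ξ i‖ := by
        have := norm_smul M.m (Λ ξ)
        rw [Real.norm_of_nonneg hm0] at this
        rw [mul_comm, ← this]
        rfl
      rw [mul_comm, h3]
      refine (pi_norm_le_iff_of_nonneg (norm_nonneg _)).mpr fun i => ?_
      rw [norm_smul, Real.norm_of_nonneg hm0, ← hm i, ← norm_mul]
      exact norm_le_pi_norm (fun i => lam i * Λ ξ i) i

/-- Powers of `Mᵀ` expand all vectors uniformly. -/
theorem exists_expansion (hd : 0 < d) : ∃ K : ℝ, 0 < K ∧ ∀ (j : ℕ) (ξ : Rd d),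
    ‖(M.tr ^ j).symm ξ‖ ≤ K * (M.m ^ j)⁻¹ * ‖ξ‖ := by
  obtain ⟨Λ, hker, hΛ⟩ := M.exists_adapted_map
  obtain ⟨K, hK, hanti⟩ := Λ.exists_antilipschitzWith hker
  set Λc := LinearMap.toContinuousLinearMap Λ
  have hpow : ∀ (j : ℕ) ξ, ‖Λ ((M.tr ^ j) ξ)‖ = M.m ^ j * ‖Λ ξ‖ := by
    intro j
    induction j with
    | zero =>
      intro ξ
      rw [pow_zero, pow_zero, one_mul]
      rfl
    | succ j ih =>
      intro ξ
      rw [pow_succ']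
      change ‖Λ (M.tr ((M.tr ^ j) ξ))‖ = _
      rw [hΛ, ih, pow_succ']
      ring
  have hm := one_lt_m M hd
  -- The `+ 1` makes the constant positive without checking that `Λ` is nonzero.
  refine ⟨K * ‖Λc‖ + 1, by positivity, fun j ξ => ?_⟩
  obtain ⟨η, rfl⟩ := (M.tr ^ j).surjective ξ
  rw [ContinuousLinearEquiv.symm_apply_apply]
  have h1 : ‖η‖ ≤ K * ‖Λ η‖ := by
    have := hanti.le_mul_dist η 0
    simpa using this
  have h2 : ‖Λ ((M.tr ^ j) η)‖ ≤ ‖Λc‖ * ‖(M.tr ^ j) η‖ := Λc.le_opNorm _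
  rw [hpow] at h2
  have hmj : 0 < M.m ^ j := by positivity
  rw [mul_assoc, mul_left_comm, ← div_eq_inv_mul, le_div_iff₀ hmj]
  calc ‖η‖ * M.m ^ j ≤ K * ‖Λ η‖ * M.m ^ j := by gcongr
    _ = K * (M.m ^ j * ‖Λ η‖) := by ring
    _ ≤ K * (‖Λc‖ * ‖(M.tr ^ j) η‖) := by gcongr
    _ ≤ (K * ‖Λc‖ + 1) * ‖(M.tr ^ j) η‖ := by nlinarith [norm_nonneg ((M.tr ^ j) η)]

end Dilation

/-! ## The Fourier transforms of the atoms -/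

theorem inner_ofInt (k : Fin d → ℤ) (ξ : Rd d) :
    inner ℝ (ofInt k) ξ = ∑ i, (k i : ℝ) * ξ i := by
  rw [PiLp.inner_apply]
  simp [ofInt, mul_comm]

theorem conj_expo (k : Fin d → ℤ) (ξ : Rd d) :
    starRingEnd ℂ (expo k ξ) = Complex.exp (((-inner ℝ (ofInt k) ξ : ℝ) : ℂ) * Complex.I) := by
  rw [expo, ← Complex.exp_conj, inner_ofInt, map_mul, Complex.conj_I, Complex.conj_ofReal]
  congr 1
  push_cast
  ring

theorem norm_expo (k : Fin d → ℤ) (ξ : Rd d) : ‖expo k ξ‖ = 1 := by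
  rw [expo, mul_comm, Complex.norm_exp_ofReal_mul_I]

theorem continuous_expo (k : Fin d → ℤ) : Continuous (expo k : Rd d → ℂ) := by
  unfold expo
  fun_prop

theorem WtL2.of_norm_le {σ : ℝ} {g g' : Rd d → ℂ} (hg : WtL2 σ g)
    (hg' : AEStronglyMeasurable g' volume) (C : ℝ) (h : ∀ᵐ ξ, ‖g' ξ‖ ≤ C * ‖g ξ‖) :
    WtL2 σ g' := by
  refine WtL2.of_bound hg hg' C ?_
  filter_upwards [h] with ξ hξ
  rw [norm_mul, Complex.norm_real, Real.norm_of_nonneg (wt_pos σ ξ).le]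
  nlinarith [wt_pos σ ξ]

/-- The normalizing factor `m^{j(d/2-s)} m^{-jd}` of the Fourier transform of `u^s_{j,k}`. -/
def Dilation.factor (M : Dilation d) (s : ℝ) (j : ℕ) : ℝ :=
  M.m ^ ((j : ℝ) * ((d : ℝ) / 2 - s)) * (M.m ^ (d * j))⁻¹

theorem isFourierOf_atom (hd : 0 < d) (M : Dilation d) (s : ℝ) {u : Dist d} {g : Rd d → ℂ}
    (h : IsFourierOf u g) (j : ℕ) (k : Fin d → ℤ) :
    IsFourierOf (atom M s u j k) (fun ξ => ((M.factor s j : ℝ) : ℂ) *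
      (starRingEnd ℂ (expo k ((M.tr ^ j).symm ξ)) * g ((M.tr ^ j).symm ξ))) := by
  have h1 := (h.dilateShift (M.equiv ^ j) (M.tr ^ j) (M.inner_equiv_pow j)
    (by rw [absdet_pow, absdet_pow, M.absdet_tr hd, M.absdet_equiv hd]) (ofInt k)).smul
      ((M.m ^ ((j : ℝ) * ((d : ℝ) / 2 - s)) : ℝ) : ℂ)
  rw [absdet_pow, M.absdet_equiv hd, ← pow_mul] at h1
  refine h1.congr (Eventually.of_forall fun ξ => ?_)
  simp only [conj_expo, Dilation.factor]
  push_cast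
  ring

theorem inH_atom (hd : 0 < d) (M : Dilation d) (s : ℝ) {σ : ℝ} {u : Dist d} (hu : InH σ u)
    (j : ℕ) (k : Fin d → ℤ) : InH σ (atom M s u j k) := by
  have h1 := isFourierOf_atom hd M s hu.isFourierOf j k
  refine inH_of_wtL2 h1 ((hu.wtL2.comp (M.tr ^ j).symm).of_norm_le h1.1 |M.factor s j|
    (Eventually.of_forall fun ξ => ?_))
  rw [norm_mul, norm_mul, RCLike.norm_conj, norm_expo, one_mul, Complex.norm_real,
    Real.norm_eq_abs]

theorem hat_atom (hd : 0 < d) (M : Dilation d) (s : ℝ) {σ : ℝ} {u : Dist d} (hu : InH σ u)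
    (j : ℕ) (k : Fin d → ℤ) :
    hat (atom M s u j k) =ᵐ[volume] fun ξ => ((M.factor s j : ℝ) : ℂ) *
      (starRingEnd ℂ (expo k ((M.tr ^ j).symm ξ)) * hat u ((M.tr ^ j).symm ξ)) :=
  (isFourierOf_atom hd M s hu.isFourierOf j k).hat_ae_eq

theorem shift_eq_atom (M : Dilation d) (s : ℝ) (u : Dist d) (k : Fin d → ℤ) :
    shift u k = atom M s u 0 k := by
  have h : M.m ^ (((0 : ℕ) : ℝ) * ((d : ℝ) / 2 - s)) = 1 := by simp
  ext θ
  change shift u k θ = ((M.m ^ (((0 : ℕ) : ℝ) * ((d : ℝ) / 2 - s)) : ℝ) : ℂ) * shift u k θ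
  rw [h, Complex.ofReal_one, one_mul]

theorem hat_shift (hd : 0 < d) (M : Dilation d) {σ : ℝ} {u : Dist d} (hu : InH σ u)
    (k : Fin d → ℤ) :
    hat (shift u k) =ᵐ[volume] fun ξ => starRingEnd ℂ (expo k ξ) * hat u ξ := by
  rw [shift_eq_atom M 0]
  refine (hat_atom hd M 0 hu 0 k).trans (Eventually.of_forall fun ξ => ?_)
  have h : M.factor 0 0 = 1 := by simp [Dilation.factor]
  simp only [h, Complex.ofReal_one, one_mul]
  rfl

theorem inH_shift (hd : 0 < d) (M : Dilation d) {σ : ℝ} {u : Dist d} (hu : InH σ u)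
    (k : Fin d → ℤ) : InH σ (shift u k) := by
  rw [shift_eq_atom M 0]
  exact inH_atom hd M 0 hu 0 k

/-! ## Decay of the framelet coefficients of smooth functions -/

theorem WtL2.integrable {σ : ℝ} {g : Rd d → ℂ} (h : WtL2 σ g) :
    Integrable (fun ξ => ‖g ξ‖ ^ 2 * (1 + ‖ξ‖ ^ 2) ^ σ) volume := by
  refine (memLp_two_iff_integrable_sq_norm h.1).mp h |>.congr (Eventually.of_forall fun ξ => ?_)
  simp only
  rw [norm_mul, mul_pow, Complex.norm_real, Real.norm_of_nonneg (wt_pos σ ξ).le, wt_sq, mul_comm]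

theorem continuous_trigPoly (b : (Fin d → ℤ) →₀ ℂ) : Continuous (trigPoly b : Rd d → ℂ) := by
  unfold trigPoly Finsupp.sum
  exact continuous_finsetSum _ fun k _ => continuous_const.mul (continuous_expo k)

/-- This is `k · Mᵀη = Mk · η`. As `M` is an integer matrix, `Mk` is again a lattice point, which is
why coefficients of `ψ'` reduce to coefficients against integer shifts of `φ'`. -/
theorem expo_tr (M : Dilation d) (k : Fin d → ℤ) (η : Rd d) :
    expo k (M.tr η) = expo (M.mat.mulVec k) η := by
  have h : M.equiv (ofInt k) = ofInt (M.mat.mulVec k) := by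
    ext i
    change M.real.mulVec (ofInt k).ofLp i = _
    simp [ofInt, Matrix.mulVec, dotProduct, Dilation.real]
  rw [expo, expo, ← inner_ofInt, ← inner_ofInt, ← M.inner_equiv, h]

theorem mulVec_injective (M : Dilation d) :
    Function.Injective fun k : Fin d → ℤ => M.mat.mulVec k := by
  intro k k' h
  have : M.mat.mulVec (k - k') = 0 := by
    rw [Matrix.mulVec_sub]
    exact sub_eq_zero.mpr h
  exact sub_eq_zero.mp (Matrix.eq_zero_of_mulVec_eq_zero M.det_ne_zero this)

/-- If `ψ̂'(Mᵀ ·) = b̂ φ̂'`, then the coefficients of `f` with respect to the `j`-th level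
of `ψ'` are, up to a factor, coefficients of `g` with respect to `φ'`. -/
theorem pairing_atom_eq_innerH (hd : 0 < d) (M : Dilation d) {s : ℝ} {φ' ψ' : Dist d}
    (hφ' : InH (-s) φ') (hψ' : InH (-s) ψ') {b : (Fin d → ℤ) →₀ ℂ}
    (hb : ∀ᵐ ξ, hat ψ' (M.tr ξ) = trigPoly b ξ * hat φ' ξ) {f g : Dist d} (j : ℕ)
    (hg : hat g =ᵐ[volume] fun η => hat f ((M.tr ^ (j + 1)) η) * starRingEnd ℂ (trigPoly b η) *
      (((1 + ‖η‖ ^ 2) ^ s : ℝ) : ℂ)) (k : Fin d → ℤ) :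
    pairing f (atom M (-s) ψ' j k) =
      ((M.m ^ (d * (j + 1)) * M.factor (-s) j : ℝ) : ℂ) *
        innerH (-s) g (shift φ' (M.mat.mulVec k)) := by
  have h1 := hat_atom hd M (-s) hψ' j k
  have h2 : pairing f (atom M (-s) ψ' j k) = ((2 * Real.pi : ℂ) ^ d)⁻¹ *
      ∫ ξ, hat f ξ * starRingEnd ℂ (((M.factor (-s) j : ℝ) : ℂ) *
      (starRingEnd ℂ (expo k ((M.tr ^ j).symm ξ)) * hat ψ' ((M.tr ^ j).symm ξ))) := by
    rw [pairing]
    congr 1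
    refine integral_congr_ae ?_
    filter_upwards [h1] with ξ hξ
    rw [hξ]
  -- One power more than the level `j`: the transform of `ψ'` is then evaluated at `Mᵀ η`, where the
  -- mask relation applies.
  have h3 := integral_comp_equiv (M.tr ^ (j + 1)) (fun ξ => hat f ξ *
    starRingEnd ℂ (((M.factor (-s) j : ℝ) : ℂ) *
      (starRingEnd ℂ (expo k ((M.tr ^ j).symm ξ)) * hat ψ' ((M.tr ^ j).symm ξ))))
  rw [eq_inv_smul_iff₀ (absdet_pos _).ne', absdet_pow, M.absdet_tr hd, ← pow_mul,
    Complex.real_smul] at h3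
  rw [h2, ← h3, innerH,
    mul_left_comm ((M.m ^ (d * (j + 1)) * M.factor (-s) j : ℝ) : ℂ)]
  congr 1
  push_cast
  rw [mul_assoc]
  congr 1
  rw [← integral_const_mul]
  refine integral_congr_ae ?_
  filter_upwards [hg, hb, hat_shift hd M hφ' (M.mat.mulVec k)] with η e1 e2 e3
  have h4 : (M.tr ^ j).symm ((M.tr ^ (j + 1)) η) = M.tr η := by
    rw [ContinuousLinearEquiv.symm_apply_eq, pow_succ]
    rfl
  have h5 : (((1 + ‖η‖ ^ 2) ^ s : ℝ) : ℂ) * (((1 + ‖η‖ ^ 2) ^ (-s) : ℝ) : ℂ) = 1 := by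
    rw [← Complex.ofReal_mul, ← Real.rpow_add (by positivity)]
    simp
  rw [h4, e1, e2, e3, expo_tr]
  simp only [map_mul, Complex.conj_ofReal, Complex.conj_conj]
  linear_combination (-(M.factor (-s) j : ℂ) * hat f ((M.tr ^ (j + 1)) η) *
    starRingEnd ℂ (trigPoly b η) * expo (M.mat.mulVec k) η * starRingEnd ℂ (hat φ' η)) * h5

/-- The first factor is the squared normalization of the coefficients, the second the Jacobian and
the gain `‖η‖^{2ς}` in the norm of the auxiliary function. The terms `d j` in the exponent cancel,
leaving the rate `-2(ς - s)` per level. -/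
theorem decay_exponent {m : ℝ} (hm : 0 < m) (d j : ℕ) (s ς : ℝ) :
    (m ^ (d * (j + 1)) * (m ^ ((j : ℝ) * ((d : ℝ) / 2 - -s)) * (m ^ (d * j))⁻¹)) ^ 2 *
      ((m ^ (d * (j + 1)))⁻¹ * ((m ^ (j + 1))⁻¹) ^ (2 * ς))
      = m ^ ((d : ℝ) - 2 * ς) * (m ^ (-2 * (ς - s))) ^ j := by
  simp only [← Real.rpow_natCast, ← Real.rpow_neg hm.le, ← Real.rpow_mul hm.le,
    ← Real.rpow_add hm]
  congr 1
  push_cast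
  ring

/-- The coefficients are those of the function `g` with `ĝ = G` at the lattice points `Mk`. Since `k
↦ Mk` is injective, the Bessel bound for all shifts of `φ'` controls them. In the norm of `g`, the
bound `hbB` produces `‖η‖^{2ς}`, which the expansion estimate turns into `m^{-2ς(j+1)}` times the
weight of `H^ς` at `(Mᵀ)^{j+1} η`. -/
theorem exists_coefficient_decay (hd : 0 < d) (M : Dilation d) {s ς : ℝ} (hς : 0 < ς)
    {φ' ψ' : Dist d} (hφ' : InH (-s) φ') (hψ' : InH (-s) ψ') {b : (Fin d → ℤ) →₀ ℂ}
    (hb : ∀ᵐ ξ, hat ψ' (M.tr ξ) = trigPoly b ξ * hat φ' ξ) {C : ℝ} (hC : 0 < C)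
    (hBessel : ∀ g : Dist d, InH (-s) g →
      ∑' k, ‖innerH (-s) g (shift φ' k)‖ₑ ^ 2 ≤ ENNReal.ofReal (C * normH (-s) g ^ 2))
    {B : ℝ} (hB : 0 ≤ B)
    (hbB : ∀ η : Rd d, ‖trigPoly b η‖ ^ 2 * (1 + ‖η‖ ^ 2) ^ s ≤ B * ‖η‖ ^ (2 * ς)) :
    ∃ D : ℝ, 0 ≤ D ∧ ∀ f : Dist d, InH ς f → ∀ j : ℕ,
      ∑' k, ‖pairing f (atom M (-s) ψ' j k)‖ₑ ^ 2 ≤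
        ENNReal.ofReal (D * normH ς f ^ 2 * (M.m ^ (-2 * (ς - s))) ^ j) := by
  obtain ⟨K, hK, hexp⟩ := M.exists_expansion hd
  have hm : 0 < M.m := one_pos.trans (M.one_lt_m hd)
  refine ⟨C * B * K ^ (2 * ς) * M.m ^ ((d : ℝ) - 2 * ς), by positivity, fun f hf j => ?_⟩
  set T := M.tr ^ (j + 1) with hT
  set G : Rd d → ℂ := fun η => hat f (T η) * starRingEnd ℂ (trigPoly b η) *
      (((1 + ‖η‖ ^ 2) ^ s : ℝ) : ℂ) with hG
  have hwf : WtL2 ς (hat f) := hf.wtL2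
  have hGn : ∀ η, ‖G η‖ ^ 2 * (1 + ‖η‖ ^ 2) ^ (-s)
      = ‖hat f (T η)‖ ^ 2 * (‖trigPoly b η‖ ^ 2 * (1 + ‖η‖ ^ 2) ^ s) := by
    intro η
    have h5 : (1 + ‖η‖ ^ 2) ^ s * (1 + ‖η‖ ^ 2) ^ (-s) = 1 := by
      rw [← Real.rpow_add (by positivity)]
      simp
    simp only [hG]
    rw [norm_mul, norm_mul, RCLike.norm_conj, Complex.norm_real,
      Real.norm_of_nonneg (by positivity)]
    linear_combination (‖hat f (T η)‖ ^ 2 * ‖trigPoly b η‖ ^ 2 * (1 + ‖η‖ ^ 2) ^ s) * h5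
  have hnς : ∀ η : Rd d, ‖η‖ ^ (2 * ς) ≤ (1 + ‖η‖ ^ 2) ^ ς := by
    intro η
    rw [Real.rpow_mul (norm_nonneg _), Real.rpow_two]
    exact Real.rpow_le_rpow (by positivity) (by linarith) hς.le
  have hGw : WtL2 (-s) G := by
    refine WtL2.of_bound (hwf.comp T) ?_ (Real.sqrt B) (Eventually.of_forall fun η => ?_)
    · refine ((hwf.comp T).aestronglyMeasurable.mul
        (Complex.continuous_conj.comp (continuous_trigPoly b)).aestronglyMeasurable).mul ?_
      have : Continuous fun η : Rd d => (((1 + ‖η‖ ^ 2) ^ s : ℝ) : ℂ) :=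
        Complex.continuous_ofReal.comp
          ((by fun_prop : Continuous fun ξ : Rd d => 1 + ‖ξ‖ ^ 2).rpow_const
            fun ξ => Or.inl (by positivity))
      exact this.aestronglyMeasurable
    · refine le_of_sq_le_sq ?_ (by positivity)
      have r : ‖((wt ς η : ℝ) : ℂ) * hat f (T η)‖ ^ 2 = (1 + ‖η‖ ^ 2) ^ ς * ‖hat f (T η)‖ ^ 2 := by
        rw [norm_mul, mul_pow, Complex.norm_real, Real.norm_of_nonneg (wt_pos _ _).le, wt_sq]
      rw [mul_pow, mul_pow, Real.sq_sqrt hB, wt_sq, mul_comm, hGn]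
      change _ ≤ B * ‖((wt ς η : ℝ) : ℂ) * hat f (T η)‖ ^ 2
      rw [r]
      have := (hbB η).trans (mul_le_mul_of_nonneg_left (hnς η) hB)
      nlinarith [sq_nonneg ‖hat f (T η)‖]
  obtain ⟨g, hg, hgG⟩ := exists_inH_of_wtL2 hGw
  have hnorm : normH (-s) g ^ 2 ≤ (M.m ^ (d * (j + 1)))⁻¹ *
      (B * (K * (M.m ^ (j + 1))⁻¹) ^ (2 * ς)) * normH ς f ^ 2 := by
    have e1 : ∫ ξ, ‖hat g ξ‖ ^ 2 * (1 + ‖ξ‖ ^ 2) ^ (-s)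
        = ∫ η, ‖hat f (T η)‖ ^ 2 * (‖trigPoly b η‖ ^ 2 * (1 + ‖η‖ ^ 2) ^ s) := by
      refine integral_congr_ae ?_
      filter_upwards [hgG] with η hη
      rw [hη]
      exact hGn η
    set h : Rd d → ℝ := fun ξ => (B * (K * (M.m ^ (j + 1))⁻¹) ^ (2 * ς)) *
      (‖hat f ξ‖ ^ 2 * (1 + ‖ξ‖ ^ 2) ^ ς) with hh
    have e2 : ∫ η, ‖hat f (T η)‖ ^ 2 * (‖trigPoly b η‖ ^ 2 * (1 + ‖η‖ ^ 2) ^ s)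
        ≤ ∫ η, h (T η) := by
      refine integral_mono_of_nonneg (Eventually.of_forall fun η => by positivity)
        (integrable_comp_equiv T (hwf.integrable.const_mul _)) (Eventually.of_forall fun η => ?_)
      have h1 := hexp (j + 1) (T η)
      rw [← hT, ContinuousLinearEquiv.symm_apply_apply] at h1
      have h2 := Real.rpow_le_rpow (norm_nonneg _) h1 (z := 2 * ς) (by positivity)
      rw [Real.mul_rpow (by positivity) (norm_nonneg _)] at h2
      calc ‖hat f (T η)‖ ^ 2 * (‖trigPoly b η‖ ^ 2 * (1 + ‖η‖ ^ 2) ^ s)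
          ≤ ‖hat f (T η)‖ ^ 2 * (B * ((K * (M.m ^ (j + 1))⁻¹) ^ (2 * ς) *
              (1 + ‖T η‖ ^ 2) ^ ς)) := by
            refine mul_le_mul_of_nonneg_left ((hbB η).trans
              (mul_le_mul_of_nonneg_left (h2.trans ?_) hB)) (by positivity)
            gcongr
            exact hnς (T η)
        _ = h (T η) := by rw [hh]; ring
    rw [integral_comp_equiv, hT, absdet_pow, M.absdet_tr hd, ← pow_mul, smul_eq_mul, hh,
      integral_const_mul] at e2
    rw [normH_sq, normH_sq, e1]
    calc cst d ^ 2 * _ ≤ cst d ^ 2 * _ := mul_le_mul_of_nonneg_left e2 (by positivity)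
      _ = _ := by ring
  have hm2 : 0 ≤ M.factor (-s) j := by unfold Dilation.factor; positivity
  set q := M.m ^ (d * (j + 1)) * M.factor (-s) j with hq
  have hpair : ∀ k, ‖pairing f (atom M (-s) ψ' j k)‖ₑ ^ 2
      = ENNReal.ofReal (q ^ 2) * ‖innerH (-s) g (shift φ' (M.mat.mulVec k))‖ₑ ^ 2 := by
    intro k
    rw [pairing_atom_eq_innerH hd M hφ' hψ' hb j hgG k, enorm_sq_eq_ofReal, enorm_sq_eq_ofReal,
      ← ENNReal.ofReal_mul (by positivity), norm_mul, mul_pow, Complex.norm_real,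
      Real.norm_of_nonneg (by positivity)]
  simp only [hpair]
  rw [ENNReal.tsum_mul_left]
  have h6 := (ENNReal.tsum_comp_le_tsum_of_injective (mulVec_injective M)
    (fun k => ‖innerH (-s) g (shift φ' k)‖ₑ ^ 2)).trans (hBessel g hg)
  refine (mul_le_mul_right h6 _).trans ?_
  rw [← ENNReal.ofReal_mul (by positivity)]
  apply ENNReal.ofReal_le_ofReal
  have h7 := decay_exponent hm d j s ς
  have h8 : (K * (M.m ^ (j + 1))⁻¹) ^ (2 * ς) = K ^ (2 * ς) * ((M.m ^ (j + 1))⁻¹) ^ (2 * ς) :=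
    Real.mul_rpow hK.le (by positivity)
  calc q ^ 2 * (C * normH (-s) g ^ 2)
      ≤ q ^ 2 * (C * ((M.m ^ (d * (j + 1)))⁻¹ *
      (B * (K * (M.m ^ (j + 1))⁻¹) ^ (2 * ς)) * normH ς f ^ 2)) := by gcongr
    _ = C * B * K ^ (2 * ς) * normH ς f ^ 2 * (q ^ 2 * ((M.m ^ (d * (j + 1)))⁻¹ *
        ((M.m ^ (j + 1))⁻¹) ^ (2 * ς))) := by rw [h8]; ring
    _ = C * B * K ^ (2 * ς) * normH ς f ^ 2 *
        (M.m ^ ((d : ℝ) - 2 * ς) * (M.m ^ (-2 * (ς - s))) ^ j) := by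
          rw [← h7, hq, Dilation.factor]
    _ = _ := by ring

/-! ## Parseval's identity for functions supported in the unit ball -/

section Torus

attribute [local instance] instMeasureSpaceUnitAddCircle

/-- The points of the cube `(-1/2, 1/2]^d`. -/
def cube (d : ℕ) : Set (Fin d → ℝ) :=
  {x | ∀ i, x i ∈ Set.Ioc ((fun _ : Fin d => (-(1 / 2) : ℝ)) i) ((fun _ : Fin d => (-(1 / 2) : ℝ)) i + 1)}

theorem measurableSet_cube (d : ℕ) : MeasurableSet (cube d) :=
  MeasurableSet.univ_pi' fun _ => measurableSet_Ioc

/-- The function on the torus that agrees with `x ↦ A (2π x)` on the cube. -/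
def torusLift (A : Rd d → ℂ) (t : UnitAddTorus (Fin d)) : ℂ :=
  A ((2 * Real.pi) • WithLp.toLp 2
    (UnitAddTorus.measurableEquivPiIoc (fun _ : Fin d => (-(1 / 2) : ℝ)) t).1)

theorem torusLift_coe (A : Rd d → ℂ) {x : Fin d → ℝ} (hx : x ∈ cube d) :
    torusLift A (fun i => (x i : UnitAddCircle)) = A ((2 * Real.pi) • WithLp.toLp 2 x) := by
  have h := (UnitAddTorus.measurableEquivPiIoc
    (fun _ : Fin d => (-(1 / 2) : ℝ))).apply_symm_apply ⟨x, hx⟩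
  rw [UnitAddTorus.coe_symm_measurableEquivPiIoc_apply] at h
  rw [torusLift, h]

theorem memLp_torusLift {A : Rd d → ℂ} (hA : MemLp A 2 volume) :
    MemLp (torusLift A) 2 (volume : Measure (UnitAddTorus (Fin d))) := by
  have h1 : MemLp (fun x : Fin d → ℝ => A ((2 * Real.pi) • WithLp.toLp 2 x)) 2 volume :=
    (memLp_comp_equiv (twoPi d) hA).comp_measurePreserving (PiLp.volume_preserving_toLp (Fin d))
  have h2 := h1.restrict (cube d)
  rw [← map_comap_subtype_coe (measurableSet_cube d),
    (MeasurableEmbedding.subtype_coe (measurableSet_cube d)).memLp_map_measure_iff] at h2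
  exact h2.comp_measurePreserving
    (UnitAddTorus.measurePreserving_equivPiIoc (fun _ : Fin d => (-(1 / 2) : ℝ)))

theorem mem_cube_of_norm_lt_one {x : Fin d → ℝ}
    (h : ‖(2 * Real.pi) • (WithLp.toLp 2 x : Rd d)‖ < 1) : x ∈ cube d := by
  intro i
  have h1 : ‖((2 * Real.pi) • (WithLp.toLp 2 x : Rd d)) i‖ < 1 :=
    (PiLp.norm_apply_le _ i).trans_lt h
  have h2 : |2 * Real.pi * x i| < 1 := h1
  have h3 := Real.pi_gt_three
  rw [abs_mul, abs_of_pos (by positivity)] at h2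
  have h4 : |x i| < 1 / 2 := by nlinarith [abs_nonneg (x i)]
  rw [abs_lt] at h4
  exact ⟨h4.1, by linarith⟩

/-- If `‖2πx‖ < 1`, every coordinate of `x` is below `1/2` in modulus. A function supported in the
unit ball therefore fits into one period and no periodization is needed. -/
theorem integral_torusLift {A : Rd d → ℂ} (hA : ∀ ξ, 1 ≤ ‖ξ‖ → A ξ = 0) :
    ∫ t : UnitAddTorus (Fin d), torusLift A t = ((2 * Real.pi : ℂ) ^ d)⁻¹ * ∫ ξ, A ξ := by
  rw [UnitAddTorus.integral_preimage (torusLift A) (fun _ => (-(1 / 2) : ℝ))]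
  have h1 : ∫ x in cube d, torusLift A (fun i => (x i : UnitAddCircle))
      = ∫ x in cube d, A ((2 * Real.pi) • WithLp.toLp 2 x) :=
    setIntegral_congr_fun (measurableSet_cube d) fun x hx => torusLift_coe A hx
  refine h1.trans ?_
  rw [setIntegral_eq_integral_of_forall_compl_eq_zero]
  · have h2 := (PiLp.volume_preserving_toLp (Fin d)).integral_comp
      (MeasurableEquiv.toLp 2 (Fin d → ℝ)).measurableEmbedding
      (fun y : Rd d => A ((2 * Real.pi) • y))
    rw [h2, Measure.integral_comp_smul, finrank_euclideanSpace_fin, abs_of_pos (by positivity),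
      Complex.real_smul]
    push_cast
    rfl
  · intro x hx
    refine hA _ ?_
    by_contra h
    exact hx (mem_cube_of_norm_lt_one (not_le.mp h))

theorem mFourier_neg_torusLift (k : Fin d → ℤ) (A : Rd d → ℂ) (t : UnitAddTorus (Fin d)) :
    UnitAddTorus.mFourier (-k) t * torusLift A t
      = torusLift (fun ξ => starRingEnd ℂ (expo k ξ) * A ξ) t := by
  set e := UnitAddTorus.measurableEquivPiIoc (fun _ : Fin d => (-(1 / 2) : ℝ))
  obtain ⟨⟨x, hx⟩, rfl⟩ := e.symm.surjective t
  rw [UnitAddTorus.coe_symm_measurableEquivPiIoc_apply]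
  rw [torusLift_coe _ hx, torusLift_coe _ hx]
  congr 1
  rw [UnitAddTorus.mFourier_neg]
  congr 1
  simp only [UnitAddTorus.mFourier, ContinuousMap.coe_mk, fourier_coe_apply]
  rw [← Complex.exp_sum, expo]
  congr 1
  push_cast
  rw [Finset.mul_sum]
  refine Finset.sum_congr rfl fun i _ => ?_
  simp only [PiLp.smul_apply, smul_eq_mul]
  push_cast
  ring

/-- **Parseval's identity** for square integrable functions supported in the unit ball. -/
theorem hasSum_parseval {A B : Rd d → ℂ} (hA : MemLp A 2 volume) (hB : MemLp B 2 volume)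
    (hA0 : ∀ ξ, 1 ≤ ‖ξ‖ → A ξ = 0) (hB0 : ∀ ξ, 1 ≤ ‖ξ‖ → B ξ = 0) :
    HasSum (fun k : Fin d → ℤ => starRingEnd ℂ (∫ ξ, starRingEnd ℂ (expo k ξ) * A ξ) *
      ∫ ξ, starRingEnd ℂ (expo k ξ) * B ξ)
      ((2 * Real.pi : ℂ) ^ d * ∫ ξ, starRingEnd ℂ (A ξ) * B ξ) := by
  have coeff : ∀ (F : Rd d → ℂ) (hF : MemLp F 2 volume) (_ : ∀ ξ, 1 ≤ ‖ξ‖ → F ξ = 0)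
      (k : Fin d → ℤ), UnitAddTorus.mFourierCoeff ((memLp_torusLift hF).toLp _) k
        = ((2 * Real.pi : ℂ) ^ d)⁻¹ * ∫ ξ, starRingEnd ℂ (expo k ξ) * F ξ := by
    intro F hF hF0 k
    rw [← integral_torusLift (fun ξ hξ => by rw [hF0 ξ hξ, mul_zero]), UnitAddTorus.mFourierCoeff]
    refine integral_congr_ae ?_
    filter_upwards [MemLp.coeFn_toLp (memLp_torusLift hF)] with t ht
    rw [ht, smul_eq_mul, mFourier_neg_torusLift]
  have h := UnitAddTorus.hasSum_prod_mFourierCoeff ((memLp_torusLift hA).toLp _)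
    ((memLp_torusLift hB).toLp _)
  have hint : ∫ t, starRingEnd ℂ (((memLp_torusLift hA).toLp _ : Lp ℂ 2 volume) t) *
      ((memLp_torusLift hB).toLp _ : Lp ℂ 2 volume) t
      = ((2 * Real.pi : ℂ) ^ d)⁻¹ * ∫ ξ, starRingEnd ℂ (A ξ) * B ξ := by
    rw [← integral_torusLift (fun ξ hξ => by rw [hB0 ξ hξ, mul_zero])]
    refine integral_congr_ae ?_
    filter_upwards [MemLp.coeFn_toLp (memLp_torusLift hA),
      MemLp.coeFn_toLp (memLp_torusLift hB)] with t h1 h2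
    rw [h1, h2]
    rfl
  rw [hint] at h
  simp only [coeff A hA hA0, coeff B hB hB0] at h
  have h2 := h.mul_left (((2 * Real.pi : ℂ) ^ d) ^ 2)
  have hpi : ((2 * Real.pi : ℂ) ^ d) ≠ 0 := by
    apply pow_ne_zero
    exact_mod_cast (by positivity : (2 * Real.pi) ≠ 0)
  have hc : starRingEnd ℂ (((2 * Real.pi : ℂ) ^ d)⁻¹) = ((2 * Real.pi : ℂ) ^ d)⁻¹ := by
    rw [← cst_sq_complex, map_mul, Complex.conj_ofReal]
  convert! h2 using 1
  · ext k
    rw [map_mul, hc]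
    field_simp
  · field_simp

end Torus

/-! ## Local consequences of the frame inequalities and of duality -/

theorem one_add_sq_rpow_le {ξ : Rd d} (h : ‖ξ‖ ≤ 1) (τ : ℝ) :
    (1 + ‖ξ‖ ^ 2) ^ τ ≤ 2 ^ |τ| :=
  (Real.rpow_le_rpow_of_exponent_le (by simp) (le_abs_self τ)).trans
    (Real.rpow_le_rpow (by positivity) (by nlinarith [norm_nonneg ξ]) (abs_nonneg τ))

theorem wt_le {ξ : Rd d} (h : ‖ξ‖ ≤ 1) (σ : ℝ) : wt σ ξ ≤ 2 ^ |σ / 2| := one_add_sq_rpow_le h _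

/-- On the unit ball every Sobolev weight is bounded below by a positive constant, so weighted and
unweighted square integrability agree after cutting off. -/
theorem WtL2.memLp_mul_of_bounded {σ : ℝ} {g : Rd d → ℂ} (hg : WtL2 σ g) {h : Rd d → ℂ}
    (hm : AEStronglyMeasurable h volume) {C : ℝ} (hC : ∀ ξ, ‖h ξ‖ ≤ C)
    (h0 : ∀ ξ, 1 ≤ ‖ξ‖ → h ξ = 0) : MemLp (fun ξ => h ξ * g ξ) 2 volume := by
  have hC0 : 0 ≤ C := (norm_nonneg _).trans (hC 0)
  refine MemLp.of_le_mul (c := C * 2 ^ |(-σ) / 2|) hg (hm.mul hg.aestronglyMeasurable)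
    (Eventually.of_forall fun ξ => ?_)
  rcases le_or_gt 1 ‖ξ‖ with h1 | h1
  · rw [h0 ξ h1, zero_mul, norm_zero]
    positivity
  · rw [norm_mul, norm_mul, Complex.norm_real, Real.norm_of_nonneg (wt_pos σ ξ).le]
    have h2 := wt_le h1.le (-σ)
    have h3 := wt_mul_neg σ ξ
    have h4 : 1 ≤ 2 ^ |(-σ) / 2| * wt σ ξ := by
      rw [← h3, mul_comm]
      exact mul_le_mul_of_nonneg_right h2 (wt_pos σ ξ).le
    calc ‖h ξ‖ * ‖g ξ‖ ≤ C * (2 ^ |(-σ) / 2| * wt σ ξ) * ‖g ξ‖ := by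
          gcongr
          exact (hC ξ).trans (le_mul_of_one_le_right hC0 h4)
      _ = _ := by ring

theorem wtL2_of_bounded (σ : ℝ) {h : Rd d → ℂ} (hm : AEStronglyMeasurable h volume) {C : ℝ}
    (hC : ∀ ξ, ‖h ξ‖ ≤ C) (h0 : ∀ ξ, 1 ≤ ‖ξ‖ → h ξ = 0) : WtL2 σ h := by
  have h1 : MemLp ((Metric.ball (0 : Rd d) 1).indicator fun _ => (1 : ℂ)) 2 volume :=
    memLp_indicator_const 2 measurableSet_ball 1 (Or.inr measure_ball_lt_top.ne)
  refine WtL2.of_bound h1 hm (2 ^ |σ / 2| * C) (Eventually.of_forall fun ξ => ?_)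
  rcases le_or_gt 1 ‖ξ‖ with h2 | h2
  · rw [h0 ξ h2, norm_zero, mul_zero, Set.indicator_of_notMem (by simpa using h2)]
    simp
  · rw [Set.indicator_of_mem (by simpa using h2), norm_one, mul_one]
    exact mul_le_mul (wt_le h2.le σ) (hC ξ) (norm_nonneg _) (by positivity)

/-- If the shifts of `u` are a Bessel sequence in `H^σ`, then the mean of `|û|²` over subsets of
the unit ball is bounded. -/
theorem setIntegral_hat_sq_le (hd : 0 < d) (M : Dilation d) {σ : ℝ} {u : Dist d}
    (hu : InH σ u) {C : ℝ} (hC : 0 < C)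
    (hBessel : ∀ g : Dist d, InH σ g →
      ∑' k, ‖innerH σ g (shift u k)‖ₑ ^ 2 ≤ ENNReal.ofReal (C * normH σ g ^ 2)) :
    ∀ E : Set (Rd d), MeasurableSet E → (∀ ξ ∈ E, ‖ξ‖ < 1) →
      ∫ ξ, E.indicator (fun ξ => ‖hat u ξ‖ ^ 2) ξ
        ≤ C * 2 ^ |(-σ)| * ∫ ξ, E.indicator (fun _ => (1 : ℝ)) ξ := by
  intro E hE hE1
  set χ : Rd d → ℂ := E.indicator fun _ => 1 with hχ
  have hχm : AEStronglyMeasurable χ volume :=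
    (measurable_const.indicator hE).aestronglyMeasurable
  have hχ1 : ∀ ξ, ‖χ ξ‖ ≤ 1 := by
    intro ξ
    by_cases h : ξ ∈ E
    · rw [hχ, Set.indicator_of_mem h, norm_one]
    · rw [hχ, Set.indicator_of_notMem h, norm_zero]; exact zero_le_one
  have hχ0 : ∀ ξ, 1 ≤ ‖ξ‖ → χ ξ = 0 := fun ξ hξ =>
    Set.indicator_of_notMem (fun h => (hE1 ξ h).not_ge hξ) _
  have hcont : Continuous fun ξ : Rd d => (((1 + ‖ξ‖ ^ 2) ^ (-σ) : ℝ) : ℂ) :=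
    Complex.continuous_ofReal.comp ((by fun_prop : Continuous fun ξ : Rd d => 1 + ‖ξ‖ ^ 2).rpow_const
        fun ξ => Or.inl (by positivity))
  -- The weight in the test function cancels that of the `H^σ` inner product, so its inner products
  -- with the shifts are conjugated Fourier coefficients of `χ û`. Parseval identifies the Bessel
  -- sum with a multiple of the integral of `|û|²` over `E`, while the norm of the test function is
  -- controlled by the measure of `E`.
  have hG : WtL2 σ (fun ξ => χ ξ * (((1 + ‖ξ‖ ^ 2) ^ (-σ) : ℝ) : ℂ)) := by
    refine wtL2_of_bounded σ (hχm.mul hcont.aestronglyMeasurable) (C := 2 ^ |(-σ)|)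
      (fun ξ => ?_) (fun ξ hξ => by rw [hχ0 ξ hξ, zero_mul])
    rcases le_or_gt 1 ‖ξ‖ with h2 | h2
    · rw [hχ0 ξ h2, zero_mul, norm_zero]; positivity
    · rw [norm_mul, Complex.norm_real, Real.norm_of_nonneg (by positivity)]
      exact (mul_le_of_le_one_left (by positivity) (hχ1 ξ)).trans (one_add_sq_rpow_le h2.le _)
  obtain ⟨g, hg, hgG⟩ := exists_inH_of_wtL2 hG
  have hinner : ∀ k, innerH σ g (shift u k) = ((2 * Real.pi : ℂ) ^ d)⁻¹ *
      starRingEnd ℂ (∫ ξ, starRingEnd ℂ (expo k ξ) * (χ ξ * hat u ξ)) := by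
    intro k
    rw [innerH, ← integral_conj]
    congr 1
    refine integral_congr_ae ?_
    filter_upwards [hgG, hat_shift hd M hu k] with ξ h1 h2
    have h5 : (((1 + ‖ξ‖ ^ 2) ^ (-σ) : ℝ) : ℂ) * (((1 + ‖ξ‖ ^ 2) ^ σ : ℝ) : ℂ) = 1 := by
      rw [← Complex.ofReal_mul, ← Real.rpow_add (by positivity)]
      simp
    have h6 : starRingEnd ℂ (χ ξ) = χ ξ := by
      by_cases h : ξ ∈ E
      · rw [hχ, Set.indicator_of_mem h, map_one]
      · rw [hχ, Set.indicator_of_notMem h, map_zero]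
    rw [h1, h2]
    simp only [map_mul, Complex.conj_conj, h6]
    linear_combination (χ ξ * expo k ξ * starRingEnd ℂ (hat u ξ)) * h5
  have hmem : MemLp (fun ξ => χ ξ * hat u ξ) 2 volume :=
    hu.wtL2.memLp_mul_of_bounded hχm hχ1 hχ0
  have h0 : ∀ ξ, 1 ≤ ‖ξ‖ → χ ξ * hat u ξ = 0 := fun ξ hξ => by rw [hχ0 ξ hξ, zero_mul]
  have hpars := hasSum_parseval hmem hmem h0 h0
  set I := ∫ ξ, E.indicator (fun ξ => ‖hat u ξ‖ ^ 2) ξ with hI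
  have hint : ∫ ξ, starRingEnd ℂ (χ ξ * hat u ξ) * (χ ξ * hat u ξ) = ((I : ℝ) : ℂ) := by
    rw [hI, ← integral_complex_ofReal]
    refine integral_congr_ae (Eventually.of_forall fun ξ => ?_)
    by_cases h : ξ ∈ E
    · simp only [hχ, Set.indicator_of_mem h, one_mul]
      rw [mul_comm, Complex.mul_conj, Complex.normSq_eq_norm_sq]
    · simp [hχ, Set.indicator_of_notMem h]
  rw [hint] at hpars
  have hre : HasSum (fun k : Fin d → ℤ =>
      ‖∫ ξ, starRingEnd ℂ (expo k ξ) * (χ ξ * hat u ξ)‖ ^ 2) ((2 * Real.pi) ^ d * I) := by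
    have := Complex.hasSum_re hpars
    convert! this using 1
    · ext k
      rw [mul_comm, Complex.mul_conj, Complex.normSq_eq_norm_sq, Complex.ofReal_re]
    · have : ((2 * Real.pi : ℂ) ^ d * (I : ℂ)) = (((2 * Real.pi) ^ d * I : ℝ) : ℂ) := by
        push_cast; rfl
      rw [this, Complex.ofReal_re]
  have hsum : ∑' k, ‖innerH σ g (shift u k)‖ₑ ^ 2 = ENNReal.ofReal (cst d ^ 2 * I) := by
    have e : ∀ k, ‖innerH σ g (shift u k)‖ₑ ^ 2 = ENNReal.ofReal ((cst d ^ 2) ^ 2 *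
        ‖∫ ξ, starRingEnd ℂ (expo k ξ) * (χ ξ * hat u ξ)‖ ^ 2) := by
      intro k
      rw [enorm_sq_eq_ofReal, hinner, ← cst_sq_complex, norm_mul, mul_pow, RCLike.norm_conj,
        norm_mul, Complex.norm_real, Real.norm_of_nonneg (cst_pos d).le, ← sq]
    simp only [e]
    have h2 := hre.mul_left ((cst d ^ 2) ^ 2)
    rw [← ENNReal.ofReal_tsum_of_nonneg (fun k => by positivity) h2.summable, h2.tsum_eq, cst_sq]
    congr 1
    field_simp
  have hb := hBessel g hg
  have hnorm : normH σ g ^ 2 ≤ cst d ^ 2 * (2 ^ |(-σ)| *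
      ∫ ξ, E.indicator (fun _ => (1 : ℝ)) ξ) := by
    rw [normH_sq]
    refine mul_le_mul_of_nonneg_left ?_ (by positivity)
    rw [← integral_const_mul]
    refine integral_mono_of_nonneg (Eventually.of_forall fun ξ => by positivity)
      (Integrable.const_mul ?_ _) ?_
    · have hfin : volume E ≠ ⊤ := by
        refine ne_top_of_le_ne_top (measure_ball_lt_top (x := (0 : Rd d)) (r := 1)).ne
          (measure_mono fun ξ h => ?_)
        simpa using hE1 ξ h
      exact (integrable_indicator_iff hE).mpr (integrableOn_const hfin)
    · filter_upwards [hgG] with ξ hξ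
      rw [hξ]
      by_cases h : ξ ∈ E
      · have h5 : (1 + ‖ξ‖ ^ 2) ^ (-σ) * (1 + ‖ξ‖ ^ 2) ^ σ = 1 := by
          rw [← Real.rpow_add (by positivity)]
          simp
        rw [hχ, Set.indicator_of_mem h, Set.indicator_of_mem h, one_mul, mul_one,
          Complex.norm_real, Real.norm_of_nonneg (by positivity), sq, mul_assoc, h5, mul_one]
        exact one_add_sq_rpow_le (hE1 ξ h).le _
      · simp [hχ, Set.indicator_of_notMem h]
  rw [hsum, ENNReal.ofReal_le_ofReal_iff (by positivity)] at hb
  have hc : 0 < cst d ^ 2 := by have := cst_pos d; positivity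
  have h9 := hb.trans (mul_le_mul_of_nonneg_left hnorm hC.le)
  refine le_of_mul_le_mul_left (h9.trans (le_of_eq ?_)) hc
  ring

/-- A bound by the measure of the set is scale invariant: the substitution `S` multiplies both sides
by the same Jacobian. The constant is thus independent of `S`, hence uniform over all powers of
`Mᵀ`. -/
theorem setIntegral_hat_comp_sq_le (hd : 0 < d) (M : Dilation d) {σ : ℝ} {u : Dist d}
    (hu : InH σ u) {C : ℝ} (hC : 0 < C)
    (hBessel : ∀ g : Dist d, InH σ g →
      ∑' k, ‖innerH σ g (shift u k)‖ₑ ^ 2 ≤ ENNReal.ofReal (C * normH σ g ^ 2))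
    (S : Rd d ≃L[ℝ] Rd d) {E : Set (Rd d)} (hE : MeasurableSet E) (hE1 : ∀ ξ ∈ E, ‖S ξ‖ < 1) :
      ∫ ξ, E.indicator (fun ξ => ‖hat u (S ξ)‖ ^ 2) ξ
        ≤ C * 2 ^ |(-σ)| * ∫ ξ, E.indicator (fun _ => (1 : ℝ)) ξ := by
  set E' : Set (Rd d) := S.symm ⁻¹' E with hE'
  have h1 := setIntegral_hat_sq_le hd M hu hC hBessel E'
    (S.symm.continuous.measurable hE) (fun ξ hξ => by
      have := hE1 _ hξ
      rwa [ContinuousLinearEquiv.apply_symm_apply] at this)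
  have h2 : ∀ (f : Rd d → ℝ), ∫ ξ, E.indicator (fun ξ => f (S ξ)) ξ
      = |LinearMap.det (S : Rd d →ₗ[ℝ] Rd d)|⁻¹ * ∫ ξ, E'.indicator f ξ := by
    intro f
    have := integral_comp_equiv S (E'.indicator f)
    rw [smul_eq_mul] at this
    rw [← this]
    refine integral_congr_ae (Eventually.of_forall fun ξ => ?_)
    by_cases h : ξ ∈ E
    · have h' : S ξ ∈ E' := by
        rw [hE', Set.mem_preimage, ContinuousLinearEquiv.symm_apply_apply]; exact h
      simp only [Set.indicator_of_mem h, Set.indicator_of_mem h']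
    · have h' : S ξ ∉ E' := by
        rw [hE', Set.mem_preimage, ContinuousLinearEquiv.symm_apply_apply]; exact h
      simp only [Set.indicator_of_notMem h, Set.indicator_of_notMem h']
  rw [h2 (fun ξ => ‖hat u ξ‖ ^ 2), h2 (fun _ => 1), mul_left_comm]
  exact mul_le_mul_of_nonneg_left h1 (inv_nonneg.mpr (abs_nonneg _))

/-! ## The resolution of the identity near the origin -/

theorem factor_mul_factor_neg (hd : 0 < d) (M : Dilation d) (s : ℝ) (j : ℕ) :
    (M.m ^ (d * j) * M.factor s j) * (M.m ^ (d * j) * M.factor (-s) j) = M.m ^ (d * j) := by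
  have hm : 0 < M.m := one_pos.trans (M.one_lt_m hd)
  unfold Dilation.factor
  simp only [← Real.rpow_natCast, ← Real.rpow_neg hm.le, ← Real.rpow_add hm]
  congr 1
  push_cast
  ring

/-- The part of level `j` of the dual expansion of `⟨f, g⟩`, when `f̂` and `ĝ` are dilates of
functions with small support. -/
theorem tsum_level (hd : 0 < d) (M : Dilation d) {s : ℝ} {u v : Dist d} (hu : InH s u)
    (hv : InH (-s) v) {F G : Rd d → ℂ} (hF : AEStronglyMeasurable F volume)
    (hG : AEStronglyMeasurable G volume) {CF CG : ℝ} (hFC : ∀ ξ, ‖F ξ‖ ≤ CF)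
    (hGC : ∀ ξ, ‖G ξ‖ ≤ CG) (hF0 : ∀ (n : ℕ) ξ, 1 ≤ ‖ξ‖ → F ((M.tr ^ n) ξ) = 0)
    (hG0 : ∀ (n : ℕ) ξ, 1 ≤ ‖ξ‖ → G ((M.tr ^ n) ξ) = 0) {f g : Dist d} (J : ℕ)
    (hf : hat f =ᵐ[volume] fun ξ => F ((M.tr ^ J) ξ))
    (hg : hat g =ᵐ[volume] fun ξ => G ((M.tr ^ J) ξ)) (j : ℕ) :
    ∑' k, pairing (atom M s u j k) g * pairing f (atom M (-s) v j k) =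
      ((2 * Real.pi : ℂ) ^ d)⁻¹ * ((M.m ^ (d * J) : ℝ) : ℂ)⁻¹ *
        ∫ ξ, F ξ * starRingEnd ℂ (G ξ) * (hat u ((M.tr ^ (j + J)).symm ξ) *
          starRingEnd ℂ (hat v ((M.tr ^ (j + J)).symm ξ))) := by
  have hm : 0 < M.m := one_pos.trans (M.one_lt_m hd)
  have hJj : ∀ η, (M.tr ^ J) ((M.tr ^ j) η) = (M.tr ^ (j + J)) η := by
    intro η
    rw [add_comm, pow_add]
    rfl
  set T := M.tr ^ (j + J) with hT
  -- After `ξ = (Mᵀ)^j η` both pairings are Fourier coefficients, of `A` and `B`. As `F` and `G`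
  -- composed with any power of `Mᵀ` vanish off the unit ball, Parseval applies at every level
  -- without aliasing terms.
  set A : Rd d → ℂ := fun η => starRingEnd ℂ (F (T η)) * hat v η with hA
  set B : Rd d → ℂ := fun η => starRingEnd ℂ (G (T η)) * hat u η with hB
  have cv : ∀ H : Rd d → ℂ, ∫ ξ, H ξ = ((M.m ^ (d * j) : ℝ) : ℂ) * ∫ η, H ((M.tr ^ j) η) := by
    intro H
    have h3 := integral_comp_equiv (M.tr ^ j) H
    rw [eq_inv_smul_iff₀ (absdet_pos _).ne', absdet_pow, M.absdet_tr hd, ← pow_mul,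
      Complex.real_smul] at h3
    exact h3.symm
  have h1 : ∀ k, pairing (atom M s u j k) g = ((2 * Real.pi : ℂ) ^ d)⁻¹ *
      ((M.m ^ (d * j) * M.factor s j : ℝ) : ℂ) * ∫ η, starRingEnd ℂ (expo k η) * B η := by
    intro k
    rw [pairing, cv, Complex.ofReal_mul, mul_assoc, mul_assoc]
    congr 2
    rw [← integral_const_mul]
    refine integral_congr_ae ?_
    filter_upwards [ae_comp_equiv (M.tr ^ j) (hat_atom hd M s hu j k),
      ae_comp_equiv (M.tr ^ j) hg] with η e1 e2
    rw [e1, e2, ContinuousLinearEquiv.symm_apply_apply, hJj, hB]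
    ring
  have h2 : ∀ k, pairing f (atom M (-s) v j k) = ((2 * Real.pi : ℂ) ^ d)⁻¹ *
      ((M.m ^ (d * j) * M.factor (-s) j : ℝ) : ℂ) *
        starRingEnd ℂ (∫ η, starRingEnd ℂ (expo k η) * A η) := by
    intro k
    rw [pairing, cv, Complex.ofReal_mul, mul_assoc, mul_assoc, ← integral_conj]
    congr 2
    rw [← integral_const_mul]
    refine integral_congr_ae ?_
    filter_upwards [ae_comp_equiv (M.tr ^ j) (hat_atom hd M (-s) hv j k),
      ae_comp_equiv (M.tr ^ j) hf] with η e1 e2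
    rw [e1, e2, ContinuousLinearEquiv.symm_apply_apply, hJj, hA]
    simp only [map_mul, Complex.conj_conj, Complex.conj_ofReal]
    ring
  have hAm : MemLp A 2 volume := by
    refine hv.wtL2.memLp_mul_of_bounded (Complex.continuous_conj.comp_aestronglyMeasurable
      (aestronglyMeasurable_comp_equiv T hF)) (C := CF) (fun ξ => ?_) (fun ξ hξ => ?_)
    · rw [RCLike.norm_conj]
      exact hFC _
    · simp only [hT]
      rw [hF0 _ _ hξ, map_zero]
  have hBm : MemLp B 2 volume := by
    refine hu.wtL2.memLp_mul_of_bounded (Complex.continuous_conj.comp_aestronglyMeasurable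
      (aestronglyMeasurable_comp_equiv T hG)) (C := CG) (fun ξ => ?_) (fun ξ hξ => ?_)
    · rw [RCLike.norm_conj]
      exact hGC _
    · simp only [hT]
      rw [hG0 _ _ hξ, map_zero]
  have hp := (hasSum_parseval hAm hBm
    (fun ξ hξ => by simp only [hA, hT]; rw [hF0 _ _ hξ, map_zero, zero_mul])
    (fun ξ hξ => by simp only [hB, hT]; rw [hG0 _ _ hξ, map_zero, zero_mul])).tsum_eq
  have h4 : ∀ k, pairing (atom M s u j k) g * pairing f (atom M (-s) v j k)
      = (((2 * Real.pi : ℂ) ^ d)⁻¹ * ((2 * Real.pi : ℂ) ^ d)⁻¹ * ((M.m ^ (d * j) : ℝ) : ℂ)) *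
        (starRingEnd ℂ (∫ ξ, starRingEnd ℂ (expo k ξ) * A ξ) *
          ∫ ξ, starRingEnd ℂ (expo k ξ) * B ξ) := by
    intro k
    have h7 : ((M.m ^ (d * j) * M.factor s j : ℝ) : ℂ) * ((M.m ^ (d * j) * M.factor (-s) j : ℝ) : ℂ)
        = ((M.m ^ (d * j) : ℝ) : ℂ) := by
      rw [← Complex.ofReal_mul, factor_mul_factor_neg hd M s j]
    rw [h1, h2, ← h7]
    ring
  simp only [h4]
  rw [tsum_mul_left, hp]
  have h5 := integral_comp_equiv T (fun ξ => F ξ * starRingEnd ℂ (G ξ) * (hat u (T.symm ξ) *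
          starRingEnd ℂ (hat v (T.symm ξ))))
  rw [eq_inv_smul_iff₀ (absdet_pos _).ne', hT, absdet_pow, M.absdet_tr hd, ← pow_mul,
      Complex.real_smul, ← hT] at h5
  rw [← h5]
  have h6 : ∫ ξ, starRingEnd ℂ (A ξ) * B ξ = ∫ x, F (T x) * starRingEnd ℂ (G (T x)) *
      (hat u (T.symm (T x)) * starRingEnd ℂ (hat v (T.symm (T x)))) := by
    refine integral_congr_ae (Eventually.of_forall fun ξ => ?_)
    simp only [hA, hB, map_mul, Complex.conj_conj, ContinuousLinearEquiv.symm_apply_apply]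
    ring
  rw [h6]
  have hpi : ((2 * Real.pi : ℂ) ^ d) ≠ 0 := by
    apply pow_ne_zero
    exact_mod_cast (by positivity : (2 * Real.pi) ≠ 0)
  have hmc : (M.m : ℂ) ≠ 0 := by exact_mod_cast hm.ne'
  push_cast
  rw [mul_add, pow_add]
  field_simp

/-- The products `φ̂ · conj φ̂'`, dilated, converge weakly to `1` near the origin. -/
theorem tendsto_integral_hat_mul_conj_hat (hd : 0 < d) {L : ℕ} {M : Dilation d} {s : ℝ}
    {φ φ' : Dist d} {ψ ψ' : Fin L → Dist d} (hdual : IsDualPair M s φ ψ φ' ψ')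
    {F G : Rd d → ℂ} (hF : AEStronglyMeasurable F volume)
    (hG : AEStronglyMeasurable G volume) {CF CG : ℝ} (hFC : ∀ ξ, ‖F ξ‖ ≤ CF)
    (hGC : ∀ ξ, ‖G ξ‖ ≤ CG) (hF0 : ∀ (n : ℕ) ξ, 1 ≤ ‖ξ‖ → F ((M.tr ^ n) ξ) = 0)
    (hG0 : ∀ (n : ℕ) ξ, 1 ≤ ‖ξ‖ → G ((M.tr ^ n) ξ) = 0) :
    Tendsto (fun J : ℕ => ∫ ξ, F ξ * starRingEnd ℂ (G ξ) * (hat φ ((M.tr ^ J).symm ξ) *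
          starRingEnd ℂ (hat φ' ((M.tr ^ J).symm ξ)))) atTop
      (𝓝 (∫ ξ, F ξ * starRingEnd ℂ (G ξ))) := by
  have hm : 0 < M.m := one_pos.trans (M.one_lt_m hd)
  obtain ⟨⟨hX, -⟩, ⟨hX', -⟩, hid⟩ := hdual
  set a : Fin L → ℕ → ℂ := fun l n => ∫ ξ, F ξ * starRingEnd ℂ (G ξ) *
    (hat (ψ l) ((M.tr ^ n).symm ξ) * starRingEnd ℂ (hat (ψ' l) ((M.tr ^ n).symm ξ))) with ha
  -- The dual expansion is applied to the dilates `F ∘ (Mᵀ)^J` and `G ∘ (Mᵀ)^J`. Up to a common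
  -- factor, level `j` contributes `a l (j + J)`: changing `J` only shifts one fixed sequence.
  have key : ∀ J : ℕ, ∫ ξ, F ξ * starRingEnd ℂ (G ξ) * (hat φ ((M.tr ^ J).symm ξ) *
          starRingEnd ℂ (hat φ' ((M.tr ^ J).symm ξ)))
      = (∫ ξ, F ξ * starRingEnd ℂ (G ξ)) - ∑ l, ∑' j, a l (j + J) := by
    intro J
    have hF1 : WtL2 s F := wtL2_of_bounded s hF hFC (fun ξ => hF0 0 ξ)
    have hG1 : WtL2 (-s) G := wtL2_of_bounded (-s) hG hGC (fun ξ => hG0 0 ξ)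
    obtain ⟨f, hf, hfF⟩ := exists_inH_of_wtL2 (hF1.comp (M.tr ^ J))
    obtain ⟨g, hg, hgG⟩ := exists_inH_of_wtL2 (hG1.comp (M.tr ^ J))
    have h1 := hid f g hf hg
    have h2 : pairing f g = ((2 * Real.pi : ℂ) ^ d)⁻¹ * ((M.m ^ (d * J) : ℝ) : ℂ)⁻¹ *
        ∫ ξ, F ξ * starRingEnd ℂ (G ξ) := by
      have h3 := integral_comp_equiv (M.tr ^ J) (fun ξ => F ξ * starRingEnd ℂ (G ξ))
      rw [absdet_pow, M.absdet_tr hd, ← pow_mul, Complex.real_smul, Complex.ofReal_inv] at h3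
      rw [mul_assoc, ← h3, pairing]
      congr 1
      refine integral_congr_ae ?_
      filter_upwards [hfF, hgG] with ξ e1 e2
      rw [e1, e2]
    have h4 := tsum_level hd M hX.mem_phi hX'.mem_phi hF hG hFC hGC hF0 hG0 J hfF hgG 0
    simp only [← shift_eq_atom, zero_add] at h4
    have h5 : ∀ l j, ∑' k, pairing (atom M s (ψ l) j k) g * pairing f (atom M (-s) (ψ' l) j k)
        = ((2 * Real.pi : ℂ) ^ d)⁻¹ * ((M.m ^ (d * J) : ℝ) : ℂ)⁻¹ * a l (j + J) := fun l j =>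
      tsum_level hd M (hX.mem_psi l) (hX'.mem_psi l) hF hG hFC hGC hF0 hG0 J hfF hgG j
    simp only [h5, tsum_mul_left] at h1
    rw [h4, h2, ← Finset.mul_sum, ← mul_add] at h1
    have hc : ((2 * Real.pi : ℂ) ^ d)⁻¹ * ((M.m ^ (d * J) : ℝ) : ℂ)⁻¹ ≠ 0 := by
      refine mul_ne_zero (inv_ne_zero (pow_ne_zero _ ?_)) (inv_ne_zero ?_)
      · exact_mod_cast (by positivity : (2 * Real.pi) ≠ 0)
      · exact_mod_cast (by positivity : M.m ^ (d * J) ≠ 0)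
    exact eq_sub_of_add_eq (mul_left_cancel₀ hc h1).symm
  simp only [key]
  -- No summability of `a l` is needed: if it fails, all the tails are `0` by the convention for
  -- `∑'`.
  have h0 : Tendsto (fun J : ℕ => ∑ l, ∑' j, a l (j + J)) atTop (𝓝 (∑ l : Fin L, 0)) :=
    tendsto_finsetSum _ fun l _ => tendsto_sum_nat_add (a l)
  have := tendsto_const_nhds (x := ∫ ξ, F ξ * starRingEnd ℂ (G ξ)).sub h0
  simpa using this

/-! ## Taylor expansions at the origin -/

/-- Induction on the order: the derivative is `o(‖x‖^n)`, and the mean value inequality on the ball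
of radius `‖x‖` adds one power. The target space varies in the induction because the hypothesis is
applied to `fderiv ℝ f`. -/
theorem isLittleO_norm_pow_of_iteratedFDeriv_eq_zero {E : Type} [NormedAddCommGroup E]
    [NormedSpace ℝ E] (n : ℕ) :
    ∀ {F : Type} [NormedAddCommGroup F] [NormedSpace ℝ F] {f : E → F},
      ContDiffAt ℝ n f 0 → (∀ k ≤ n, iteratedFDeriv ℝ k f 0 = 0) →
        f =o[𝓝 0] fun x => ‖x‖ ^ n := by
  induction n with
  | zero =>
    intro F _ _ f hf h0
    have h1 : f 0 = 0 := by
      have := h0 0 le_rfl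
      rw [← norm_eq_zero, norm_iteratedFDeriv_zero] at this
      exact norm_eq_zero.mp this
    simp only [pow_zero]
    rw [Asymptotics.isLittleO_one_iff]
    have := hf.continuousAt.tendsto
    rwa [h1] at this
  | succ n ih =>
    intro F _ _ f hf h0
    have h1 : f 0 = 0 := by
      have := h0 0 (Nat.zero_le _)
      rw [← norm_eq_zero, norm_iteratedFDeriv_zero] at this
      exact norm_eq_zero.mp this
    have h2 : ContDiffAt ℝ n (fderiv ℝ f) 0 := hf.fderiv_right (by norm_cast)
    have h3 : fderiv ℝ f =o[𝓝 0] fun x => ‖x‖ ^ n := by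
      refine ih h2 fun k hk => ?_
      rw [← norm_eq_zero, norm_iteratedFDeriv_fderiv, h0 (k + 1) (by omega), norm_zero]
    have h4 : ∀ᶠ x in 𝓝 (0 : E), DifferentiableAt ℝ f x := by
      filter_upwards [hf.eventually (by simp)] with x hx
      exact hx.differentiableAt (by simp)
    rw [Asymptotics.isLittleO_iff] at h3 ⊢
    intro c hc
    obtain ⟨r, hr, hball⟩ := Metric.eventually_nhds_iff_ball.mp (h4.and (h3 hc))
    filter_upwards [Metric.ball_mem_nhds (0 : E) hr] with x hx
    have hsub : ∀ y ∈ Metric.closedBall (0 : E) ‖x‖, y ∈ Metric.ball (0 : E) r := by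
      intro y hy
      rw [mem_closedBall_zero_iff] at hy
      rw [mem_ball_zero_iff] at hx ⊢
      exact hy.trans_lt hx
    have := (convex_closedBall (0 : E) ‖x‖).norm_image_sub_le_of_norm_fderiv_le (𝕜 := ℝ)
      (f := f) (C := c * ‖x‖ ^ n) (x := 0) (y := x) (fun y hy => (hball y (hsub y hy)).1)
      (fun y hy => by
        refine ((hball y (hsub y hy)).2).trans ?_
        rw [norm_pow, norm_norm]
        rw [mem_closedBall_zero_iff] at hy
        gcongr) (by simp) (by simp)
    rw [h1, sub_zero, sub_zero] at this
    rw [norm_pow, norm_norm, pow_succ, ← mul_assoc]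
    exact this

theorem HasVanishingMoments.hat_le {κ : ℕ} {u : Dist d} (h : HasVanishingMoments κ u) {ε : ℝ}
    (hε : 0 < ε) : ∃ δ > 0, ∀ᵐ η : Rd d, ‖η‖ < δ → ‖hat u η‖ ≤ ε * ‖η‖ ^ κ := by
  obtain ⟨g, hg, hcd, hvan⟩ := h
  have h0 : ∀ k ≤ κ, iteratedFDeriv ℝ k g 0 = 0 := by
    intro k hk
    -- The partial derivatives are the values on basis vectors, and these determine the multilinear
    -- form.
    apply ContinuousMultilinearMap.toMultilinearMap_injective
    refine Module.Basis.ext_multilinear (fun _ => (EuclideanSpace.basisFun (Fin d) ℝ).toBasis)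
      fun α => ?_
    have := hvan k hk α
    simpa using this
  have h1 := isLittleO_norm_pow_of_iteratedFDeriv_eq_zero κ (by exact_mod_cast hcd) h0
  obtain ⟨δ, hδ, hball⟩ := Metric.eventually_nhds_iff_ball.mp (Asymptotics.isLittleO_iff.mp h1 hε)
  refine ⟨δ, hδ, ?_⟩
  filter_upwards [hg.hat_ae_eq] with η hη hlt
  have := hball η (by simpa using hlt)
  rwa [hη, ← norm_norm η, ← norm_pow]

/-- The homogeneous part of degree `n` of the power series of a trigonometric polynomial. -/
def taylorPart (b : (Fin d → ℤ) →₀ ℂ) (n : ℕ) (η : Rd d) : ℂ :=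
  b.sum fun k z => z * ((Complex.I * ((∑ i, (k i : ℝ) * η i : ℝ) : ℂ)) ^ n / (n.factorial : ℂ))

theorem continuous_taylorPart (b : (Fin d → ℤ) →₀ ℂ) (n : ℕ) :
    Continuous (taylorPart b n : Rd d → ℂ) := by
  unfold taylorPart Finsupp.sum
  fun_prop

theorem taylorPart_smul (b : (Fin d → ℤ) →₀ ℂ) (n : ℕ) (c : ℝ) (η : Rd d) :
    taylorPart b n (c • η) = (c : ℂ) ^ n * taylorPart b n η := by
  unfold taylorPart Finsupp.sum
  rw [Finset.mul_sum]
  refine Finset.sum_congr rfl fun k _ => ?_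
  have : (∑ i, (k i : ℝ) * (c • η) i) = c * ∑ i, (k i : ℝ) * η i := by
    rw [Finset.mul_sum]
    refine Finset.sum_congr rfl fun i _ => ?_
    simp only [PiLp.smul_apply, smul_eq_mul]
    ring
  simp only [this, Complex.ofReal_mul]
  ring

theorem exists_trigPoly_sub_taylor_le (b : (Fin d → ℤ) →₀ ℂ) (N : ℕ) :
    ∃ C : ℝ, 0 ≤ C ∧ ∀ η : Rd d, ‖η‖ ≤ 1 →
      ‖trigPoly b η - ∑ n ∈ Finset.range N, taylorPart b n η‖ ≤ C * ‖η‖ ^ N := by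
  refine ⟨∑ k ∈ b.support, ‖b k‖ * (‖(ofInt k : Rd d)‖ ^ N * Real.exp ‖(ofInt k : Rd d)‖),
    by positivity, fun η hη => ?_⟩
  have e : trigPoly b η - ∑ n ∈ Finset.range N, taylorPart b n η
      = ∑ k ∈ b.support, b k * (Complex.exp (Complex.I * ((∑ i, (k i : ℝ) * η i : ℝ) : ℂ)) -
        ∑ n ∈ Finset.range N, (Complex.I * ((∑ i, (k i : ℝ) * η i : ℝ) : ℂ)) ^ n /
          (n.factorial : ℂ)) := by
    simp only [trigPoly, taylorPart, Finsupp.sum, expo]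
    rw [Finset.sum_comm, ← Finset.sum_sub_distrib]
    refine Finset.sum_congr rfl fun k _ => ?_
    rw [mul_sub, Finset.mul_sum]
  rw [e, Finset.sum_mul]
  refine (norm_sum_le _ _).trans (Finset.sum_le_sum fun k _ => ?_)
  rw [norm_mul, mul_assoc]
  gcongr
  refine (Complex.norm_exp_sub_sum_le_norm_mul_exp _ N).trans ?_
  have h1 : ‖Complex.I * ((∑ i, (k i : ℝ) * η i : ℝ) : ℂ)‖ ≤ ‖(ofInt k : Rd d)‖ * ‖η‖ := by
    rw [norm_mul, Complex.norm_I, one_mul, Complex.norm_real, ← inner_ofInt]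
    exact norm_inner_le_norm _ _
  calc _ ≤ (‖(ofInt k : Rd d)‖ * ‖η‖) ^ N * Real.exp (‖(ofInt k : Rd d)‖ * 1) := by
        gcongr
        exact h1.trans (by gcongr)
    _ = _ := by rw [mul_pow, mul_one]; ring

theorem norm_trigPoly_le (b : (Fin d → ℤ) →₀ ℂ) (η : Rd d) :
    ‖trigPoly b η‖ ≤ ∑ k ∈ b.support, ‖b k‖ := by
  refine (norm_sum_le _ _).trans (Finset.sum_le_sum fun k _ => ?_)
  rw [norm_mul, norm_expo, mul_one]

/-- In the unit ball the mask is `O(‖η‖^{κ+1})` with `κ + 1 > ς`; outside, it is bounded and the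
weight is at most `2^s ‖η‖^{2s}` with `s < ς`. -/
theorem exists_trigPoly_weight_le {b : (Fin d → ℤ) →₀ ℂ} {κ : ℕ}
    (h : ∀ n ≤ κ, ∀ η : Rd d, taylorPart b n η = 0) {s ς : ℝ} (hs : 0 < s) (hsς : s < ς)
    (hς : ς < (κ : ℝ) + 1) :
    ∃ B : ℝ, 0 ≤ B ∧ ∀ η : Rd d,
      ‖trigPoly b η‖ ^ 2 * (1 + ‖η‖ ^ 2) ^ s ≤ B * ‖η‖ ^ (2 * ς) := by
  obtain ⟨C, hC, hCb⟩ := exists_trigPoly_sub_taylor_le b (κ + 1)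
  set A := ∑ k ∈ b.support, ‖b k‖
  have hA : 0 ≤ A := by positivity
  refine ⟨(C ^ 2 + A ^ 2) * 2 ^ s, by positivity, fun η => ?_⟩
  rcases le_or_gt ‖η‖ 1 with h1 | h1
  · have h2 := hCb η h1
    rw [Finset.sum_eq_zero (fun n hn => h n (by simpa [Nat.lt_succ_iff] using hn) η), sub_zero] at h2
    have h3 : ‖η‖ ^ (κ + 1) ≤ ‖η‖ ^ ς := by
      rcases eq_or_lt_of_le (norm_nonneg η) with h0 | h0
      · rw [← h0, Real.zero_rpow (by linarith), zero_pow (by omega)]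
      · rw [← Real.rpow_natCast]
        exact Real.rpow_le_rpow_of_exponent_ge h0 h1 (by push_cast; exact hς.le)
    have h4 : ‖trigPoly b η‖ ^ 2 ≤ C ^ 2 * ‖η‖ ^ (2 * ς) := by
      have : ‖η‖ ^ (2 * ς) = (‖η‖ ^ ς) ^ 2 := by
        rw [← Real.rpow_natCast, ← Real.rpow_mul (norm_nonneg _)]
        congr 1
        push_cast
        ring
      rw [this, ← mul_pow]
      exact pow_le_pow_left₀ (norm_nonneg _) (h2.trans (by gcongr)) 2
    have h5 : (1 + ‖η‖ ^ 2) ^ s ≤ 2 ^ s :=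
      Real.rpow_le_rpow (by positivity) (by nlinarith [norm_nonneg η]) hs.le
    calc _ ≤ C ^ 2 * ‖η‖ ^ (2 * ς) * 2 ^ s := by gcongr
      _ = C ^ 2 * 2 ^ s * ‖η‖ ^ (2 * ς) := by ring
      _ ≤ _ := by
        gcongr
        exact le_add_of_nonneg_right (sq_nonneg A)
  · have h4 : ‖trigPoly b η‖ ^ 2 ≤ A ^ 2 := pow_le_pow_left₀ (norm_nonneg _) (norm_trigPoly_le b η) 2
    have h5 : (1 + ‖η‖ ^ 2) ^ s ≤ 2 ^ s * ‖η‖ ^ (2 * ς) := by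
      calc (1 + ‖η‖ ^ 2) ^ s ≤ (2 * ‖η‖ ^ 2) ^ s :=
            Real.rpow_le_rpow (by positivity) (by nlinarith) hs.le
        _ = 2 ^ s * ‖η‖ ^ (2 * s) := by
            rw [Real.mul_rpow (by norm_num) (by positivity), ← Real.rpow_natCast,
              ← Real.rpow_mul (norm_nonneg _)]
            norm_num
        _ ≤ _ := by
            gcongr
            exact h1.le
    calc _ ≤ A ^ 2 * (2 ^ s * ‖η‖ ^ (2 * ς)) := by gcongr
      _ = A ^ 2 * 2 ^ s * ‖η‖ ^ (2 * ς) := by ring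
      _ ≤ _ := by
        gcongr
        exact le_add_of_nonneg_left (sq_nonneg C)

/-! ## Vanishing moments of the masks -/

theorem IsFrameletSystem.exists_bessel_shift {L : ℕ} {M : Dilation d} {s : ℝ} {φ : Dist d}
    {ψ : Fin L → Dist d} (h : IsFrameletSystem M s φ ψ) :
    ∃ C : ℝ, 0 < C ∧ ∀ f : Dist d, InH s f →
      ∑' k, ‖innerH s f (shift φ k)‖ₑ ^ 2 ≤ ENNReal.ofReal (C * normH s f ^ 2) := by
  obtain ⟨-, C₁, C, hC₁, hC, hf⟩ := h
  exact ⟨C, hC, fun f hfs => le_self_add.trans (hf f hfs).2⟩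

theorem IsFrameletSystem.exists_bessel_atom {L : ℕ} {M : Dilation d} {s : ℝ} {φ : Dist d}
    {ψ : Fin L → Dist d} (h : IsFrameletSystem M s φ ψ) :
    ∃ C : ℝ, 0 < C ∧ ∀ f : Dist d, InH s f →
      ∑ l, ∑' j, ∑' k, ‖innerH s f (atom M s (ψ l) j k)‖ₑ ^ 2
        ≤ ENNReal.ofReal (C * normH s f ^ 2) := by
  obtain ⟨-, C₁, C, hC₁, hC, hf⟩ := h
  exact ⟨C, hC, fun f hfs => le_add_self.trans (hf f hfs).2⟩

/-- Replacing one factor `q` by `Q` gives `|qβ| ≤ |Qβ| + |Q - q||β| ≤ ε(1 + |β|)`; the rest follows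
from `2xy ≤ x² + y²`. In the application `Q` is a rescaled mask, `q` its limit, and `α`, `β` are
dilates of `φ̂` and `φ̂'`. -/
theorem norm_integral_sq_mul_le {E : Set (Rd d)} {q Q α β : Rd d → ℂ} {c ε : ℝ}
    (hα : Integrable (E.indicator fun ξ => ‖α ξ‖ ^ 2) volume)
    (hβ : Integrable (E.indicator fun ξ => ‖β ξ‖ ^ 2) volume)
    (h1 : Integrable (E.indicator fun _ => (1 : ℝ)) (volume : Measure (Rd d)))
    (hc : 0 ≤ c) (hε : 0 ≤ ε) (hq : ∀ ξ ∈ E, ‖q ξ‖ ≤ c)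
    (hQ : ∀ᵐ ξ, ξ ∈ E → ‖Q ξ - q ξ‖ ≤ ε ∧ ‖Q ξ * β ξ‖ ≤ ε) :
    ‖∫ ξ, E.indicator (fun ξ => q ξ * starRingEnd ℂ (q ξ)) ξ *
        starRingEnd ℂ (E.indicator (fun _ => (1 : ℂ)) ξ) * (α ξ * starRingEnd ℂ (β ξ))‖
      ≤ c * ε * ((∫ ξ, E.indicator (fun ξ => ‖α ξ‖ ^ 2) ξ) +
        (∫ ξ, E.indicator (fun ξ => ‖β ξ‖ ^ 2) ξ) +
        ∫ ξ, E.indicator (fun _ => (1 : ℝ)) ξ) := by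
  rw [← integral_add hα hβ]
  have e0 := integral_add (hα.add hβ) h1
  simp only [Pi.add_apply] at e0
  rw [← e0, ← integral_const_mul]
  refine norm_integral_le_of_norm_le (((hα.add hβ).add h1).const_mul _) ?_
  filter_upwards [hQ] with ξ hξ
  by_cases h : ξ ∈ E
  · simp only [Set.indicator_of_mem h, map_one, mul_one]
    obtain ⟨e1, e2⟩ := hξ h
    have e3 : ‖q ξ * β ξ‖ ≤ ε * ‖β ξ‖ + ε := by
      have : q ξ * β ξ = Q ξ * β ξ - (Q ξ - q ξ) * β ξ := by ring
      rw [this]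
      refine (norm_sub_le _ _).trans ?_
      rw [norm_mul (Q ξ - q ξ), add_comm]
      gcongr
    rw [norm_mul] at e3
    simp only [norm_mul, RCLike.norm_conj]
    have e4 : ‖α ξ‖ * ‖β ξ‖ + ‖α ξ‖ ≤ ‖α ξ‖ ^ 2 + ‖β ξ‖ ^ 2 + 1 := by
      nlinarith [sq_nonneg (‖α ξ‖ - ‖β ξ‖), sq_nonneg (‖α ξ‖ - 1), sq_nonneg ‖β ξ‖]
    calc ‖q ξ‖ * ‖q ξ‖ * (‖α ξ‖ * ‖β ξ‖) = ‖q ξ‖ * ‖α ξ‖ * (‖q ξ‖ * ‖β ξ‖) := by ring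
      _ ≤ c * ‖α ξ‖ * (ε * ‖β ξ‖ + ε) := by
        gcongr
        exact hq ξ h
      _ = c * ε * (‖α ξ‖ * ‖β ξ‖ + ‖α ξ‖) := by ring
      _ ≤ _ := by gcongr
  · simp [Set.indicator_of_notMem h]

theorem WtL2.integrable_indicator_sq {σ : ℝ} {g : Rd d → ℂ} (hg : WtL2 σ g) {E : Set (Rd d)}
    (hE : MeasurableSet E) (hE1 : ∀ ξ ∈ E, ‖ξ‖ < 1) :
    Integrable (E.indicator fun ξ => ‖g ξ‖ ^ 2) volume := by
  have h1 := hg.memLp_mul_of_bounded (h := E.indicator fun _ => 1)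
    (measurable_const.indicator hE).aestronglyMeasurable (C := 1)
    (fun ξ => by
      by_cases h : ξ ∈ E
      · rw [Set.indicator_of_mem h, norm_one]
      · rw [Set.indicator_of_notMem h, norm_zero]; exact zero_le_one)
    (fun ξ hξ => Set.indicator_of_notMem (fun h => (hE1 ξ h).not_ge hξ) _)
  refine ((memLp_two_iff_integrable_sq_norm h1.1).mp h1).congr (Eventually.of_forall fun ξ => ?_)
  by_cases h : ξ ∈ E
  · simp [Set.indicator_of_mem h]
  · simp [Set.indicator_of_notMem h]

/-- The normalized inverse powers of `Mᵀ` have a subsequence converging to an invertible map. -/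
theorem Dilation.exists_subseq_tendsto (M : Dilation d) (hd : 0 < d) :
    ∃ (V : Rd d →L[ℝ] Rd d) (σ : ℕ → ℕ), StrictMono σ ∧ Function.Surjective V ∧
      Tendsto (fun i => (M.m ^ σ i) • (((M.tr ^ σ i).symm : Rd d ≃L[ℝ] Rd d) : Rd d →L[ℝ] Rd d))
        atTop (𝓝 V) := by
  have hm : 0 < M.m := one_pos.trans (M.one_lt_m hd)
  obtain ⟨K, hK, hexp⟩ := M.exists_expansion hd
  set W : ℕ → (Rd d →L[ℝ] Rd d) := fun J =>
    (M.m ^ J) • (((M.tr ^ J).symm : Rd d ≃L[ℝ] Rd d) : Rd d →L[ℝ] Rd d) with hW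
  have : ProperSpace (Rd d →L[ℝ] Rd d) := FiniteDimensional.proper ℝ _
  have hbdd : ∀ J, W J ∈ Metric.closedBall (0 : Rd d →L[ℝ] Rd d) K := by
    intro J
    rw [mem_closedBall_zero_iff]
    refine ContinuousLinearMap.opNorm_le_bound _ hK.le fun ξ => ?_
    have h1 := hexp J ξ
    have hmJ : 0 < M.m ^ J := by positivity
    change ‖(M.m ^ J) • ((M.tr ^ J).symm ξ)‖ ≤ _
    rw [norm_smul, Real.norm_of_nonneg hmJ.le]
    calc M.m ^ J * ‖(M.tr ^ J).symm ξ‖ ≤ M.m ^ J * (K * (M.m ^ J)⁻¹ * ‖ξ‖) := by gcongr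
      _ = K * ‖ξ‖ := by field_simp
  obtain ⟨V, -, σ, hσ, hV⟩ := tendsto_subseq_of_bounded Metric.isBounded_closedBall hbdd
  refine ⟨V, σ, hσ, ?_, hV⟩
  -- The normalization by `m^J` makes all determinants unimodular, so a limit obtained from
  -- compactness is invertible.
  have hdet : ∀ J, |(W J).det| = 1 := by
    intro J
    have h1 : (W J).det = (M.m ^ J) ^ d * LinearMap.det ((M.tr ^ J).symm : Rd d →ₗ[ℝ] Rd d) := by
      have := LinearMap.det_smul (M.m ^ J) ((M.tr ^ J).symm : Rd d →ₗ[ℝ] Rd d)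
      rw [finrank_euclideanSpace_fin] at this
      exact this
    rw [h1, abs_mul, absdet_symm, absdet_pow, M.absdet_tr hd, abs_of_pos (by positivity),
      ← pow_mul, ← pow_mul, mul_comm J d, mul_inv_cancel₀ (by positivity)]
  have hlim : |V.det| = 1 := by
    have h1 : Tendsto (fun i => |(W (σ i)).det|) atTop (𝓝 |V.det|) :=
      ((ContinuousLinearMap.continuous_det.tendsto V).comp hV).abs
    simp only [hdet] at h1
    exact tendsto_nhds_unique h1 tendsto_const_nhds |>.symm ▸ rfl
  have hne : LinearMap.det (V : Rd d →ₗ[ℝ] Rd d) ≠ 0 := by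
    intro h
    have : V.det = 0 := h
    rw [this, abs_zero] at hlim
    exact zero_ne_one hlim
  exact (LinearMap.equivOfDetNeZero (V : Rd d →ₗ[ℝ] Rd d) hne).surjective

/-- In a pair of dual framelet systems, vanishing moments of `ψ'^ℓ` are inherited by its mask. -/
theorem taylorPart_eq_zero (hd : 0 < d) {L : ℕ} {M : Dilation d} {s : ℝ} {φ φ' : Dist d}
    {ψ ψ' : Fin L → Dist d} (hdual : IsDualPair M s φ ψ φ' ψ') {κ : ℕ} {l : Fin L}
    (hvm : HasVanishingMoments κ (ψ' l)) {b : (Fin d → ℤ) →₀ ℂ}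
    (hb : ∀ᵐ ξ, hat (ψ' l) (M.tr ξ) = trigPoly b ξ * hat φ' ξ) :
    ∀ n ≤ κ, ∀ η, taylorPart b n η = 0 := by
  -- Under strong induction the Taylor parts below `n` vanish, so `P = taylorPart b n` approximates
  -- the mask up to `O(‖η‖^{n+1})`.
  intro n
  induction n using Nat.strong_induction_on with
  | _ n ih =>
  intro hn
  have hm1 := M.one_lt_m hd
  have hm : 0 < M.m := one_pos.trans hm1
  obtain ⟨K, hK, hexp⟩ := M.exists_expansion hd
  obtain ⟨V, σ, hσ, hVsurj, hV⟩ := M.exists_subseq_tendsto hd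
  obtain ⟨C, hC, hTay⟩ := exists_trigPoly_sub_taylor_le b (n + 1)
  obtain ⟨C₁, hC₁, hB₁⟩ := hdual.1.exists_bessel_shift
  obtain ⟨C₂, hC₂, hB₂⟩ := hdual.2.1.exists_bessel_shift
  have hφ : InH s φ := hdual.1.1.mem_phi
  have hφ' : InH (-s) φ' := hdual.2.1.1.mem_phi
  set P : Rd d → ℂ := taylorPart b n with hP
  have hPc : Continuous P := continuous_taylorPart b n
  set q : Rd d → ℂ := fun ξ => P (V ξ) with hq
  have hqc : Continuous q := hPc.comp V.continuous
  -- The choice `K ρ < 1` keeps the images of `E` under all inverse powers of `Mᵀ` inside the unit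
  -- ball, as the weak limit requires.
  set ρ : ℝ := (K + 1)⁻¹ with hρ
  have hρ0 : 0 < ρ := by positivity
  have hKρ : K * ρ < 1 := by
    rw [hρ, ← div_eq_mul_inv, div_lt_one (by positivity)]
    linarith
  have hρ1 : ρ < 1 := inv_lt_one_of_one_lt₀ (by linarith)
  set E : Set (Rd d) := Metric.ball 0 ρ with hE
  have hEm : MeasurableSet E := measurableSet_ball
  have hE1 : ∀ ξ ∈ E, ‖ξ‖ < 1 := fun ξ hξ => (mem_ball_zero_iff.mp hξ).trans hρ1
  have hr : Tendsto (fun J : ℕ => (M.m ^ J)⁻¹) atTop (𝓝 0) :=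
    tendsto_inv_atTop_zero.comp (tendsto_pow_atTop_atTop_of_one_lt hm1)
  have hr1 : ∀ J : ℕ, (M.m ^ J)⁻¹ ≤ 1 := fun J => inv_le_one_of_one_le₀ (one_le_pow₀ hm1.le)
  have hsmall : ∀ (J : ℕ), ∀ ξ ∈ E, ‖(M.tr ^ J).symm ξ‖ ≤ K * ρ * (M.m ^ J)⁻¹ := by
    intro J ξ hξ
    refine (hexp J ξ).trans ?_
    rw [mul_right_comm]
    gcongr
    exact (mem_ball_zero_iff.mp hξ).le
  have hsmall' : ∀ (J : ℕ), ∀ ξ ∈ E, ‖(M.tr ^ J).symm ξ‖ ≤ (M.m ^ J)⁻¹ := fun J ξ hξ =>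
    (hsmall J ξ hξ).trans (mul_le_of_le_one_left (by positivity) hKρ.le)
  have hsmall1 : ∀ (J : ℕ), ∀ ξ ∈ E, ‖(M.tr ^ J).symm ξ‖ < 1 := fun J ξ hξ =>
    (hsmall J ξ hξ).trans_lt ((mul_le_of_le_one_right (by positivity) (hr1 J)).trans_lt hKρ)
  have hsupp : ∀ (J : ℕ) (ξ : Rd d), 1 ≤ ‖ξ‖ → (M.tr ^ J) ξ ∉ E := by
    intro J ξ hξ h
    have := hsmall1 J _ h
    rw [ContinuousLinearEquiv.symm_apply_apply] at this
    exact this.not_ge hξ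
  obtain ⟨c, hc⟩ := (isCompact_closedBall (0 : Rd d) 1).exists_bound_of_continuousOn
    hqc.continuousOn
  have hqE : ∀ ξ ∈ E, ‖q ξ‖ ≤ c := fun ξ hξ => hc ξ (by
    rw [mem_closedBall_zero_iff]; exact (hE1 ξ hξ).le)
  have hc0 : 0 ≤ c := (norm_nonneg _).trans (hc 0 (by simp))
  -- the weak limit
  have hlim := (tendsto_integral_hat_mul_conj_hat hd hdual
    (F := E.indicator fun ξ => q ξ * starRingEnd ℂ (q ξ)) (G := E.indicator fun _ => 1)
    (((hqc.mul (Complex.continuous_conj.comp hqc)).measurable.indicator hEm).aestronglyMeasurable)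
    (measurable_const.indicator hEm).aestronglyMeasurable (CF := c * c) (CG := 1)
    (fun ξ => by
      by_cases h : ξ ∈ E
      · rw [Set.indicator_of_mem h, norm_mul, RCLike.norm_conj]
        exact mul_le_mul (hqE ξ h) (hqE ξ h) (norm_nonneg _) hc0
      · rw [Set.indicator_of_notMem h, norm_zero]; positivity)
    (fun ξ => by
      by_cases h : ξ ∈ E
      · rw [Set.indicator_of_mem h, norm_one]
      · rw [Set.indicator_of_notMem h, norm_zero]; exact zero_le_one)
    (fun J ξ hξ => Set.indicator_of_notMem (hsupp J ξ hξ) _)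
    (fun J ξ hξ => Set.indicator_of_notMem (hsupp J ξ hξ) _)).comp hσ.tendsto_atTop
  -- the approximation of the mask
  have happrox : ∀ ε > 0, ∀ᶠ i in atTop, ∀ᵐ ξ, ξ ∈ E →
      ‖((M.m ^ σ i : ℝ) : ℂ) ^ n * trigPoly b ((M.tr ^ σ i).symm ξ) - q ξ‖ ≤ ε ∧
      ‖((M.m ^ σ i : ℝ) : ℂ) ^ n * trigPoly b ((M.tr ^ σ i).symm ξ) *
        hat φ' ((M.tr ^ σ i).symm ξ)‖ ≤ ε := by
    intro ε hε
    have huc := (isCompact_closedBall (0 : Rd d) 1).uniformContinuousOn_of_continuous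
      hPc.continuousOn
    obtain ⟨δ₁, hδ₁, huc⟩ := Metric.uniformContinuousOn_iff.mp huc (ε / 2) (by positivity)
    set T := ‖(M.tr : Rd d →L[ℝ] Rd d)‖ with hT
    obtain ⟨δ₂, hδ₂, hvan⟩ := hvm.hat_le (ε := ε / (T ^ κ + 1)) (by positivity)
    have hrσ := hr.comp hσ.tendsto_atTop
    have ev1 := Metric.tendsto_nhds.mp hV δ₁ hδ₁
    have ev2 : ∀ᶠ i in atTop, C * (M.m ^ σ i)⁻¹ < ε / 2 := by
      have := hrσ.const_mul C
      rw [mul_zero] at this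
      exact this.eventually_lt_const (by positivity)
    have ev3 : ∀ᶠ i in atTop, T * (M.m ^ σ i)⁻¹ < δ₂ := by
      have := hrσ.const_mul T
      rw [mul_zero] at this
      exact this.eventually_lt_const hδ₂
    have hVapp : ∀ ξ, Tendsto (fun i => (M.m ^ σ i) • ((M.tr ^ σ i).symm ξ)) atTop (𝓝 (V ξ)) :=
      fun ξ => ((ContinuousLinearMap.apply ℝ (Rd d) ξ).continuous.tendsto V).comp hV
    have hVJ1 : ∀ i, ∀ ξ ∈ E, ‖(M.m ^ σ i) • ((M.tr ^ σ i).symm ξ)‖ ≤ 1 := by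
      intro i ξ hξ
      have hmJ : 0 < M.m ^ σ i := by positivity
      rw [norm_smul, Real.norm_of_nonneg hmJ.le]
      calc M.m ^ σ i * ‖(M.tr ^ σ i).symm ξ‖ ≤ M.m ^ σ i * (M.m ^ σ i)⁻¹ := by
            gcongr; exact hsmall' _ ξ hξ
        _ = 1 := mul_inv_cancel₀ hmJ.ne'
    have hV1 : ∀ ξ ∈ E, ‖V ξ‖ ≤ 1 := fun ξ hξ =>
      le_of_tendsto (hVapp ξ).norm (Eventually.of_forall fun i => hVJ1 i ξ hξ)
    filter_upwards [ev1, ev2, ev3] with i h1 h2 h3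
    set J := σ i
    have hmJ : 0 < M.m ^ J := by positivity
    filter_upwards [ae_comp_equiv (M.tr ^ J).symm hb,
      ae_comp_equiv (M.tr ^ J).symm (ae_comp_equiv M.tr hvan)] with ξ e1 e2 hξ
    constructor
    · have a1 : ‖P ((M.m ^ J) • ((M.tr ^ J).symm ξ)) - P (V ξ)‖ ≤ ε / 2 := by
        rw [← dist_eq_norm]
        refine (huc _ (by rw [mem_closedBall_zero_iff]; exact hVJ1 i ξ hξ) _
          (by rw [mem_closedBall_zero_iff]; exact hV1 ξ hξ) ?_).le
        rw [dist_eq_norm] at h1 ⊢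
        refine lt_of_le_of_lt ?_ h1
        have := ((M.m ^ J) • (((M.tr ^ J).symm : Rd d ≃L[ℝ] Rd d) : Rd d →L[ℝ] Rd d)
          - V).le_opNorm ξ
        exact this.trans (mul_le_of_le_one_right (norm_nonneg _) (hE1 ξ hξ).le)
      have a2 : ‖trigPoly b ((M.tr ^ J).symm ξ) - P ((M.tr ^ J).symm ξ)‖
          ≤ C * ((M.m ^ J)⁻¹) ^ (n + 1) := by
        have := hTay _ (hsmall1 J ξ hξ).le
        rw [Finset.sum_range_succ, Finset.sum_eq_zero (fun k hk => ih k (Finset.mem_range.mp hk)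
          ((Finset.mem_range.mp hk).le.trans hn) _), zero_add] at this
        refine this.trans ?_
        gcongr
        exact hsmall' J ξ hξ
      have a3 : ((M.m ^ J : ℝ) : ℂ) ^ n * trigPoly b ((M.tr ^ J).symm ξ) - q ξ
          = ((M.m ^ J : ℝ) : ℂ) ^ n * (trigPoly b ((M.tr ^ J).symm ξ) - P ((M.tr ^ J).symm ξ))
            + (P ((M.m ^ J) • ((M.tr ^ J).symm ξ)) - P (V ξ)) := by
        rw [hP, taylorPart_smul, hq]
        ring
      rw [a3]
      refine (norm_add_le _ _).trans ?_
      rw [norm_mul, norm_pow, Complex.norm_real, Real.norm_of_nonneg hmJ.le]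
      -- The remainder has order `n + 1` while the rescaling costs only `n` powers, so one factor
      -- `m^{-J}` is left.
      have a4 : (M.m ^ J) ^ n * (C * ((M.m ^ J)⁻¹) ^ (n + 1)) = C * (M.m ^ J)⁻¹ := by
        rw [pow_succ, inv_pow]
        field_simp
      have a5 := mul_le_mul_of_nonneg_left a2 (by positivity : 0 ≤ (M.m ^ J) ^ n)
      rw [a4] at a5
      linarith
    · rw [mul_assoc, ← e1, norm_mul, norm_pow, Complex.norm_real, Real.norm_of_nonneg hmJ.le]
      have a1 : ‖M.tr ((M.tr ^ J).symm ξ)‖ ≤ T * (M.m ^ J)⁻¹ :=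
        ((M.tr : Rd d →L[ℝ] Rd d).le_opNorm _).trans (by gcongr; exact hsmall' J ξ hξ)
      have a2 := e2 (a1.trans_lt h3)
      -- In the extreme case `n = κ` the rescaling uses up the whole power `κ`; smallness then comes
      -- only from the little-o in the vanishing moments.
      have a3 : (M.m ^ J) ^ n ≤ (M.m ^ J) ^ κ := pow_le_pow_right₀ (one_le_pow₀ hm1.le) hn
      calc (M.m ^ J) ^ n * ‖hat (ψ' l) (M.tr ((M.tr ^ J).symm ξ))‖
          ≤ (M.m ^ J) ^ κ * (ε / (T ^ κ + 1) * (T * (M.m ^ J)⁻¹) ^ κ) := by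
            gcongr
            refine a2.trans ?_
            gcongr
        _ = ε * (T ^ κ / (T ^ κ + 1)) := by
            rw [mul_pow, inv_pow]
            field_simp
        _ ≤ ε := by
            refine mul_le_of_le_one_right hε.le ?_
            rw [div_le_one (by positivity)]
            linarith
  -- the weak limit vanishes
  have h1int : Integrable (E.indicator fun _ => (1 : ℝ)) (volume : Measure (Rd d)) :=
    (integrable_indicator_iff hEm).mpr (integrableOn_const measure_ball_lt_top.ne)
  set I1 := ∫ ξ, E.indicator (fun _ => (1 : ℝ)) ξ with hI1
  have hI1n : 0 ≤ I1 := integral_nonneg fun ξ => Set.indicator_nonneg (fun _ _ => zero_le_one) _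
  set D := c * (C₁ * 2 ^ |(-s)| * I1 + C₂ * 2 ^ |(-(-s))| * I1 + I1) with hD
  have hD0 : 0 ≤ D := by positivity
  have hbound : ∀ ε > 0, ‖∫ ξ, E.indicator (fun ξ => q ξ * starRingEnd ℂ (q ξ)) ξ *
      starRingEnd ℂ (E.indicator (fun _ => (1 : ℂ)) ξ)‖ ≤ D * ε := by
    intro ε hε
    refine le_of_tendsto hlim.norm ?_
    filter_upwards [happrox ε hε] with i hi
    refine (norm_integral_sq_mul_le
      (hφ.wtL2.comp (M.tr ^ σ i).symm |>.integrable_indicator_sq hEm hE1)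
      (hφ'.wtL2.comp (M.tr ^ σ i).symm |>.integrable_indicator_sq hEm hE1) h1int hc0 hε.le hqE
      hi).trans ?_
    have b1 := setIntegral_hat_comp_sq_le hd M hφ hC₁ hB₁ (M.tr ^ σ i).symm hEm (hsmall1 (σ i))
    have b2 := setIntegral_hat_comp_sq_le hd M hφ' hC₂ hB₂ (M.tr ^ σ i).symm hEm (hsmall1 (σ i))
    calc _ ≤ c * ε * (C₁ * 2 ^ |(-s)| * I1 + C₂ * 2 ^ |(-(-s))| * I1 + I1) := by gcongr
      _ = D * ε := by rw [hD]; ring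
  have hzero : ∫ ξ, E.indicator (fun ξ => ‖q ξ‖ ^ 2) ξ = 0 := by
    have e : ∫ ξ, E.indicator (fun ξ => q ξ * starRingEnd ℂ (q ξ)) ξ *
        starRingEnd ℂ (E.indicator (fun _ => (1 : ℂ)) ξ)
        = ((∫ ξ, E.indicator (fun ξ => ‖q ξ‖ ^ 2) ξ : ℝ) : ℂ) := by
      rw [← integral_complex_ofReal]
      refine integral_congr_ae (Eventually.of_forall fun ξ => ?_)
      by_cases h : ξ ∈ E
      · simp only [Set.indicator_of_mem h, map_one, mul_one]
        rw [Complex.mul_conj, Complex.normSq_eq_norm_sq]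
      · simp [Set.indicator_of_notMem h]
    rw [e] at hbound
    have h0 : ‖((∫ ξ, E.indicator (fun ξ => ‖q ξ‖ ^ 2) ξ : ℝ) : ℂ)‖ ≤ 0 := by
      refine le_of_forall_pos_le_add fun δ hδ => ?_
      refine (hbound (δ / (D + 1)) (by positivity)).trans ?_
      rw [zero_add, mul_div_assoc', div_le_iff₀ (by positivity)]
      nlinarith
    have := norm_le_zero_iff.mp h0
    exact_mod_cast this
  have hqint : Integrable (E.indicator fun ξ => ‖q ξ‖ ^ 2) volume := by
    refine (integrable_indicator_iff hEm).mpr ?_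
    exact ((hqc.norm.pow 2).continuousOn.integrableOn_compact
      (isCompact_closedBall (0 : Rd d) ρ)).mono_set Metric.ball_subset_closedBall
  have hqae : ∀ᵐ ξ, E.indicator (fun ξ => ‖q ξ‖ ^ 2) ξ = 0 :=
    (integral_eq_zero_iff_of_nonneg
      (fun ξ => Set.indicator_nonneg (fun _ _ => by positivity) _) hqint).mp hzero
  have hqE0 : ∀ ξ ∈ E, q ξ = 0 := by
    have h1 : q =ᵐ[volume.restrict E] fun _ => (0 : ℂ) := by
      rw [Filter.EventuallyEq, ae_restrict_iff' hEm]
      filter_upwards [hqae] with ξ hξ h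
      rw [Set.indicator_of_mem h] at hξ
      exact norm_eq_zero.mp (pow_eq_zero_iff two_ne_zero |>.mp hξ)
    exact Measure.eqOn_open_of_ae_eq h1 Metric.isOpen_ball hqc.continuousOn continuousOn_const
  intro η
  obtain ⟨ξ, rfl⟩ := hVsurj η
  -- Vanishing of `q` on the ball extends to the whole space because `P` is homogeneous and `V` is
  -- linear and surjective.
  set t : ℝ := ρ / (‖ξ‖ + 1) with ht
  have ht0 : 0 < t := by positivity
  have htE : t • ξ ∈ E := by
    rw [hE, mem_ball_zero_iff, norm_smul, Real.norm_of_nonneg ht0.le, ht, div_mul_eq_mul_div,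
      div_lt_iff₀ (by positivity)]
    nlinarith
  have h1 := hqE0 _ htE
  rw [hq] at h1
  simp only [map_smul] at h1
  rw [hP, taylorPart_smul] at h1
  refine (mul_eq_zero.mp h1).resolve_left (pow_ne_zero _ ?_)
  exact_mod_cast ht0.ne'

/-! ## Convergence of the truncated series -/

theorem hasSumH_iff {ι : Type*} {σ : ℝ} {F : ι → Dist d} {u : Dist d} (hF : ∀ i, InH σ (F i))
    (hu : InH σ u) : HasSumH σ F u ↔ HasSum (fun i => toL2 σ (F i)) (toL2 σ u) := by
  have h1 : ∀ T : Finset ι, normH σ (u - ∑ i ∈ T, F i) = ‖∑ i ∈ T, toL2 σ (F i) - toL2 σ u‖ := by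
    intro T
    have h2 : InH σ (∑ i ∈ T, F i) := InH.sum T fun i _ => hF i
    rw [normH_eq_norm (hu.sub h2), toL2_sub hu h2, toL2_sum T fun i _ => hF i, norm_sub_rev]
  have h3 : HasSum (fun i => toL2 σ (F i)) (toL2 σ u) ↔
      Tendsto (fun T : Finset ι => normH σ (u - ∑ i ∈ T, F i)) atTop (𝓝 0) := by
    simp only [h1]
    exact tendsto_iff_norm_sub_tendsto_zero
  rw [h3]
  exact ⟨fun h => h.2.2, fun h => ⟨hF, hu, h⟩⟩

theorem exists_hasSumH_smul {ι : Type*} {σ : ℝ} {a : ι → Dist d} (ha : ∀ i, InH σ (a i)) {C : ℝ}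
    (hC : 0 ≤ C)
    (hB : ∀ f : Dist d, InH σ f →
      ∑' i, ‖innerH σ f (a i)‖ₑ ^ 2 ≤ ENNReal.ofReal (C * normH σ f ^ 2))
    {c : ι → ℂ} (hc : ∑' i, ‖c i‖ₑ ^ 2 ≠ ⊤) : ∃ u, HasSumH σ (fun i => c i • a i) u := by
  have h1 : Summable fun i => c i • toL2 σ (a i) := by
    refine summable_smul_of_bessel hC (fun x => ?_) hc
    obtain ⟨f, hf, rfl⟩ := toL2_surjective σ x
    rw [← normH_eq_norm hf]
    simpa only [innerH_eq_inner hf (ha _)] using hB f hf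
  obtain ⟨u, hu, hu2⟩ := toL2_surjective σ (∑' i, c i • toL2 σ (a i))
  refine ⟨u, (hasSumH_iff (fun i => (ha i).smul _) hu).2 ?_⟩
  simp only [toL2_smul _ (ha _), hu2]
  exact h1.hasSum

theorem IsTruncatedSeries.normH_sub_sq_le (hd : 0 < d) {L : ℕ} {M : Dilation d} {s : ℝ}
    {φ φ' : Dist d} {ψ ψ' : Fin L → Dist d} (hdual : IsDualPair M s φ ψ φ' ψ') {C R : ℝ}
    (hC : 0 < C) (hR : 0 ≤ R)
    (hB : ∀ f : Dist d, InH s f → ∑ l, ∑' j, ∑' k, ‖innerH s f (atom M s (ψ l) j k)‖ₑ ^ 2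
      ≤ ENNReal.ofReal (C * normH s f ^ 2))
    {f S : Dist d} (hf : InH s f)
    (hfin : ∑ l, ∑' j, ∑' k, ‖pairing f (atom M (-s) (ψ' l) j k)‖ₑ ^ 2 ≠ ⊤) {N : ℕ}
    (htail : ∑ l, ∑' j, ∑' k, ‖pairing f (atom M (-s) (ψ' l) (j + N) k)‖ₑ ^ 2 ≤ ENNReal.ofReal R)
    (hS : IsTruncatedSeries M s φ ψ φ' ψ' N f S) : normH s (f - S) ^ 2 ≤ C * R := by
  have hφ : ∀ k, InH s (shift φ k) := inH_shift hd M hdual.1.1.mem_phi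
  have hφ' : ∀ k, InH (-s) (shift φ' k) := inH_shift hd M hdual.2.1.1.mem_phi
  have hψ : ∀ l j k, InH s (atom M s (ψ l) j k) := fun l => inH_atom hd M s (hdual.1.1.mem_psi l)
  have hψ' : ∀ l j k, InH (-s) (atom M (-s) (ψ' l) j k) := fun l =>
    inH_atom hd M (-s) (hdual.2.1.1.mem_psi l)
  obtain ⟨u, v, hu, hv, rfl⟩ := hS
  have hvj : ∀ l, ∀ j ∈ Finset.range N, InH s (v l j) := fun l j hj =>
    (hv l j (Finset.mem_range.1 hj)).2.1
  have hvl : ∀ l ∈ Finset.univ, InH s (∑ j ∈ Finset.range N, v l j) := fun l _ => InH.sum _ (hvj l)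
  have hvs := InH.sum _ hvl
  have e : toL2 s (f - (u + ∑ l, ∑ j ∈ Finset.range N, v l j)) =
      toL2 s f - (toL2 s u + ∑ l, ∑ j ∈ Finset.range N, toL2 s (v l j)) := by
    rw [toL2_sub hf (hu.2.1.add hvs), toL2_add hu.2.1 hvs, toL2_sum _ hvl]
    simp only [toL2_sum _ (hvj _)]
  rw [normH_eq_norm (hf.sub (hu.2.1.add hvs)), e]
  simp only [pairing_eq_inner hf (hψ' _ _ _)] at hfin htail
  refine norm_sub_truncated_sq_le (e0 := fun k => toL2 s (shift φ k))
    (e0' := fun k => toL2 (-s) (shift φ' k)) (e := fun l j k => toL2 s (atom M s (ψ l) j k))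
    (e' := fun l j k => toL2 (-s) (atom M (-s) (ψ' l) j k)) hC hR ?_ ?_ hfin htail ?_ ?_
  · intro x
    obtain ⟨g, hg, rfl⟩ := toL2_surjective s x
    rw [← normH_eq_norm hg]
    simpa only [innerH_eq_inner hg (hψ _ _ _)] using hB g hg
  · intro y
    obtain ⟨g, hg, rfl⟩ := toL2_surjective (-s) y
    have h := hdual.2.2 f g hf hg
    simpa only [pairing_eq_inner hf hg, pairing_eq_inner hf (hφ' _),
      pairing_eq_inner hf (hψ' _ _ _), pairing_eq_inner (hφ _) hg,
      pairing_eq_inner (hψ _ _ _) hg] using h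
  · have h := (hasSumH_iff hu.1 hu.2.1).1 hu
    simpa only [toL2_smul _ (hφ _), pairing_eq_inner hf (hφ' _)] using h
  · intro l j hj
    have h := (hasSumH_iff (hv l j hj).1 (hv l j hj).2.1).1 (hv l j hj)
    simpa only [toL2_smul _ (hψ _ _ _), pairing_eq_inner hf (hψ' _ _ _)] using h

theorem exists_isTruncatedSeries (hd : 0 < d) {L : ℕ} {M : Dilation d} {s : ℝ}
    {φ φ' : Dist d} {ψ ψ' : Fin L → Dist d} (hdual : IsDualPair M s φ ψ φ' ψ') {f : Dist d}
    (hf : InH s f) (N : ℕ) : ∃ S, IsTruncatedSeries M s φ ψ φ' ψ' N f S := by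
  have hle : ∀ (t : Fin L → ℕ → ℝ≥0∞) l j, t l j ≤ ∑ l, ∑' j, t l j := fun t l j =>
    (ENNReal.le_tsum j).trans
      (Finset.single_le_sum (f := fun l => ∑' j, t l j) (fun _ _ => zero_le) (Finset.mem_univ l))
  obtain ⟨C₀, hC₀, hB₀⟩ := hdual.1.exists_bessel_shift
  obtain ⟨C₁, hC₁, hB₁⟩ := hdual.1.exists_bessel_atom
  obtain ⟨C₂, hC₂, hB₂⟩ := hdual.2.1.exists_bessel_shift
  obtain ⟨C₃, hC₃, hB₃⟩ := hdual.2.1.exists_bessel_atom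
  have hφ' : ∀ k, InH (-s) (shift φ' k) := inH_shift hd M hdual.2.1.1.mem_phi
  have hψ' : ∀ l j k, InH (-s) (atom M (-s) (ψ' l) j k) := fun l =>
    inH_atom hd M (-s) (hdual.2.1.1.mem_psi l)
  -- Here `g` is the Riesz representative of `f` in `H^{-s}`; the frame bound of the dual system at
  -- `g` makes the coefficients square summable.
  obtain ⟨g, hg, hgf⟩ := toL2_surjective (-s) (toL2 s f)
  have hpair : ∀ a : Dist d, InH (-s) a → pairing f a = innerH (-s) g a := fun a ha => by
    rw [pairing_eq_inner hf ha, innerH_eq_inner hg ha, hgf]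
  have hu : ∃ u, HasSumH s (fun k : Fin d → ℤ => pairing f (shift φ' k) • shift φ k) u := by
    refine exists_hasSumH_smul (inH_shift hd M hdual.1.1.mem_phi) hC₀.le hB₀
      (ne_top_of_le_ne_top (b := ENNReal.ofReal (C₂ * normH (-s) g ^ 2)) ENNReal.ofReal_ne_top ?_)
    simpa only [hpair _ (hφ' _)] using hB₂ g hg
  have hv : ∀ l j, ∃ v, HasSumH s (fun k : Fin d → ℤ =>
      pairing f (atom M (-s) (ψ' l) j k) • atom M s (ψ l) j k) v := by
    intro l j
    refine exists_hasSumH_smul (inH_atom hd M s (hdual.1.1.mem_psi l) j) hC₁.le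
      (fun h hh => (hle (fun l j => ∑' k, ‖innerH s h (atom M s (ψ l) j k)‖ₑ ^ 2) l j).trans
        (hB₁ h hh)) (ne_top_of_le_ne_top (b := ENNReal.ofReal (C₃ * normH (-s) g ^ 2))
        ENNReal.ofReal_ne_top ?_)
    simp only [hpair _ (hψ' _ _ _)]
    exact (hle (fun l j => ∑' k, ‖innerH (-s) g (atom M (-s) (ψ' l) j k)‖ₑ ^ 2) l j).trans
      (hB₃ g hg)
  obtain ⟨u, hu⟩ := hu
  choose v hv using hv
  exact ⟨_, u, v, hu, fun l j _ => hv l j, rfl⟩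

theorem sum_tsum_le_of_geometric {L : ℕ} {t : Fin L → ℕ → ℝ≥0∞} {D : Fin L → ℝ} {A r : ℝ}
    (hD : ∀ l, 0 ≤ D l) (hA : 0 ≤ A) (hr : 0 ≤ r) (hr1 : r < 1)
    (ht : ∀ l j, t l j ≤ ENNReal.ofReal (D l * A * r ^ j)) (N : ℕ) :
    ∑ l, ∑' j, t l (j + N) ≤ ENNReal.ofReal ((∑ l, D l) * A * r ^ N / (1 - r)) := by
  have h1 : ∀ l, ∑' j, t l (j + N) ≤ ENNReal.ofReal (D l * A * r ^ N / (1 - r)) := by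
    intro l
    have h2 : HasSum (fun j : ℕ => D l * A * r ^ (j + N)) (D l * A * r ^ N / (1 - r)) := by
      have := (hasSum_geometric_of_lt_one hr hr1).mul_left (D l * A * r ^ N)
      simpa only [pow_add, mul_comm, mul_left_comm, mul_assoc, div_eq_mul_inv] using this
    rw [← h2.tsum_eq, ENNReal.ofReal_tsum_of_nonneg
      (fun j => mul_nonneg (mul_nonneg (hD l) hA) (pow_nonneg hr _)) h2.summable]
    exact ENNReal.tsum_le_tsum fun j => ht l _
  refine (Finset.sum_le_sum fun l _ => h1 l).trans ?_
  rw [← ENNReal.ofReal_sum_of_nonneg, Finset.sum_mul, Finset.sum_mul, Finset.sum_div]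
  exact fun l _ => div_nonneg (mul_nonneg (mul_nonneg (hD l) hA) (pow_nonneg hr _)) (by linarith)

end Framelet

end

theorem theorem2p2 {d : ℕ} (hd : 0 < d) {L : ℕ} (M : Dilation d) (s ς : ℝ) (κ : ℕ)
    (hs : 0 < s) (hsς : s < ς) (hςκ : ς < (κ : ℝ) + 1)
    (φ φ' : Dist d) (ψ ψ' : Fin L → Dist d)
    (hdual : IsDualPair M s φ ψ φ' ψ')
    (hφ : InH ς φ)
    (hvm : ∀ l, HasVanishingMoments κ (ψ' l)) :
    ∃ C : ℝ, 0 < C ∧ ∀ f : Dist d, InH ς f → ∀ N : ℕ,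
      (∃ S : Dist d, IsTruncatedSeries M s φ ψ φ' ψ' N f S) ∧
      ∀ S : Dist d, IsTruncatedSeries M s φ ψ φ' ψ' N f S →
        normH s (f - S) ≤ C * normH ς f * M.m ^ (-(N : ℝ) * (ς - s) / 2) := by
  have hm := M.one_lt_m hd
  have hm0 : 0 < M.m := one_pos.trans hm
  obtain ⟨C₁, hC₁, hB₁⟩ := hdual.1.exists_bessel_atom
  obtain ⟨C₂, hC₂, hB₂⟩ := hdual.2.1.exists_bessel_shift
  have hdecay : ∀ l, ∃ D : ℝ, 0 ≤ D ∧ ∀ f : Dist d, InH ς f → ∀ j : ℕ,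
      ∑' k, ‖pairing f (atom M (-s) (ψ' l) j k)‖ₑ ^ 2 ≤
        ENNReal.ofReal (D * normH ς f ^ 2 * (M.m ^ (-2 * (ς - s))) ^ j) := by
    intro l
    obtain ⟨b, hb⟩ := hdual.2.1.1.wavelet l
    obtain ⟨B, hB, hbB⟩ :=
      exists_trigPoly_weight_le (taylorPart_eq_zero hd hdual (hvm l) hb) hs hsς hςκ
    exact exists_coefficient_decay hd M (hs.trans hsς) hdual.2.1.1.mem_phi
      (hdual.2.1.1.mem_psi l) hb hC₂ hB₂ hB hbB
  choose D hD hdecay using hdecay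
  set r : ℝ := M.m ^ (-2 * (ς - s)) with hr
  have hr0 : 0 < r := Real.rpow_pos_of_pos hm0 _
  have hr1 : r < 1 := Real.rpow_lt_one_of_one_lt_of_neg hm (by linarith)
  have hD0 : 0 ≤ ∑ l, D l := Finset.sum_nonneg fun l _ => hD l
  have h1r : 0 < 1 - r := by linarith
  set K : ℝ := C₁ * (∑ l, D l) / (1 - r) with hK
  have hK0 : 0 ≤ K := div_nonneg (mul_nonneg hC₁.le hD0) h1r.le
  -- `√K` suffices for the estimate; the `+ 1` ensures positivity when all the decay constants
  -- vanish.
  refine ⟨√K + 1, by positivity, fun f hf N =>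
    ⟨exists_isTruncatedSeries hd hdual (hf.mono hsς.le) N, fun S hS => ?_⟩⟩
  have hgeom := sum_tsum_le_of_geometric hD (sq_nonneg (normH ς f)) hr0.le hr1
    (fun l j => hdecay l f hf j)
  have hsq := hS.normH_sub_sq_le hd hdual hC₁ (by positivity) hB₁ (hf.mono hsς.le)
    (ne_top_of_le_ne_top ENNReal.ofReal_ne_top (hgeom 0)) (hgeom N)
  have hrN : r ^ N = (M.m ^ (-(N : ℝ) * (ς - s))) ^ 2 := by
    rw [hr, ← Real.rpow_natCast, ← Real.rpow_natCast, ← Real.rpow_mul hm0.le,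
      ← Real.rpow_mul hm0.le]
    congr 1
    push_cast
    ring
  have hn := normH_nonneg ς f
  -- The argument gives twice the required exponent; the claim follows since `m > 1` and `ς > s`.
  have hfull : normH s (f - S) ≤ √K * normH ς f * M.m ^ (-(N : ℝ) * (ς - s)) := by
    refine le_of_sq_le_sq ?_ (by positivity)
    refine hsq.trans_eq ?_
    rw [mul_pow, mul_pow, Real.sq_sqrt hK0, hrN, hK]
    ring
  refine hfull.trans ?_
  have hexp : -(N : ℝ) * (ς - s) ≤ -(N : ℝ) * (ς - s) / 2 := by
    have : 0 ≤ (N : ℝ) * (ς - s) := mul_nonneg N.cast_nonneg (by linarith)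
    linarith
  gcongr
  · linarith
  · exact hm.le
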